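/- Let $F$ be a field of characteristic $p>3$, let $m,n\ge 3$ be integers and let $t=(t_1,\dots,t_m)$ be a tuple of positive integers. Let $\mathfrak A(m,n)$ be the tensor product of the divided power algebra in $m$ variables and the exterior algebra in $n$ variables $\xi_1,\dots,\xi_n$ over $F$. It has the basis $x^{(\alpha)}x^u$, with $\alpha\in\mathbb N_0^m$, $u=\{k_1<\dots<k_l\}\subseteq\{1,\dots,n\}$ and $x^u=\xi_{k_1}\cdots\xi_{k_l}$, and its multiplication is determined by $x^{(\alpha)}x^{(\beta)}=\prod_i\binom{\alpha_i+\beta_i}{\alpha_i}x^{(\alpha+\beta)}$, $\xi_k\xi_l=-\xi_l\xi_k$, $\xi_k^2=0$ and $x^{(\alpha)}\xi_k=\xi_kx^{(\alpha)}$. It is $\mathbb Z_2$-graded: the parity $\mathrm p(x^{(\alpha)}x^u)$ is $|u|$ modulo $2$. Put $Y_0=\{1,\dots,m\}$, $Y_1=\{m+1,\dots,m+n\}$, $Y=Y_0\cup Y_1$, and $\tau(r)=\bar 0$ for $r\in Y_0$, $\tau(r)=\bar 1$ for $r\in Y_1$. For $r\in Y$ let $D_r$ be the superderivation of $\mathfrak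 A(m,n)$ of parity $\tau(r)$ with $D_r(x^{(\alpha)}x^u)=x^{(\alpha-\varepsilon_r)}x^u$ if $r\in Y_0$ (where $x^{(\alpha-\varepsilon_r)}=0$ if $\alpha_r=0$), and, if $r=m+k\in Y_1$, $D_r(x^{(\alpha)})=0$ and $D_r(\xi_l)=\delta_{kl}$. Let $\mathfrak A(m,n;t)$ be the span of all $x^{(\alpha)}x^u$ with $\alpha_i\le p^{t_i}-1$ for all $i\in Y_0$. Put $$W(m,n;t)=\Big\{\sum_{r\in Y}f_rD_r : f_r\in\mathfrak A(m,n;t)\Big\},$$ $$S(m,n;t)=\operatorname{span}_F\{D_{rs}(f) : r,s\in Y,\ f\in\mathfrak A(m,n;t)\},$$ where, for $f$ homogeneous (and extended linearly), $$D_{rs}(f)=(-1)^{\tau(r)\tau(s)}D_r(f)D_s-(-1)^{(\tau(r)+\tau(s))\mathrm p(f)}D_s(f)D_r .$$ Let $\mathcal W$ and $\mathcal S$ be the even parts of $W(m,n;t)$ and $S(m,n;t)$, that is, the subspaces of their parity-preserving elements (as operators on $\mathfrak A(m,n)$). With the commutator as bracket, $\mathcal W$ is a Lie algebra and $\mathcal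 S$ is a Lie subalgebra of $\mathcal W$; thus $\mathcal W$ is an $\mathcal S$-module under the adjoint action. Let $\operatorname{Der}(\mathcal S,\mathcal W)$ be the space of derivations from $\mathcal S$ into $\mathcal W$, that is, of all linear maps $\varphi:\mathcal S\to\mathcal W$ with $\varphi([x,y])=[x,\varphi(y)]-[y,\varphi(x)]$ for all $x,y\in\mathcal S$. Then $$\operatorname{Der}(\mathcal S,\mathcal W)=\operatorname{ad}\mathcal W\ \oplus\ \operatorname{span}_F\{(\operatorname{ad}D_i)^{p^{r_i}} : i\in Y_0,\ 1\le r_i<t_i\},$$ where all maps on the right-hand side are restricted to $\mathcal S$, that is, $\operatorname{ad}\mathcal W=\{(\operatorname{ad}E)|_{\mathcal S}:E\in\mathcal W\}$ and $(\operatorname{ad}D_i)^{p^{r_i}}$ stands for its restriction to $\mathcal S$. -/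

import Mathlib

namespace CartanType

noncomputable section

/-- The parity `τ` of an index in `Y = Y₀ ∪ Y₁`, where `Y₀` (even) is the set of the
`Sum.inl i`, `i : Fin m`, and `Y₁` (odd) is the set of the `Sum.inr k`, `k : Fin n`. -/
def tau {m n : ℕ} : Fin m ⊕ Fin n → ZMod 2
  | .inl _ => 0
  | .inr _ => 1

/-- The sign `(-1)^a` for `a ∈ ℤ/2`. -/
def sgn (F : Type*) [Field F] (a : ZMod 2) : F := if a = 0 then 1 else -1

/-- Indices of the standard basis: the pair `(α, u)` stands for `x^(α) x^u`, where
`x^u` is the product of the odd variables in `u`, in increasing order. -/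
abbrev Mon (m n : ℕ) := (Fin m → ℕ) × Finset (Fin n)

/-- The underlying space of the superalgebra `𝔄(m,n)`, the tensor product of the divided power
algebra in `m` variables and the exterior algebra in `n` variables, with its standard basis. -/
def Alg (F : Type*) [Field F] (m n : ℕ) := Mon m n →₀ F

instance (F : Type*) [Field F] (m n : ℕ) : AddCommGroup (Alg F m n) :=
  inferInstanceAs (AddCommGroup (Mon m n →₀ F))

instance (F : Type*) [Field F] (m n : ℕ) : Module F (Alg F m n) :=
  inferInstanceAs (Module F (Mon m n →₀ F))

/-- The parity of `x^(α) x^u`. -/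
def mpar {m n : ℕ} (a : Mon m n) : ZMod 2 := (a.2.card : ZMod 2)

/-- The number of inversions in the juxtaposition of `u` and `v`. -/
def inversions {n : ℕ} (u v : Finset (Fin n)) : ℕ := ∑ i ∈ u, ∑ j ∈ v, if j < i then 1 else 0

/-- The coefficient in `x^(α)x^u · x^(β)x^v = c x^(α+β)x^(u ∪ v)`. -/
def mulCoeff (F : Type*) [Field F] {m n : ℕ} (a b : Mon m n) : F :=
  if Disjoint a.2 b.2 then
    (∏ i, ((a.1 i + b.1 i).choose (a.1 i) : F)) * (-1) ^ inversions a.2 b.2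
  else 0

variable {F : Type*} [Field F] {m n : ℕ}

/-- The element `c x^(α) x^u`, where `a = (α, u)`. -/
def mono (a : Mon m n) : F →ₗ[F] Alg F m n := Finsupp.lsingle a

/-- The linear map on `𝔄(m,n)` with prescribed values on the standard basis. -/
def lin {M : Type*} [AddCommGroup M] [Module F M] (v : Mon m n → M) : Alg F m n →ₗ[F] M :=
  Finsupp.linearCombination F v

/-- The span of the basis elements with index in `s`. -/
def monSpan (F : Type*) [Field F] (s : Set (Mon m n)) : Submodule F (Alg F m n) :=
  Submodule.span F ((fun a => mono a 1) '' s)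

theorem lin_mono {M : Type*} [AddCommGroup M] [Module F M] (v : Mon m n → M) (a : Mon m n)
    (c : F) : lin v (mono a c) = c • v a := Finsupp.linearCombination_single F c a

theorem alg_ext {M : Type*} [AddCommGroup M] [Module F M] {A B : Alg F m n →ₗ[F] M}
    (h : ∀ a, A (mono a 1) = B (mono a 1)) : A = B :=
  Finsupp.lhom_ext' fun a => LinearMap.ext_ring (h a)

theorem smul_mono (a : Mon m n) (c x : F) : c • (mono a x : Alg F m n) = mono a (c * x) :=
  (map_smul (mono a) c x).symm

theorem mono_mem {s : Set (Mon m n)} {a : Mon m n} (c : F) (h : a ∈ s) :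
    mono a c ∈ monSpan F s := by
  rw [← mul_one c, ← smul_mono]
  exact Submodule.smul_mem _ _ (Submodule.subset_span ⟨a, h, rfl⟩)

theorem monSpan_coeff {s : Set (Mon m n)} {f : Alg F m n} (hf : f ∈ monSpan F s) {a : Mon m n}
    (h : a ∉ s) : (show Mon m n →₀ F from f) a = 0 := by
  induction hf using Submodule.span_induction with
  | mem x hx =>
    obtain ⟨b, hb, rfl⟩ := hx
    exact Finsupp.single_eq_of_ne (fun e => h (e ▸ hb))
  | zero => rfl
  | add x y _ _ hx hy => exact (congrArg₂ (· + ·) hx hy).trans (add_zero 0)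
  | smul c x _ hx => exact (congrArg (c * ·) hx).trans (mul_zero c)

theorem monSpan_induction {s : Set (Mon m n)} {P : Alg F m n → Prop}
    (h1 : ∀ a ∈ s, P (mono a 1))
    (h0 : P 0) (hadd : ∀ f g, P f → P g → P (f + g)) (hsmul : ∀ (c : F) f, P f → P (c • f))
    {f : Alg F m n} (hf : f ∈ monSpan F s) : P f := by
  induction hf using Submodule.span_induction with
  | mem x hx => obtain ⟨a, ha, rfl⟩ := hx; exact h1 a ha
  | zero => exact h0
  | add x y _ _ hx hy => exact hadd x y hx hy
  | smul c x _ hx => exact hsmul c x hx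

/-- Left multiplication in `𝔄(m,n)`: `mul f g = f g`. -/
def mul : Alg F m n →ₗ[F] Module.End F (Alg F m n) :=
  lin fun a =>
    lin fun b =>
      mono (a.1 + b.1, a.2 ∪ b.2) (mulCoeff F a b)

/-- The superderivations `D_r` of `𝔄(m,n)`; here `x^(β) = 0` if `β` has a negative entry. -/
def D : Fin m ⊕ Fin n → Module.End F (Alg F m n)
  | .inl i => lin fun a =>
      if 0 < a.1 i then mono (a.1 - Pi.single i 1, a.2) 1 else 0
  | .inr k => lin fun a =>
      if k ∈ a.2 then
        mono (a.1, a.2.erase k) ((-1) ^ (a.2.filter (· < k)).card)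
      else 0

/-- The homogeneous component of `𝔄(m,n)` of parity `ε`. -/
def par (F : Type*) [Field F] (m n : ℕ) (ε : ZMod 2) : Submodule F (Alg F m n) :=
  monSpan F {a | mpar a = ε}

/-- The linear map with `f ↦ (-1)^(c p(f)) f` for homogeneous `f`. -/
def twist (c : ZMod 2) : Module.End F (Alg F m n) :=
  lin fun a => mono a (sgn F (c * mpar a))

/-- The even endomorphisms of the superspace `𝔄(m,n)`. -/
def evenEnd (F : Type*) [Field F] (m n : ℕ) : Submodule F (Module.End F (Alg F m n)) where
  carrier := {A | ∀ ε, ∀ f ∈ par F m n ε, A f ∈ par F m n ε}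
  zero_mem' := fun ε _ _ => (par F m n ε).zero_mem
  add_mem' := fun hA hB ε f hf => (par F m n ε).add_mem (hA ε f hf) (hB ε f hf)
  smul_mem' := fun c _ hA ε f hf => (par F m n ε).smul_mem c (hA ε f hf)

/-- `𝔄(m,n;t)`, spanned by the `x^(α) x^u` with `α_i ≤ p^(t_i) - 1`. -/
def trunc (F : Type*) [Field F] (n p : ℕ) (t : Fin m → ℕ) : Submodule F (Alg F m n) :=
  monSpan F {a | ∀ i, a.1 i < p ^ t i}

/-- The operator `∑_r f_r D_r` on `𝔄(m,n)`. -/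
def vec (f : Fin m ⊕ Fin n → Alg F m n) : Module.End F (Alg F m n) := ∑ r, mul (f r) * D r

/-- `W(m,n;t)`, the space of all `∑_r f_r D_r` with `f_r ∈ 𝔄(m,n;t)`. -/
def W (F : Type*) [Field F] (n p : ℕ) (t : Fin m → ℕ) :
    Submodule F (Module.End F (Alg F m n)) where
  carrier := {E | ∃ f : Fin m ⊕ Fin n → Alg F m n,
    (∀ r, f r ∈ trunc F n p t) ∧ E = vec f}
  zero_mem' := ⟨0, fun _ => Submodule.zero_mem _, by simp [vec]⟩
  add_mem' := by
    rintro _ _ ⟨f, hf, rfl⟩ ⟨g, hg, rfl⟩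
    exact ⟨f + g, fun r => Submodule.add_mem _ (hf r) (hg r),
      by simp [vec, add_mul, Finset.sum_add_distrib]⟩
  smul_mem' := by
    rintro c _ ⟨f, hf, rfl⟩
    exact ⟨c • f, fun r => Submodule.smul_mem _ c (hf r), by simp [vec, Finset.smul_sum]⟩

/-- `D_rs(f) = (-1)^(τ(r)τ(s)) D_r(f) D_s - (-1)^((τ(r)+τ(s))p(f)) D_s(f) D_r`. -/
def Drs (r s : Fin m ⊕ Fin n) : Alg F m n →ₗ[F] Module.End F (Alg F m n) where
  toFun f := sgn F (tau r * tau s) • (mul (D r f) * D s)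
    - mul (D s (twist (tau r + tau s) f)) * D r
  map_add' f g := by simp only [map_add, add_mul, smul_add]; abel
  map_smul' c f := by
    simp only [map_smul, smul_mul_assoc, RingHom.id_apply]
    rw [smul_comm]
    rw [smul_sub]

/-- `S(m,n;t)`, the span of all `D_rs(f)` with `f ∈ 𝔄(m,n;t)`. -/
def S (F : Type*) [Field F] (n p : ℕ) (t : Fin m → ℕ) :
    Submodule F (Module.End F (Alg F m n)) :=
  Submodule.span F {E | ∃ r s, ∃ f ∈ trunc F n p t, E = Drs r s f}

/-! ### Multiplication and superderivations -/

theorem mul_single (a b : Mon m n) (x y : F) :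
    mul (mono a x) (mono b y)
      = mono (a.1 + b.1, a.2 ∪ b.2) (x * y * mulCoeff F a b) := by
  simp only [mul, lin_mono, LinearMap.smul_apply, smul_mono, _root_.mul_assoc]

theorem inversions_union_left {u v w : Finset (Fin n)} (h : Disjoint u v) :
    inversions (u ∪ v) w = inversions u w + inversions v w := by
  simp [inversions, Finset.sum_union h]

theorem inversions_union_right {u v w : Finset (Fin n)} (h : Disjoint v w) :
    inversions u (v ∪ w) = inversions u v + inversions u w := by
  simp [inversions, Finset.sum_union h, Finset.sum_add_distrib]

theorem inversions_swap {u v : Finset (Fin n)} (h : Disjoint u v) :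
    inversions u v + inversions v u = u.card * v.card := by
  unfold inversions
  rw [Finset.sum_comm (s := v), ← Finset.sum_add_distrib]
  rw [Finset.sum_congr rfl (g := fun _ => v.card), Finset.sum_const, smul_eq_mul]
  intro i hi
  rw [← Finset.sum_add_distrib, Finset.card_eq_sum_ones]
  refine Finset.sum_congr rfl fun j hj => ?_
  have : i ≠ j := fun e => Finset.disjoint_left.1 h hi (e ▸ hj)
  rcases lt_or_gt_of_ne this with h | h
  · simp [h, h.not_gt]
  · simp [h, h.not_gt]

theorem choose_assoc (a b c : ℕ) :
    ((a + b).choose a) * ((a + b + c).choose (a + b))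
      = ((b + c).choose b) * ((a + (b + c)).choose a) := by
  have key : ∀ i j : ℕ, (i + j).choose i * i.factorial * j.factorial = (i + j).factorial :=
    fun i j => by rw [Nat.choose_symm_add]; exact Nat.add_choose_mul_factorial_mul_factorial i j
  have h1 := key a b
  have h2 := key (a + b) c
  have h3 := key b c
  have h4 := key a (b + c)
  have pos : 0 < a.factorial * b.factorial * c.factorial := by positivity
  refine Nat.eq_of_mul_eq_mul_right pos ?_
  rw [← add_assoc] at h4 ⊢
  calc _ = (a + b + c).choose (a + b) * ((a + b).choose a * a.factorial * b.factorial)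
          * c.factorial := by ring
    _ = (a + b + c).choose a * a.factorial * ((b + c).choose b * b.factorial * c.factorial) := by
        rw [h1, h2, h3, h4]
    _ = _ := by ring

theorem mulCoeff_assoc (a b c : Mon m n) :
    mulCoeff F a b * mulCoeff F (a.1 + b.1, a.2 ∪ b.2) c
      = mulCoeff F b c * mulCoeff F a (b.1 + c.1, b.2 ∪ c.2) := by
  unfold mulCoeff
  by_cases hab : Disjoint a.2 b.2
  · by_cases hbc : Disjoint b.2 c.2
    · by_cases hac : Disjoint a.2 c.2
      · have key : (∏ i, ((a.1 i + b.1 i).choose (a.1 i) : F)) *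
            (∏ i, ((a.1 i + b.1 i + c.1 i).choose (a.1 i + b.1 i) : F))
            = (∏ i, ((b.1 i + c.1 i).choose (b.1 i) : F)) *
            (∏ i, ((a.1 i + (b.1 i + c.1 i)).choose (a.1 i) : F)) := by
          rw [← Finset.prod_mul_distrib, ← Finset.prod_mul_distrib]
          refine Finset.prod_congr rfl fun i _ => ?_
          exact_mod_cast congrArg (Nat.cast (R := F)) (choose_assoc (a.1 i) (b.1 i) (c.1 i))
        simp only [hab, hbc, hac, if_true, Finset.disjoint_union_left,
          Finset.disjoint_union_right, and_self, Pi.add_apply, inversions_union_left hab,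
          inversions_union_right hbc, pow_add]
        linear_combination ((-1) ^ inversions a.2 b.2 * (-1) ^ inversions b.2 c.2 *
          (-1) ^ inversions a.2 c.2) * key
      · simp [hac]
    · simp [hbc]
  · simp [hab]

theorem mul_mul (f g : Alg F m n) : mul (mul f g) = mul f * mul g := by
  have : (LinearMap.compr₂ mul mul : Alg F m n →ₗ[F] _ →ₗ[F] _)
      = (LinearMap.mul F (Module.End F (Alg F m n))).compl₁₂ mul mul := by
    refine alg_ext fun a => alg_ext fun b => alg_ext fun c => ?_
    simp only [LinearMap.compr₂_apply, LinearMap.compl₁₂_apply, LinearMap.mul_apply',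
      Module.End.mul_apply, mul_single, one_mul, mul_one]
    rw [mulCoeff_assoc, add_assoc, Finset.union_assoc]
  exact LinearMap.congr_fun₂ this f g

theorem sgn_natCast (k : ℕ) : sgn F (k : ZMod 2) = (-1) ^ k := by
  rcases Nat.even_or_odd k with h | h
  · rw [h.neg_one_pow, sgn, if_pos ((ZMod.natCast_eq_zero_iff_even).2 h)]
  · rw [h.neg_one_pow, sgn, if_neg]
    rw [(ZMod.natCast_eq_one_iff_odd).2 h]; decide

theorem sgn_mul_self (a : ZMod 2) : sgn F a * sgn F a = 1 := by
  unfold sgn; split <;> simp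

theorem sgn_zero : sgn F 0 = 1 := rfl

theorem sgn_one : sgn F 1 = -1 := by simp [sgn]

theorem zmod_two_cases : ∀ a : ZMod 2, a = 0 ∨ a = 1 := by decide

theorem zmod_two_one_add_one : (1 : ZMod 2) + 1 = 0 := by decide

theorem par_induction {ε : ZMod 2} {P : Alg F m n → Prop}
    (h1 : ∀ a : Mon m n, mpar a = ε → P (mono a 1))
    (h0 : P 0) (hadd : ∀ f g, P f → P g → P (f + g)) (hsmul : ∀ (c : F) f, P f → P (c • f))
    {f : Alg F m n} (hf : f ∈ par F m n ε) : P f := by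
  exact monSpan_induction h1 h0 hadd hsmul hf

theorem mulCoeff_comm (a b : Mon m n) :
    mulCoeff F a b = sgn F (mpar a * mpar b) * mulCoeff F b a := by
  unfold mulCoeff
  by_cases h : Disjoint a.2 b.2
  · rw [if_pos h, if_pos h.symm]
    have h2 : ∀ i, ((a.1 i + b.1 i).choose (a.1 i) : F) = ((b.1 i + a.1 i).choose (b.1 i) : F) := by
      intro i; rw [Nat.choose_symm_add, add_comm]
    simp only [h2, mpar]
    rw [← Nat.cast_mul, sgn_natCast, ← inversions_swap h, pow_add]
    have h3 : ((-1 : F) ^ inversions b.2 a.2) * (-1) ^ inversions b.2 a.2 = 1 := by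
      rw [← mul_pow]; simp
    linear_combination (-(∏ i, ((b.1 i + a.1 i).choose (b.1 i) : F)) *
      (-1) ^ inversions a.2 b.2) * h3
  · rw [if_neg h, if_neg (fun h' => h h'.symm), mul_zero]

theorem mul_super_comm {ε δ : ZMod 2} {f g : Alg F m n} (hf : f ∈ par F m n ε)
    (hg : g ∈ par F m n δ) : mul f g = sgn F (ε * δ) • mul g f := by
  refine par_induction (P := fun f => mul f g = sgn F (ε * δ) • mul g f) ?_ ?_ ?_ ?_ hf
  · intro a ha
    refine par_induction (P := fun g => mul (mono a 1) g
      = sgn F (ε * δ) • mul g (mono a 1)) ?_ ?_ ?_ ?_ hg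
    · intro b hb
      rw [mul_single, mul_single, mulCoeff_comm, ha, hb, add_comm, Finset.union_comm]
      simp [smul_mono]
    · simp
    · intro x y hx hy; simp [hx, hy]
    · intro c x hx; simp only [map_smul, LinearMap.smul_apply, hx]; rw [smul_comm]
  · simp
  · intro x y hx hy; simp [hx, hy]
  · intro c x hx; simp only [map_smul, LinearMap.smul_apply, hx]; rw [smul_comm]

theorem par_mul {ε δ : ZMod 2} {f g : Alg F m n} (hf : f ∈ par F m n ε)
    (hg : g ∈ par F m n δ) : mul f g ∈ par F m n (ε + δ) := by
  refine par_induction (P := fun f => mul f g ∈ par F m n (ε + δ)) ?_ ?_ ?_ ?_ hf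
  · intro a ha
    refine par_induction (P := fun g => mul (mono a 1) g ∈ par F m n (ε + δ))
      ?_ ?_ ?_ ?_ hg
    · intro b hb
      rw [mul_single]
      by_cases h : Disjoint a.2 b.2
      · refine mono_mem _ ?_
        simp only [mpar, Set.mem_ofPred_eq] at *
        rw [Finset.card_union_of_disjoint h, Nat.cast_add, ha, hb]
      · simp [mulCoeff, h]
    · simp
    · intro x y hx hy; rw [map_add]; exact Submodule.add_mem _ hx hy
    · intro c x hx; rw [map_smul]; exact Submodule.smul_mem _ c hx
  · simp
  · intro x y hx hy; rw [map_add]; exact Submodule.add_mem _ hx hy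
  · intro c x hx; rw [map_smul]; exact Submodule.smul_mem _ c hx

theorem D_inl_single (i : Fin m) (a : Mon m n) (x : F) :
    D (.inl i) (mono a x) =
      if 0 < a.1 i then mono (a.1 - Pi.single i 1, a.2) x else 0 := by
  simp only [D, lin_mono]
  split <;> simp [smul_mono]

theorem D_inr_single (k : Fin n) (a : Mon m n) (x : F) :
    D (.inr k) (mono a x) =
      if k ∈ a.2 then
        mono (a.1, a.2.erase k) (x * (-1) ^ (a.2.filter (· < k)).card) else 0 := by
  simp only [D, lin_mono]
  split <;> simp [smul_mono]

theorem par_D (r : Fin m ⊕ Fin n) {ε : ZMod 2} {f : Alg F m n} (hf : f ∈ par F m n ε) :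
    D r f ∈ par F m n (tau r + ε) := by
  refine par_induction (P := fun f => D r f ∈ par F m n (tau r + ε)) ?_ ?_ ?_ ?_ hf
  · intro a ha
    rcases r with i | k
    · rw [D_inl_single]
      split
      · refine mono_mem _ ?_
        simpa [mpar, tau] using ha
      · exact Submodule.zero_mem _
    · rw [D_inr_single]
      split
      · rename_i hk
        refine mono_mem _ ?_
        have := Finset.card_erase_add_one hk
        simp only [mpar, Set.mem_ofPred_eq, tau] at *
        rw [← ha, ← this, Nat.cast_add, Nat.cast_one]
        generalize ((a.2.erase k).card : ZMod 2) = z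
        revert z; decide
      · exact Submodule.zero_mem _
  · simp
  · intro x y hx hy; rw [map_add]; exact Submodule.add_mem _ hx hy
  · intro c x hx; rw [map_smul]; exact Submodule.smul_mem _ c hx

theorem card_filter_lt (k : Fin n) (u : Finset (Fin n)) :
    (u.filter (· < k)).card = inversions {k} u := by
  rw [inversions, Finset.sum_singleton, Finset.card_filter]

theorem inversions_erase_right {k : Fin n} {u v : Finset (Fin n)} (h : k ∈ v) :
    inversions u v = inversions u {k} + inversions u (v.erase k) := by
  conv_lhs => rw [← Finset.insert_erase h, Finset.insert_eq]
  exact inversions_union_right (by simp)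

theorem inversions_erase_left {k : Fin n} {u v : Finset (Fin n)} (h : k ∈ u) :
    inversions u v = inversions {k} v + inversions (u.erase k) v := by
  conv_lhs => rw [← Finset.insert_erase h, Finset.insert_eq]
  exact inversions_union_left (by simp)

theorem neg_one_pow_sq (k : ℕ) : ((-1 : F) ^ k) * (-1) ^ k = 1 := by
  rw [← mul_pow]; simp

theorem D_comm (r s : Fin m ⊕ Fin n) :
    (D r * D s : Module.End F (Alg F m n)) = sgn F (tau r * tau s) • (D s * D r) := by
  refine alg_ext fun a => ?_
  generalize (1 : F) = x
  simp only [Module.End.mul_apply, LinearMap.smul_apply]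
  rcases r with i | k <;> rcases s with j | l
  · by_cases hij : i = j
    · subst hij; simp [sgn, tau]
    · rw [D_inl_single, D_inl_single]
      by_cases hi : 0 < a.1 i <;> by_cases hj : 0 < a.1 j <;>
        simp [hi, hj, D_inl_single, sgn, tau, Ne.symm hij, hij, tsub_right_comm]
  · rw [D_inl_single, D_inr_single]
    by_cases hi : 0 < a.1 i <;> by_cases hj : l ∈ a.2 <;>
      simp [hi, hj, D_inl_single, D_inr_single, sgn, tau]
  · rw [D_inl_single, D_inr_single]
    by_cases hi : 0 < a.1 j <;> by_cases hj : k ∈ a.2 <;>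
      simp [hi, hj, D_inl_single, D_inr_single, sgn, tau]
  · have hs : sgn F (tau (m := m) (Sum.inr k) * tau (m := m) (Sum.inr l)) = -1 := by
      simp [sgn, tau]
    rw [hs]
    by_cases hkl : k = l
    · subst hkl
      rw [D_inr_single]
      split <;> simp [D_inr_single]
    · rw [D_inr_single, D_inr_single]
      by_cases hk : k ∈ a.2
      · by_cases hl : l ∈ a.2
        · simp only [hk, hl, if_true, D_inr_single, Finset.mem_erase, ne_eq, hkl, Ne.symm hkl,
            not_false_eq_true, true_and, card_filter_lt, Finset.erase_right_comm (a := k)]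
          rw [inversions_erase_right (u := {k}) hl, inversions_erase_right (u := {l}) hk,
            pow_add, pow_add, smul_mono]
          congr 1
          have h1 := inversions_swap (u := {k}) (v := {l}) (by simpa using hkl)
          have h2 : ((-1 : F) ^ inversions {k} {l}) * (-1) ^ inversions {l} {k} = -1 := by
            rw [← pow_add, h1]; simp
          have h3 := neg_one_pow_sq (F := F) (inversions {l} {k})
          have h4 : ((-1 : F) ^ inversions {k} {l}) = - (-1) ^ inversions {l} {k} := by
            linear_combination (-1 : F) ^ inversions {l} {k} * h2
              - ((-1 : F) ^ inversions {k} {l}) * h3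
          linear_combination (x * (-1) ^ inversions {l} (a.2.erase k) *
            (-1) ^ inversions {k} (a.2.erase l)) * h4
        · simp [hk, hl, D_inr_single]
      · by_cases hl : l ∈ a.2
        · simp [hk, hl, D_inr_single]
        · simp [hk, hl]

theorem sub_add_single {i : Fin m} {α β : Fin m → ℕ} (h : 0 < α i) :
    α - Pi.single i 1 + β = α + β - Pi.single i 1 := by
  funext j
  by_cases hj : j = i
  · subst hj; simp; omega
  · simp [hj]

theorem add_sub_single {i : Fin m} {α β : Fin m → ℕ} (h : 0 < β i) :
    α + (β - Pi.single i 1) = α + β - Pi.single i 1 := by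
  rw [add_comm, sub_add_single h, add_comm]

theorem prod_choose_split (i : Fin m) (α β : Fin m → ℕ) :
    ∏ j, ((α j + β j).choose (α j) : F) =
      ((α i + β i).choose (α i) : F) *
        ∏ j ∈ Finset.univ.erase i, ((α j + β j).choose (α j) : F) :=
  (Finset.mul_prod_erase _ _ (Finset.mem_univ i)).symm

theorem prod_sub_left (i : Fin m) (α β : Fin m → ℕ) :
    ∏ j ∈ Finset.univ.erase i, (((α - Pi.single i 1 : Fin m → ℕ) j + β j).choose ((α - Pi.single i 1 : Fin m → ℕ) j) : F)
      = ∏ j ∈ Finset.univ.erase i, ((α j + β j).choose (α j) : F) := by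
  refine Finset.prod_congr rfl fun j hj => ?_
  have : j ≠ i := (Finset.mem_erase.1 hj).1
  simp [this]

theorem prod_sub_right (i : Fin m) (α β : Fin m → ℕ) :
    ∏ j ∈ Finset.univ.erase i, ((α j + (β - Pi.single i 1 : Fin m → ℕ) j).choose (α j) : F)
      = ∏ j ∈ Finset.univ.erase i, ((α j + β j).choose (α j) : F) := by
  refine Finset.prod_congr rfl fun j hj => ?_
  have : j ≠ i := (Finset.mem_erase.1 hj).1
  simp [this]

theorem D_mul_inl (i : Fin m) (a b : Mon m n) :
    (D (.inl i) (mul (mono a 1) (mono b 1)) : Alg F m n) =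
      mul (D (.inl i) (mono a 1)) (mono b 1)
        + mul (mono a 1) (D (.inl i) (mono b 1)) := by
  rw [mul_single, D_inl_single, D_inl_single, D_inl_single]
  by_cases hd : Disjoint a.2 b.2
  · rcases Nat.eq_zero_or_pos (a.1 i) with ha | ha <;>
      rcases Nat.eq_zero_or_pos (b.1 i) with hb | hb
    · simp [ha, hb]
    · simp only [Pi.add_apply, ha, hb, lt_irrefl, if_true, if_false, mul_single, map_zero,
        LinearMap.zero_apply, zero_add, add_sub_single hb, mulCoeff, hd]
      congr 3
      rw [prod_choose_split (F := F) i, prod_choose_split (F := F) i, prod_sub_right]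
      simp [ha]
    · simp only [Pi.add_apply, ha, hb, lt_irrefl, if_true, if_false, mul_single, map_zero,
        add_zero, sub_add_single ha, mulCoeff, hd]
      congr 3
      rw [prod_choose_split (F := F) i, prod_choose_split (F := F) i, prod_sub_left]
      simp [hb]
    · have hab : 0 < a.1 i + b.1 i := by omega
      simp only [Pi.add_apply, ha, hb, hab, if_true, mul_single, add_sub_single hb,
        sub_add_single ha, mulCoeff, hd]
      rw [← map_add]
      congr 1
      rw [prod_choose_split i, prod_choose_split i (a.1 - Pi.single i 1),
        prod_choose_split i a.1 (b.1 - Pi.single i 1),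
        prod_sub_left, prod_sub_right]
      have : (a.1 i + b.1 i).choose (a.1 i) =
          ((a.1 - Pi.single i 1 : Fin m → ℕ) i + b.1 i).choose ((a.1 - Pi.single i 1 : Fin m → ℕ) i)
            + (a.1 i + (b.1 - Pi.single i 1 : Fin m → ℕ) i).choose (a.1 i) := by
        obtain ⟨x, hx⟩ := Nat.exists_eq_add_of_lt ha
        obtain ⟨y, hy⟩ := Nat.exists_eq_add_of_lt hb
        simp only [Pi.sub_apply, Pi.single_eq_same, hx, hy, zero_add, Nat.add_sub_cancel]
        rw [show x + 1 + (y + 1) = (x + (y + 1)) + 1 by ring, Nat.choose_succ_succ',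
          show x + 1 + y = x + (y + 1) by ring]
      rw [this]
      push_cast
      ring
  · have h0 : ∀ α β : Fin m → ℕ, mulCoeff F (α, a.2) (β, b.2) = 0 := fun _ _ => by
      simp [mulCoeff, hd]
    have h1 : mulCoeff F a b = 0 := h0 a.1 b.1
    have h2 : ∀ α, mulCoeff F (α, a.2) b = 0 := fun α => h0 α b.1
    have h3 : ∀ α, mulCoeff F a (α, b.2) = 0 := fun α => h0 a.1 α
    split_ifs <;> simp [mul_single, h1, h2, h3]

theorem D_mul_inr (k : Fin n) (a b : Mon m n) :
    (D (.inr k) (mul (mono a 1) (mono b 1)) : Alg F m n) =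
      mul (D (.inr k) (mono a 1)) (mono b 1)
        + sgn F (mpar a) • mul (mono a 1) (D (.inr k) (mono b 1)) := by
  rw [mul_single, D_inr_single, D_inr_single, D_inr_single]
  simp only [card_filter_lt, mpar, sgn_natCast]
  by_cases hd : Disjoint a.2 b.2
  · by_cases ha : k ∈ a.2
    · have hb : k ∉ b.2 := Finset.disjoint_left.1 hd ha
      have hd' : Disjoint (a.2.erase k) b.2 :=
        Finset.disjoint_of_subset_left (Finset.erase_subset _ _) hd
      simp only [Finset.mem_union, ha, hb, or_false, if_true, if_false, map_zero, smul_zero,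
        add_zero, mul_single, Finset.erase_union_distrib, Finset.erase_eq_of_notMem hb, mulCoeff,
        hd, hd', inversions_union_right hd, inversions_erase_left (v := b.2) ha, pow_add]
      congr 1
      linear_combination ((∏ i, ((a.1 i + b.1 i).choose (a.1 i) : F)) *
        (-1) ^ inversions (a.2.erase k) b.2 * (-1) ^ inversions {k} a.2) *
        neg_one_pow_sq (F := F) (inversions {k} b.2)
    · by_cases hb : k ∈ b.2
      · have hd' : Disjoint a.2 (b.2.erase k) :=
          Finset.disjoint_of_subset_right (Finset.erase_subset _ _) hd
        have hc := inversions_swap (u := {k}) (v := a.2) (by simpa using ha)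
        rw [Finset.card_singleton, one_mul] at hc
        simp only [Finset.mem_union, ha, hb, or_true, if_true, if_false, map_zero,
          LinearMap.zero_apply, zero_add, mul_single, Finset.erase_union_distrib,
          Finset.erase_eq_of_notMem ha, mulCoeff, hd, hd', inversions_union_right hd,
          inversions_erase_right (u := a.2) hb, pow_add, ← hc, smul_mono]
        congr 1
        ring
      · simp [ha, hb]
  · have h1 : mulCoeff F a b = 0 := by simp [mulCoeff, hd]
    simp only [h1, mul_zero, zero_mul, map_zero, ite_self]
    obtain ⟨l, hla, hlb⟩ := Finset.not_disjoint_iff.1 hd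
    by_cases hl : ∃ l, l ≠ k ∧ l ∈ a.2 ∧ l ∈ b.2
    · obtain ⟨l, hlk, hla, hlb⟩ := hl
      have e1 : ¬ Disjoint (a.2.erase k) b.2 :=
        Finset.not_disjoint_iff.2 ⟨l, Finset.mem_erase.2 ⟨hlk, hla⟩, hlb⟩
      have e2 : ¬ Disjoint a.2 (b.2.erase k) :=
        Finset.not_disjoint_iff.2 ⟨l, hla, Finset.mem_erase.2 ⟨hlk, hlb⟩⟩
      split_ifs <;> simp [mul_single, mulCoeff, e1, e2]
    · push Not at hl
      have hlk : l = k := by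
        by_contra h; exact hl l h hla hlb
      subst hlk
      have e1 : Disjoint (a.2.erase l) b.2 := Finset.disjoint_left.2 fun x hx hxb =>
        hl x (Finset.mem_erase.1 hx).1 (Finset.mem_erase.1 hx).2 hxb
      have e2 : Disjoint a.2 (b.2.erase l) := Finset.disjoint_right.2 fun x hx hxa =>
        hl x (Finset.mem_erase.1 hx).1 hxa (Finset.mem_erase.1 hx).2
      have e3 : a.2.erase l ∪ b.2 = a.2 ∪ b.2.erase l := by
        ext x
        by_cases hx : x = l
        · subst hx; simp [hla, hlb]
        · simp [hx]
      have hc := inversions_swap (u := {l}) (v := a.2.erase l) (by simp)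
      rw [Finset.card_singleton, one_mul] at hc
      have hcard := Finset.card_erase_add_one hla
      have hll : inversions {l} {l} = 0 := by simp [inversions]
      simp only [hla, hlb, if_true, mul_single, mulCoeff, e1, e2, e3, smul_mono,
        ← map_add]
      rw [← hcard, ← hc, inversions_erase_right (u := {l}) hla,
        inversions_erase_right (u := {l}) hlb, inversions_erase_right (u := a.2.erase l) hlb,
        inversions_erase_left (v := b.2.erase l) hla, hll]
      simp only [pow_add, pow_zero, pow_one, one_mul, mul_one]
      symm
      refine (congrArg (mono _) ?_).trans (map_zero _)
      linear_combination (-(-1) ^ inversions {l} (a.2.erase l) *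
        (∏ i, ((a.1 i + b.1 i).choose (a.1 i) : F)) * (-1) ^ inversions (a.2.erase l) {l} *
        (-1) ^ inversions (a.2.erase l) (b.2.erase l)) *
          neg_one_pow_sq (F := F) (inversions {l} (b.2.erase l))

theorem D_mul (r : Fin m ⊕ Fin n) {ε : ZMod 2} {f : Alg F m n} (hf : f ∈ par F m n ε) :
    D r * mul f = mul (D r f) + sgn F (tau r * ε) • (mul f * D r) := by
  refine par_induction (P := fun f => D r * mul f = mul (D r f) + sgn F (tau r * ε) • (mul f * D r))
    ?_ ?_ ?_ ?_ hf
  · intro a ha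
    refine alg_ext fun b => ?_
    simp only [Module.End.mul_apply, LinearMap.add_apply, LinearMap.smul_apply]
    rcases r with i | k
    · rw [D_mul_inl]; simp [tau, sgn]
    · rw [D_mul_inr, ha]; simp [tau]
  · simp
  · intro x y hx hy
    simp only [map_add, mul_add, add_mul, hx, hy, smul_add]; abel
  · intro c x hx
    simp only [map_smul, mul_smul_comm, smul_mul_assoc, hx, smul_add]
    rw [smul_comm]

/-! ### The truncated subalgebra -/

theorem trunc_induction {p : ℕ} {t : Fin m → ℕ} {P : Alg F m n → Prop}
    (h1 : ∀ a : Mon m n, (∀ i, a.1 i < p ^ t i) → P (mono a 1))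
    (h0 : P 0) (hadd : ∀ f g, P f → P g → P (f + g)) (hsmul : ∀ (c : F) f, P f → P (c • f))
    {f : Alg F m n} (hf : f ∈ trunc F n p t) : P f := by
  exact monSpan_induction h1 h0 hadd hsmul hf

theorem trunc_D {p : ℕ} {t : Fin m → ℕ} (r : Fin m ⊕ Fin n) {f : Alg F m n}
    (hf : f ∈ trunc F n p t) : D r f ∈ trunc F n p t := by
  refine trunc_induction (P := fun f => D r f ∈ trunc F n p t) ?_ ?_ ?_ ?_ hf
  · intro a ha
    rcases r with i | k
    · rw [D_inl_single]
      split
      · exact mono_mem _ fun j => lt_of_le_of_lt (Nat.sub_le _ _) (ha j)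
      · exact Submodule.zero_mem _
    · rw [D_inr_single]
      split
      · exact mono_mem _ ha
      · exact Submodule.zero_mem _
  · simp
  · intro x y hx hy; rw [map_add]; exact Submodule.add_mem _ hx hy
  · intro c x hx; rw [map_smul]; exact Submodule.smul_mem _ c hx

theorem prime_dvd_choose {p : ℕ} (hp : p.Prime) {t a b : ℕ} (ha : a < p ^ t) (hb : b < p ^ t)
    (hab : p ^ t ≤ a + b) : p ∣ (a + b).choose a := by
  rw [Nat.choose_symm_add]
  have ht : 1 ≤ t := by
    rcases Nat.eq_zero_or_pos t with rfl | h
    · simp at ha hb hab; omega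
    · exact h
  have hlog : t ≤ Nat.log p (a + b) := Nat.le_log_of_pow_le hp.one_lt hab
  apply dvd_of_emultiplicity_pos
  rw [hp.emultiplicity_choose' (Nat.lt_succ_self _)]
  have : t ∈ (Finset.Ico 1 (Nat.log p (a + b)).succ).filter
      (fun i => p ^ i ≤ b % p ^ i + a % p ^ i) := by
    simp only [Finset.mem_filter, Finset.mem_Ico]
    refine ⟨⟨ht, by omega⟩, ?_⟩
    rw [Nat.mod_eq_of_lt ha, Nat.mod_eq_of_lt hb]; omega
  exact_mod_cast Finset.card_pos.2 ⟨t, this⟩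

theorem trunc_mul {p : ℕ} [Fact p.Prime] [CharP F p] {t : Fin m → ℕ} {f g : Alg F m n}
    (hf : f ∈ trunc F n p t) (hg : g ∈ trunc F n p t) : mul f g ∈ trunc F n p t := by
  refine trunc_induction (P := fun f => mul f g ∈ trunc F n p t) ?_ ?_ ?_ ?_ hf
  · intro a ha
    refine trunc_induction (P := fun g => mul (mono a 1) g ∈ trunc F n p t)
      ?_ ?_ ?_ ?_ hg
    · intro b hb
      rw [mul_single]
      by_cases h : ∀ i, a.1 i + b.1 i < p ^ t i
      · exact mono_mem _ h
      · push Not at h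
        obtain ⟨i, hi⟩ := h
        have h0 : ((a.1 i + b.1 i).choose (a.1 i) : F) = 0 :=
          (CharP.cast_eq_zero_iff F p _).2 (prime_dvd_choose Fact.out (ha i) (hb i) hi)
        have h1 : mulCoeff F a b = 0 := by
          unfold mulCoeff
          split
          · rw [Finset.prod_eq_zero (Finset.mem_univ i) h0, zero_mul]
          · rfl
        simp [h1]
    · simp
    · intro x y hx hy; rw [map_add]; exact Submodule.add_mem _ hx hy
    · intro c x hx; rw [map_smul]; exact Submodule.smul_mem _ c hx
  · simp
  · intro x y hx hy; rw [map_add]; exact Submodule.add_mem _ hx hy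
  · intro c x hx; rw [map_smul]; exact Submodule.smul_mem _ c hx

/-! ### The unit, the variables, and coefficients -/

/-- The unit of `𝔄(m,n)`. -/
def one : Alg F m n := mono (0, ∅) 1

/-- The variables `x_r`. -/
def xv : Fin m ⊕ Fin n → Alg F m n
  | .inl i => mono (Pi.single i 1, ∅) 1
  | .inr k => mono (0, {k}) 1

theorem mul_one' (f : Alg F m n) : mul f one = f := by
  have : (mul : Alg F m n →ₗ[F] _).flip one = LinearMap.id := by
    refine alg_ext fun a => ?_
    simp [mul_single, one, mulCoeff, inversions]
  exact LinearMap.congr_fun this f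

theorem one_mul' : mul (one : Alg F m n) = 1 := by
  refine alg_ext fun a => ?_
  simp [mul_single, one, mulCoeff, inversions]

theorem D_xv (r s : Fin m ⊕ Fin n) : (D s (xv r) : Alg F m n) = if s = r then one else 0 := by
  rcases r with i | k <;> rcases s with j | l
  · by_cases h : j = i
    · subst h; simp [xv, one, D_inl_single]
    · simp [xv, D_inl_single, h]
  · simp [xv, D_inr_single]
  · simp [xv, D_inl_single]
  · by_cases h : l = k
    · subst h
      simp [xv, one, D_inr_single, Finset.filter_singleton]
    · simp [xv, D_inr_single, h]

theorem par_xv (r : Fin m ⊕ Fin n) : (xv r : Alg F m n) ∈ par F m n (tau r) := by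
  rcases r with i | k
  · exact mono_mem _ (by simp [mpar, tau])
  · exact mono_mem _ (by simp [mpar, tau])

theorem coeff_xv (f : Fin m ⊕ Fin n → Alg F m n) (r : Fin m ⊕ Fin n) :
    vec f (xv r) = f r := by
  simp only [vec, LinearMap.sum_apply, Module.End.mul_apply, D_xv]
  rw [Finset.sum_eq_single r]
  · simp [mul_one']
  · intro s _ hs; simp [hs]
  · simp

theorem even_coeff {f : Fin m ⊕ Fin n → Alg F m n}
    (h : vec f ∈ evenEnd F m n) (r : Fin m ⊕ Fin n) :
    f r ∈ par F m n (tau r) := by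
  rw [← coeff_xv f r]; exact h _ _ (par_xv r)

/-! ### Brackets of even elements -/

theorem D_vec (l : Fin m ⊕ Fin n) {f : Fin m ⊕ Fin n → Alg F m n}
    (hf : ∀ r, f r ∈ par F m n (tau r)) :
    D l * vec f
      = vec f * D l + ∑ r, mul (D l (f r)) * D r := by
  rw [vec, Finset.mul_sum, Finset.sum_mul, ← Finset.sum_add_distrib]
  refine Finset.sum_congr rfl fun r _ => ?_
  rw [← _root_.mul_assoc, D_mul l (hf r), add_mul, add_comm, smul_mul_assoc,
    _root_.mul_assoc, D_comm l r, mul_smul_comm, smul_smul, sgn_mul_self, one_smul,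
    ← _root_.mul_assoc]

theorem vec_mul {f : Fin m ⊕ Fin n → Alg F m n} (hf : ∀ r, f r ∈ par F m n (tau r))
    {ε : ZMod 2} {h : Alg F m n} (hh : h ∈ par F m n ε) :
    vec f * mul h
      = mul (vec f h) + mul h * vec f := by
  rw [vec, Finset.sum_mul, Finset.mul_sum, LinearMap.sum_apply, map_sum, ← Finset.sum_add_distrib]
  refine Finset.sum_congr rfl fun r _ => ?_
  rw [_root_.mul_assoc, D_mul r hh, mul_add, Module.End.mul_apply, mul_mul, mul_smul_comm,
    ← _root_.mul_assoc (mul h), ← mul_mul h, mul_super_comm hh (hf r), map_smul, mul_mul,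
    smul_mul_assoc, _root_.mul_assoc, mul_comm ε]

theorem vec_lie {f g : Fin m ⊕ Fin n → Alg F m n} (hf : ∀ r, f r ∈ par F m n (tau r))
    (hg : ∀ r, g r ∈ par F m n (tau r)) :
    vec f * vec g - vec g * vec f
      = vec fun s => vec f (g s) - vec g (f s) := by
  have h1 : vec f * vec g
      = ∑ s, (mul (vec f (g s)) * D s
        + mul (g s) * (vec f * D s)) := by
    conv_lhs => rw [vec.eq_1 g, Finset.mul_sum]
    refine Finset.sum_congr rfl fun s _ => ?_
    rw [← _root_.mul_assoc, vec_mul hf (hg s), add_mul, _root_.mul_assoc]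
  have h2 : vec g * vec f
      = ∑ s, mul (g s) * (vec f * D s)
        + ∑ r, mul (vec g (f r)) * D r := by
    conv_lhs => rw [vec.eq_1 g]
    simp only [Finset.sum_mul, _root_.mul_assoc,
      D_vec _ hf, mul_add, Finset.sum_add_distrib]
    congr 1
    simp only [vec.eq_1 g, Finset.mul_sum, LinearMap.sum_apply, map_sum, Finset.sum_mul, Module.End.mul_apply,
      mul_mul, _root_.mul_assoc]
    exact Finset.sum_comm
  rw [h1, h2, Finset.sum_add_distrib, vec.eq_1 fun s => vec f (g s) - vec g (f s)]
  simp only [map_sub, sub_mul, Finset.sum_sub_distrib]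
  abel

theorem evenEnd_lie {A B : Module.End F (Alg F m n)} (hA : A ∈ evenEnd F m n)
    (hB : B ∈ evenEnd F m n) : A * B - B * A ∈ evenEnd F m n := fun ε f hf =>
  Submodule.sub_mem _ (hA ε _ (hB ε f hf)) (hB ε _ (hA ε f hf))

theorem vec_trunc {p : ℕ} [Fact p.Prime] [CharP F p] {t : Fin m → ℕ}
    {f : Fin m ⊕ Fin n → Alg F m n} (hf : ∀ r, f r ∈ trunc F n p t) {g : Alg F m n}
    (hg : g ∈ trunc F n p t) : vec f g ∈ trunc F n p t := by
  rw [vec, LinearMap.sum_apply]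
  exact Submodule.sum_mem _ fun r _ => trunc_mul (hf r) (trunc_D r hg)

/-! ### Closure of the special algebra under brackets -/

theorem twist_par (c : ZMod 2) {ε : ZMod 2} {f : Alg F m n} (hf : f ∈ par F m n ε) :
    twist c f = sgn F (c * ε) • f := by
  refine par_induction (P := fun f => twist c f = sgn F (c * ε) • f) ?_ ?_ ?_ ?_ hf
  · intro a ha; simp [twist, lin_mono, ha, smul_mono]
  · simp
  · intro x y hx hy; simp [hx, hy]
  · intro d x hx; rw [map_smul, hx, smul_comm]

theorem Drs_par (r s : Fin m ⊕ Fin n) {ε : ZMod 2} {f : Alg F m n} (hf : f ∈ par F m n ε) :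
    Drs r s f = sgn F (tau r * tau s) • (mul (D r f) * D s)
      - sgn F ((tau r + tau s) * ε) • (mul (D s f) * D r) := by
  simp [Drs, twist_par _ hf]

theorem par_trunc_span {p : ℕ} {t : Fin m → ℕ} {f : Alg F m n} (hf : f ∈ trunc F n p t) (δ : ZMod 2) :
    ∃ g ∈ trunc F n p t, ∃ h ∈ trunc F n p t, f = g + h ∧ g ∈ par F m n δ ∧
      h ∈ par F m n (δ + 1) := by
  refine trunc_induction (P := fun f => ∃ g ∈ trunc F n p t, ∃ h ∈ trunc F n p t, f = g + h ∧
    g ∈ par F m n δ ∧ h ∈ par F m n (δ + 1)) ?_ ?_ ?_ ?_ hf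
  · intro a ha
    have h0 : mono a (1 : F) ∈ trunc F n p t := mono_mem _ ha
    by_cases h : mpar a = δ
    · exact ⟨_, h0, 0, Submodule.zero_mem _, by simp, mono_mem _ h,
        Submodule.zero_mem _⟩
    · refine ⟨0, Submodule.zero_mem _, _, h0, by simp, Submodule.zero_mem _,
        mono_mem _ ?_⟩
      change mpar a = δ + 1
      revert h
      generalize mpar a = z
      revert z δ; decide
  · exact ⟨0, Submodule.zero_mem _, 0, Submodule.zero_mem _, by simp, Submodule.zero_mem _,
      Submodule.zero_mem _⟩
  · rintro _ _ ⟨g, hg, h, hh, rfl, h1, h2⟩ ⟨g', hg', h', hh', rfl, h1', h2'⟩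
    exact ⟨g + g', Submodule.add_mem _ hg hg', h + h', Submodule.add_mem _ hh hh', by abel,
      Submodule.add_mem _ h1 h1', Submodule.add_mem _ h2 h2'⟩
  · rintro c _ ⟨g, hg, h, hh, rfl, h1, h2⟩
    exact ⟨c • g, Submodule.smul_mem _ c hg, c • h, Submodule.smul_mem _ c hh, by simp,
      Submodule.smul_mem _ c h1, Submodule.smul_mem _ c h2⟩

theorem mul_D_par (r : Fin m ⊕ Fin n) {ε δ : ZMod 2} {f g : Alg F m n} (hf : f ∈ par F m n ε)
    (hg : g ∈ par F m n δ) : mul f (D r g) ∈ par F m n (ε + tau r + δ) := by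
  rw [add_assoc]; exact par_mul hf (par_D r hg)

/-- The span of the elements `D_rs(f)` of parity `ε`. -/
def homGen (F : Type*) [Field F] (n p : ℕ) (t : Fin m → ℕ) (ε : ZMod 2) :
    Submodule F (Module.End F (Alg F m n)) :=
  Submodule.span F {E | ∃ r s, ∃ f ∈ trunc F n p t, f ∈ par F m n (tau r + tau s + ε) ∧
    E = Drs r s f}

theorem homGen_apply {p : ℕ} {t : Fin m → ℕ} {ε δ : ZMod 2} {E : Module.End F (Alg F m n)}
    (hE : E ∈ homGen F n p t ε) {h : Alg F m n} (hh : h ∈ par F m n δ) :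
    E h ∈ par F m n (ε + δ) := by
  induction hE using Submodule.span_induction with
  | mem x hx =>
    obtain ⟨r, s, f, _, hf, rfl⟩ := hx
    rw [Drs_par r s hf]
    refine Submodule.sub_mem _ ?_ ?_
    · have := mul_D_par s (par_D r hf) hh
      have aux : tau r + (tau r + tau s + ε) + tau s + δ = ε + δ := by
        generalize tau r = a; generalize tau s = b
        clear * -
        revert a b ε δ; decide
      rw [LinearMap.smul_apply, Module.End.mul_apply]
      refine Submodule.smul_mem _ _ ?_
      rwa [aux] at this
    · have := mul_D_par r (par_D s hf) hh
      have aux : tau s + (tau r + tau s + ε) + tau r + δ = ε + δ := by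
        generalize tau r = a; generalize tau s = b
        clear * -
        revert a b ε δ; decide
      rw [LinearMap.smul_apply, Module.End.mul_apply]
      refine Submodule.smul_mem _ _ ?_
      rwa [aux] at this
  | zero => exact Submodule.zero_mem _
  | add x y _ _ hx hy => exact Submodule.add_mem _ hx hy
  | smul c x _ hx => exact Submodule.smul_mem _ c hx

theorem par_disjoint (δ : ZMod 2) {f : Alg F m n} (h0 : f ∈ par F m n δ)
    (h1 : f ∈ par F m n (1 + δ)) : f = 0 := by
  refine Finsupp.ext fun a => ?_
  by_cases h : mpar a = δ
  · refine monSpan_coeff h1 (a := a) fun h' => ?_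
    have e : δ = 1 + δ := h.symm.trans h'
    clear h h' h0 h1
    revert δ; decide
  · exact monSpan_coeff h0 (a := a) h

theorem even_S_mem {p : ℕ} {t : Fin m → ℕ} {E : Module.End F (Alg F m n)}
    (hE : E ∈ S F n p t) (hev : E ∈ evenEnd F m n) : E ∈ homGen F n p t 0 := by
  have h : ∃ A ∈ homGen F n p t 0, ∃ B ∈ homGen F n p t 1, E = A + B := by
    clear hev
    induction hE using Submodule.span_induction with
    | mem x hx =>
      obtain ⟨r, s, f, hf, rfl⟩ := hx
      obtain ⟨g, hg, h, hh, rfl, h1, h2⟩ := par_trunc_span hf (tau r + tau s)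
      refine ⟨Drs r s g, Submodule.subset_span ⟨r, s, g, hg, by rwa [add_zero], rfl⟩,
        Drs r s h, Submodule.subset_span ⟨r, s, h, hh, h2, rfl⟩, map_add _ _ _⟩
    | zero => exact ⟨0, Submodule.zero_mem _, 0, Submodule.zero_mem _, by simp⟩
    | add x y _ _ hx hy =>
      obtain ⟨A, hA, B, hB, rfl⟩ := hx
      obtain ⟨A', hA', B', hB', rfl⟩ := hy
      exact ⟨A + A', Submodule.add_mem _ hA hA', B + B', Submodule.add_mem _ hB hB', by abel⟩
    | smul c x _ hx =>
      obtain ⟨A, hA, B, hB, rfl⟩ := hx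
      exact ⟨c • A, Submodule.smul_mem _ c hA, c • B, Submodule.smul_mem _ c hB, by simp⟩
  obtain ⟨A, hA, B, hB, rfl⟩ := h
  have : B = 0 := by
    refine alg_ext fun a => ?_
    have ha : mono a (1 : F) ∈ par F m n (mpar a) :=
      mono_mem _ rfl
    change B (mono a 1) = 0
    refine par_disjoint (mpar a) ?_ (homGen_apply hB ha)
    have h1 := homGen_apply hA ha
    rw [zero_add] at h1
    have h2 := Submodule.sub_mem _ (hev _ _ ha) h1
    rwa [LinearMap.add_apply, add_sub_cancel_left] at h2
  rw [this, add_zero]; exact hA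

/-- The divergence of an even element. -/
def evenDiv : Module.End F (Alg F m n) →ₗ[F] Alg F m n where
  toFun E := ∑ r, sgn F (tau r) • D r (E (xv r))
  map_add' A B := by simp only [LinearMap.add_apply, map_add, smul_add, Finset.sum_add_distrib]
  map_smul' c A := by
    simp only [LinearMap.smul_apply, map_smul, Finset.smul_sum, RingHom.id_apply]
    exact Finset.sum_congr rfl fun r _ => smul_comm _ _ _

theorem evenDiv_homGen {p : ℕ} {t : Fin m → ℕ} {E : Module.End F (Alg F m n)}
    (hE : E ∈ homGen F n p t 0) : evenDiv E = 0 := by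
  induction hE using Submodule.span_induction with
  | mem x hx =>
    obtain ⟨k, l, f, _, hf, rfl⟩ := hx
    have h1 : ∀ (g : Alg F m n) (s : Fin m ⊕ Fin n),
        evenDiv (mul g * D s) = sgn F (tau s) • D s g := by
      intro g s
      simp only [evenDiv, LinearMap.coe_mk, AddHom.coe_mk, Module.End.mul_apply, D_xv]
      rw [Finset.sum_eq_single s]
      · simp [mul_one']
      · intro r _ hr; simp [Ne.symm hr]
      · simp
    have h2 : D k (D l f) = sgn F (tau k * tau l) • D l (D k f) :=
      LinearMap.congr_fun (D_comm k l) f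
    rw [Drs_par k l hf]
    rw [map_sub, map_smul, map_smul, h1, h1, h2, smul_smul, smul_smul, smul_smul,
      ← sub_smul]
    convert zero_smul F _
    rcases zmod_two_cases (tau k) with h | h <;> rcases zmod_two_cases (tau l) with h' | h' <;>
      simp [h, h', sgn_zero, sgn_one, zmod_two_one_add_one]
  | zero => simp
  | add x y _ _ hx hy => rw [map_add, hx, hy, add_zero]
  | smul c x _ hx => rw [map_smul, hx, smul_zero]

theorem Drs_mem_S {p : ℕ} {t : Fin m → ℕ} (r s : Fin m ⊕ Fin n) {f : Alg F m n}
    (hf : f ∈ trunc F n p t) : Drs r s f ∈ S F n p t :=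
  Submodule.subset_span ⟨r, s, f, hf, rfl⟩

theorem mul_super_comm' {ε δ : ZMod 2} {f g : Alg F m n} (hf : f ∈ par F m n ε)
    (hg : g ∈ par F m n δ) : mul f * mul g = sgn F (ε * δ) • (mul g * mul f) := by
  rw [← mul_mul, mul_super_comm hf hg, map_smul, mul_mul]

theorem lie_term (k l r : Fin m ⊕ Fin n) {f g : Alg F m n} (hf : f ∈ par F m n (tau r))
    (hg : g ∈ par F m n (tau k + tau l)) :
    sgn F (tau k + tau l) • (mul (D l g) * mul (D k f) * D r)
      - sgn F (tau k * tau l) • (mul (D k f) * mul (D r g) * D l)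
    = - sgn F (tau k * tau l + tau r * tau l + tau r * tau k + tau r) • Drs r l (mul (D k f) g)
      + sgn F (tau k * tau l + tau r) • (mul (D k (D r f)) * mul g * D l)
      - sgn F (tau k * tau l + tau r * tau l + tau r * tau k + tau l) •
        (mul (D l (D k f)) * mul g * D r) := by
  have hkf := par_D k hf
  have hh := par_mul hkf hg
  have e (s : Fin m ⊕ Fin n) : D s (mul (D k f) g) = mul (D s (D k f)) g
      + sgn F (tau s * (tau k + tau r)) • mul (D k f) (D s g) :=
    LinearMap.congr_fun (D_mul s hkf) g
  have e1 : D r (D k f) = sgn F (tau r * tau k) • D k (D r f) :=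
    LinearMap.congr_fun (D_comm r k) f
  have e2 : mul (D k f) * mul (D l g)
      = sgn F ((tau k + tau r) * (tau l + (tau k + tau l))) • (mul (D l g) * mul (D k f)) :=
    mul_super_comm' hkf (par_D l hg)
  rw [Drs_par r l hh, e, e, e1]
  simp only [map_add, map_smul, LinearMap.smul_apply, mul_mul, e2, add_mul, smul_mul_assoc,
    smul_add, smul_sub, smul_smul]
  generalize mul (D l g) * mul (D k f) * D r = X1
  generalize mul (D k f) * mul (D r g) * D l = X2
  generalize mul (D k (D r f)) * mul g * D l = X3
  generalize mul (D l (D k f)) * mul g * D r = X4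
  rcases zmod_two_cases (tau k) with h | h <;> rcases zmod_two_cases (tau l) with h' | h' <;>
    rcases zmod_two_cases (tau r) with h'' | h'' <;>
    simp only [h, h', h'', sgn_zero, sgn_one, zmod_two_one_add_one, add_zero, zero_add, mul_zero,
      zero_mul, mul_one, one_mul] <;> module

/-- The bracket of an even divergence-free element with `D_kl(g)`. -/
theorem lie_Drs (k l : Fin m ⊕ Fin n) {f : Fin m ⊕ Fin n → Alg F m n} {g : Alg F m n}
    (hf : ∀ r, f r ∈ par F m n (tau r)) (hdiv : evenDiv (vec f) = 0)
    (hg : g ∈ par F m n (tau k + tau l)) :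
    vec f * Drs k l g - Drs k l g * vec f = Drs k l (vec f g)
      + ∑ r, (sgn F (tau k + tau l + tau r * tau l + tau r * tau k + tau r) •
            Drs r k (mul (D l (f r)) g)
          - sgn F (tau k * tau l + tau r * tau l + tau r * tau k + tau r) •
            Drs r l (mul (D k (f r)) g)) := by
  have hfg : vec f g ∈ par F m n (tau k + tau l) := by
    rw [vec, LinearMap.sum_apply]
    refine Submodule.sum_mem _ fun r _ => ?_
    have := mul_D_par r (hf r) hg
    rwa [show tau r + tau r + (tau k + tau l) = tau k + tau l by
      rcases zmod_two_cases (tau r) with h | h <;> simp [h, zmod_two_one_add_one]] at this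
  have hq (a b : Fin m ⊕ Fin n) : vec f * (mul (D a g) * D b) - mul (D a g) * D b * vec f
      = mul (D a (vec f g)) * D b - (∑ r, mul (D a (f r)) * mul (D r g)) * D b
        - ∑ r, mul (D a g) * mul (D b (f r)) * D r := by
    have h1 : vec f (D a g) = D a (vec f g) - ∑ r, mul (D a (f r)) (D r g) := by
      have := LinearMap.congr_fun (D_vec a hf) g
      simp only [Module.End.mul_apply, LinearMap.add_apply, LinearMap.sum_apply] at this
      rw [this, add_sub_cancel_right]
    rw [← _root_.mul_assoc, vec_mul hf (par_D a hg), _root_.mul_assoc _ (D b), D_vec b hf, h1]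
    simp only [map_sub, map_sum, mul_mul, sub_mul, add_mul, mul_add, _root_.mul_assoc,
      Finset.mul_sum]
    abel
  have hz : ∑ r, sgn F (tau r) • D r (f r) = 0 := by
    have := hdiv
    simp only [evenDiv, LinearMap.coe_mk, AddHom.coe_mk, coeff_xv] at this
    exact this
  have hz' (a b : Fin m ⊕ Fin n) :
      ∑ r, sgn F (tau r) • (mul (D a (D r (f r))) * mul g * D b) = 0 := by
    have : mul (D a (∑ r, sgn F (tau r) • D r (f r))) * mul g * D b = 0 := by
      rw [hz]; simp
    rw [← this]
    simp only [map_sum, map_smul, Finset.sum_mul, smul_mul_assoc]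
  have term (r : Fin m ⊕ Fin n) :
      sgn F (tau k + tau l) • (mul (D l g) * mul (D k (f r)) * D r)
        - sgn F (tau k * tau l) • (mul (D k (f r)) * mul (D r g) * D l)
        - sgn F (tau k * tau l) • (mul (D k g) * mul (D l (f r)) * D r)
        + sgn F (tau k + tau l) • (mul (D l (f r)) * mul (D r g) * D k)
      = (sgn F (tau k + tau l + tau r * tau l + tau r * tau k + tau r) •
            Drs r k (mul (D l (f r)) g)
          - sgn F (tau k * tau l + tau r * tau l + tau r * tau k + tau r) •
            Drs r l (mul (D k (f r)) g))
        + sgn F (tau k * tau l) • (sgn F (tau r) • (mul (D k (D r (f r))) * mul g * D l))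
        - sgn F (tau k + tau l) • (sgn F (tau r) • (mul (D l (D r (f r))) * mul g * D k)) := by
    have t1 := lie_term k l r (hf r) hg
    have t2 := lie_term (g := g) l k r (hf r) (by rwa [add_comm])
    have e1 : D l (D k (f r)) = sgn F (tau l * tau k) • D k (D l (f r)) :=
      LinearMap.congr_fun (D_comm l k) (f r)
    rw [e1] at t1
    simp only [map_smul, smul_mul_assoc] at t1
    generalize mul (D l g) * mul (D k (f r)) * D r = X1 at *
    generalize mul (D k (f r)) * mul (D r g) * D l = X2 at *
    generalize mul (D k g) * mul (D l (f r)) * D r = X3 at *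
    generalize mul (D l (f r)) * mul (D r g) * D k = X4 at *
    generalize mul (D k (D r (f r))) * mul g * D l = X5 at *
    generalize mul (D l (D r (f r))) * mul g * D k = X6 at *
    generalize mul (D k (D l (f r))) * mul g * D r = X7 at *
    generalize Drs r k (mul (D l (f r)) g) = X8 at *
    generalize Drs r l (mul (D k (f r)) g) = X9 at *
    clear hz' hz hq hfg hdiv hf hg e1
    rcases zmod_two_cases (tau k) with h | h <;> rcases zmod_two_cases (tau l) with h' | h' <;>
      rcases zmod_two_cases (tau r) with h'' | h'' <;>
      simp only [h, h', h'', sgn_zero, sgn_one, zmod_two_one_add_one, add_zero, zero_add, mul_zero,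
        zero_mul, mul_one, one_mul] at t1 t2 ⊢
    · linear_combination (norm := module) t1 - t2
    · linear_combination (norm := module) t1 - t2
    · linear_combination (norm := module) t1 + t2
    · linear_combination (norm := module) t1 + t2
    · linear_combination (norm := module) t1 + t2
    · linear_combination (norm := module) t1 + t2
    · linear_combination (norm := module) t1 + t2
    · linear_combination (norm := module) t1 + t2
  have total := Finset.sum_congr (rfl : (Finset.univ : Finset (Fin m ⊕ Fin n)) = _)
    fun r _ => term r
  simp only [Finset.sum_add_distrib, Finset.sum_sub_distrib, ← Finset.smul_sum, hz', smul_zero,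
    add_zero, sub_zero] at total
  have hsq : sgn F ((tau k + tau l) * (tau k + tau l)) = sgn F (tau k + tau l) := by
    rcases zmod_two_cases (tau k + tau l) with h | h <;> simp [h]
  have hkl := hq k l
  have hlk := hq l k
  rw [Finset.sum_mul] at hkl hlk
  rw [Drs_par k l hg, Drs_par k l hfg, hsq, Finset.sum_sub_distrib, ← total]
  simp only [mul_sub, sub_mul, mul_smul_comm, smul_mul_assoc]
  generalize vec f * (mul (D k g) * D l) = Y1 at *
  generalize vec f * (mul (D l g) * D k) = Y2 at *
  generalize mul (D k g) * D l * vec f = Y3 at *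
  generalize mul (D l g) * D k * vec f = Y4 at *
  linear_combination (norm := module) sgn F (tau k * tau l) • hkl - sgn F (tau k + tau l) • hlk

theorem lie_mem_S {p : ℕ} [Fact p.Prime] [CharP F p] {t : Fin m → ℕ}
    {A B : Module.End F (Alg F m n)} (hA : A ∈ S F n p t) (hAW : A ∈ W F n p t)
    (hAe : A ∈ evenEnd F m n) (hB : B ∈ S F n p t) (hBe : B ∈ evenEnd F m n) :
    A * B - B * A ∈ S F n p t := by
  obtain ⟨f, hf, rfl⟩ := hAW
  have hdiv := evenDiv_homGen (even_S_mem hA hAe)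
  have hfe := even_coeff hAe
  have hB' := even_S_mem hB hBe
  clear hB hBe
  induction hB' using Submodule.span_induction with
  | mem x hx =>
    obtain ⟨k, l, g, hg, hgp, rfl⟩ := hx
    rw [add_zero] at hgp
    rw [lie_Drs k l hfe hdiv hgp]
    refine Submodule.add_mem _ (Drs_mem_S _ _ (vec_trunc hf hg)) (Submodule.sum_mem _ fun r _ => ?_)
    exact Submodule.sub_mem _
      (Submodule.smul_mem _ _ (Drs_mem_S _ _ (trunc_mul (trunc_D l (hf r)) hg)))
      (Submodule.smul_mem _ _ (Drs_mem_S _ _ (trunc_mul (trunc_D k (hf r)) hg)))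
  | zero => simp
  | add x y _ _ hx hy =>
    have : vec f * (x + y) - (x + y) * vec f
        = (vec f * x - x * vec f) + (vec f * y - y * vec f) := by
      rw [mul_add, add_mul]; abel
    rw [this]; exact Submodule.add_mem _ hx hy
  | smul c x _ hx =>
    have : vec f * (c • x) - (c • x) * vec f = c • (vec f * x - x * vec f) := by
      rw [mul_smul_comm, smul_mul_assoc, smul_sub]
    rw [this]; exact Submodule.smul_mem _ c hx

theorem S_le_W (p : ℕ) (t : Fin m → ℕ) : S F n p t ≤ W F n p t := by
  have h (f : Alg F m n) (hf : f ∈ trunc F n p t) (r : Fin m ⊕ Fin n) :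
      mul f * D r ∈ W F n p t := by
    refine ⟨fun s => if s = r then f else 0, fun s => ?_, ?_⟩
    · by_cases hs : s = r <;> simp [hs, hf]
    · rw [vec, Finset.sum_eq_single r]
      · simp
      · intro s _ hs; simp [hs]
      · simp
  have ht (c : ZMod 2) (f : Alg F m n) (hf : f ∈ trunc F n p t) : twist c f ∈ trunc F n p t := by
    refine trunc_induction (P := fun f => twist c f ∈ trunc F n p t) ?_ ?_ ?_ ?_ hf
    · intro a ha
      rw [twist, lin_mono, one_smul]
      exact mono_mem _ ha
    · simp
    · intro x y hx hy; rw [map_add]; exact Submodule.add_mem _ hx hy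
    · intro d x hx; rw [map_smul]; exact Submodule.smul_mem _ d hx
  refine Submodule.span_le.2 ?_
  rintro _ ⟨r, s, f, hf, rfl⟩
  exact Submodule.sub_mem _ (Submodule.smul_mem _ _ (h _ (trunc_D r hf) s))
    (h _ (trunc_D s (ht _ f hf)) r)

/-! ### The Lie algebras `𝒲` and `𝒮`, and derivations -/

section LieAlgebras

/-- The Lie algebra of all endomorphisms of `𝔄(m,n)`, with the commutator as bracket. -/
abbrev endLieRing : LieRing (Module.End F (Alg F m n)) := LieRing.ofAssociativeRing

abbrev endLieAlgebra : @LieAlgebra F (Module.End F (Alg F m n)) _ endLieRing :=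
  LieAlgebra.ofAssociativeAlgebra

attribute [local instance] endLieRing endLieAlgebra

/-- The Lie algebra `𝒲`, the even part of `W(m,n;t)`. On even endomorphisms the bracket
of the Lie superalgebra is the commutator. -/
def evenW (F : Type*) [Field F] (n p : ℕ) [Fact p.Prime] [CharP F p] (t : Fin m → ℕ) :
    LieSubalgebra F (Module.End F (Alg F m n)) :=
  { W F n p t ⊓ evenEnd F m n with
    lie_mem' := by
      rintro A B ⟨⟨f, hf, rfl⟩, hA⟩ ⟨⟨g, hg, rfl⟩, hB⟩
      refine ⟨?_, evenEnd_lie hA hB⟩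
      change vec f * vec g - vec g * vec f ∈ W F n p t
      rw [vec_lie (even_coeff hA) (even_coeff hB)]
      exact ⟨_, fun s => Submodule.sub_mem _ (vec_trunc hf (hg s)) (vec_trunc hg (hf s)), rfl⟩ }

/-- The Lie algebra `𝒮`, the even part of `S(m,n;t)`, as a Lie subalgebra of `𝒲`. -/
def evenS (F : Type*) [Field F] (n p : ℕ) [Fact p.Prime] [CharP F p] (t : Fin m → ℕ) :
    LieSubalgebra F (evenW F n p t) :=
  { (S F n p t).comap (evenW F n p t).toSubmodule.subtype with
    lie_mem' := by
      rintro ⟨A, hA⟩ ⟨B, hB⟩ hA' hB'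
      exact lie_mem_S hA' hA.1 hA.2 hB' hB.2 }

variable (F n)

/-- The element `D_i`, `i ∈ Y₀`, of `𝒲`. -/
def DW (p : ℕ) [Fact p.Prime] [CharP F p] (t : Fin m → ℕ) (i : Fin m) : evenW F n p t :=
  ⟨D (.inl i), by
    constructor
    · refine ⟨fun s => if s = .inl i then one else 0, fun s => ?_, ?_⟩
      · by_cases hs : s = .inl i
        · simp only [hs, if_true]
          exact mono_mem _ fun j => pow_pos (Fact.out : p.Prime).pos _
        · simp [hs]
      · rw [vec, Finset.sum_eq_single (.inl i)]
        · simp [one_mul']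
        · intro s _ hs; simp [hs]
        · simp
    · intro ε f hf
      have := par_D (.inl i) hf
      rwa [tau, zero_add] at this⟩

variable (p : ℕ) [Fact p.Prime] [CharP F p] (t : Fin m → ℕ)

/-- The space `Der(𝒮, 𝒲)` of derivations, inside the space of linear maps from `𝒮` to `𝒲`. -/
def derSW : Submodule F (evenS F n p t →ₗ[F] evenW F n p t) where
  carrier := {φ | ∃ d : LieDerivation F (evenS F n p t) (evenW F n p t), d.toLinearMap = φ}
  zero_mem' := ⟨0, rfl⟩
  add_mem' := by rintro _ _ ⟨d, rfl⟩ ⟨e, rfl⟩; exact ⟨d + e, rfl⟩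
  smul_mem' := by rintro c _ ⟨d, rfl⟩; exact ⟨c • d, rfl⟩

/-- Restriction to `𝒮` of linear maps from `𝒲` to `𝒲`. -/
def restrictS (A : Module.End F (evenW F n p t)) : evenS F n p t →ₗ[F] evenW F n p t :=
  A ∘ₗ (evenS F n p t).toSubmodule.subtype

/-- `ad 𝒲`: the space of all maps `ad E : 𝒮 → 𝒲` with `E ∈ 𝒲`. -/
def adW : Submodule F (evenS F n p t →ₗ[F] evenW F n p t) :=
  Submodule.span F {φ | ∃ E : evenW F n p t, φ = restrictS F n p t (LieAlgebra.ad F _ E)}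

/-- The span of the maps `(ad D_i)^(p^r) : 𝒮 → 𝒲` with `i ∈ Y₀` and `1 ≤ r < t_i`. -/
def adPowers : Submodule F (evenS F n p t →ₗ[F] evenW F n p t) :=
  Submodule.span F {φ | ∃ (i : Fin m) (r : ℕ), 1 ≤ r ∧ r < t i ∧
    φ = restrictS F n p t (LieAlgebra.ad F _ (DW F n p t i) ^ p ^ r)}

end LieAlgebras

end

end CartanType

namespace CartanType

noncomputable section

attribute [local instance] endLieRing endLieAlgebra

variable {F : Type*} [Field F] {m n : ℕ}

/-! ### Coefficients -/

/-! Why the theorem holds. The elements `hop i k`, that is `x_i D_i + ξ_k D_k`, are divergence-free,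
commute with one another and act diagonally on the monomial fields `x^(α) x^u D_r`. A derivation `ψ`
is corrected by inner ones until it kills the translations `D_j` and this torus. For such a
`Normalized` `ψ`, let `y` be a weight vector such that `ψ` kills every `[D_j, y]`. Then `ψ y`
commutes with all `D_j`, so its coefficients contain no `x_i`, and it has the weight of `y`. Few
weights occur among fields with constant even part: the even components are all equal, except that
one may be smaller by `1` (`weight_triple`). So `ψ y` is usually zero for reasons of weight alone,
and otherwise often a multiple of one monomial field (`weight_unique`).

Normalization. Since the `D_i` commute, the values `ψ(D_j)` satisfy `D_i ψ(D_j) = D_j ψ(D_i)`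
coefficientwise. A Poincaré lemma integrates them up to terms in `x_j^(p^{t_j} - 1)`, the only ones
that truncation prevents from being integrated (`exists_adl_top`). The torus restricts these to
multiples of `∑ z_s ξ_s D_s`, and brackets with `ξ_k ξ_l D_i` give `z_k + z_l = 0`, so all `z_s`
vanish as `n ≥ 3` and `p ≠ 2` (`diagonal_eq_zero`, `exists_adl_D`). The values on the torus are
removed in the same way, now dividing by nonzero weights (`exists_adl_hop`). The field `∑ z_k ξ_k
D_k` is still free, and it is used to kill all `ξ_k D_l` and `ξ_k ξ_l D_i` (`Normalized.exists_xi`,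
`Normalized.exists_pair`).

Outer derivations. On `x_i^(a) D_j` with `i ≠ j` the weight argument fails only for `a ≡ 0` modulo
`p`. If `a` is not a power of `p`, some binomial coefficient `C(a,b)` with `0 < b < a` is nonzero in
`F`, and the element is a bracket of killed ones. If `a = p^r` with `r ≥ 1`, then `ψ` gives a
multiple of `D_j`, exactly as `(ad D_i)^{p^r}` does. Subtracting these powers leaves a derivation
that vanishes on low-degree elements. These generate `𝒮` as a Lie algebra (`homGen_le`), so it
vanishes altogether.

The sum is direct because an inner derivation never produces a constant `D_j` term from `x_i^(N)
D_j` with `N > 1` (`cf_zero_adl`), while the powers produce their own coefficients there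
(`cf_powSum`). -/

/-- The coefficient at a basis element. -/
def cf (a : Mon m n) : Alg F m n →ₗ[F] F := Finsupp.lapply a

theorem cf_mono (a b : Mon m n) (c : F) : cf a (mono b c) = if b = a then c else 0 :=
  Finsupp.single_apply

theorem cf_ext {f g : Alg F m n} (h : ∀ a, cf a f = cf a g) : f = g := Finsupp.ext h

theorem eq_sum_mono (f : Alg F m n) : ∃ s : Finset (Mon m n), f = ∑ a ∈ s, mono a (cf a f) ∧
    ∀ a ∈ s, cf a f ≠ 0 :=
  ⟨Finsupp.support f, (Finsupp.sum_single f).symm, fun _ ha => (Finsupp.mem_support_iff.1 ha)⟩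

theorem mem_monSpan_iff {s : Set (Mon m n)} {f : Alg F m n} :
    f ∈ monSpan F s ↔ ∀ a, cf a f ≠ 0 → a ∈ s := by
  constructor
  · intro hf a ha
    by_contra h
    exact ha (monSpan_coeff hf h)
  · intro h
    obtain ⟨t, ht, hne⟩ := eq_sum_mono f
    rw [ht]
    exact Submodule.sum_mem _ fun a ha => mono_mem _ (h a (hne a ha))

theorem exists_cf (s : Set (Mon m n)) (hs : s.Finite) (e : Mon m n → F) :
    ∃ f ∈ monSpan F s, ∀ a ∈ s, cf a f = e a := by
  classical
  refine ⟨∑ a ∈ hs.toFinset, mono a (e a), Submodule.sum_mem _ fun a ha =>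
    mono_mem _ (hs.mem_toFinset.1 ha), fun a ha => ?_⟩
  simp only [map_sum, cf_mono]
  rw [Finset.sum_ite_eq' hs.toFinset a e, if_pos (hs.mem_toFinset.2 ha)]

theorem cf_D_inl (j : Fin m) (a : Mon m n) (f : Alg F m n) :
    cf a (D (.inl j) f) = cf (a.1 + Pi.single j 1, a.2) f := by
  have : (cf a ∘ₗ D (.inl j) : Alg F m n →ₗ[F] F) = cf (a.1 + Pi.single j 1, a.2) := by
    refine alg_ext fun b => ?_
    rw [LinearMap.comp_apply, D_inl_single, cf_mono]
    by_cases h : 0 < b.1 j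
    · rw [if_pos h, cf_mono]
      refine if_congr ?_ rfl rfl
      constructor
      · rintro rfl
        refine Prod.ext ?_ rfl
        funext i
        by_cases hi : i = j
        · subst hi; simp; omega
        · simp [hi]
      · rintro rfl
        refine Prod.ext ?_ rfl
        funext i
        simp
    · rw [if_neg h, map_zero, if_neg]
      rintro rfl
      simp at h
  exact LinearMap.congr_fun this f

/-- The element `ξ_k`. -/
abbrev xi (k : Fin n) : Alg F m n := xv (.inr k)

theorem tau_inl (i : Fin m) : tau (.inl i : Fin m ⊕ Fin n) = 0 := rfl

theorem tau_inr (k : Fin n) : tau (.inr k : Fin m ⊕ Fin n) = 1 := rfl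

theorem par_xi (k : Fin n) : (xi k : Alg F m n) ∈ par F m n 1 := par_xv (.inr k)

theorem par_xinl (i : Fin m) : (xv (.inl i) : Alg F m n) ∈ par F m n 0 := par_xv (.inl i)

theorem par_one : (one : Alg F m n) ∈ par F m n 0 := mono_mem _ (by simp [mpar])

theorem D_one (r : Fin m ⊕ Fin n) : D r (one : Alg F m n) = 0 := by
  rcases r with i | k
  · simp [one, D_inl_single]
  · simp [one, D_inr_single]

theorem par_D0 (i : Fin m) {ε : ZMod 2} {f : Alg F m n} (hf : f ∈ par F m n ε) :
    D (.inl i) f ∈ par F m n ε := by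
  simpa [tau_inl] using par_D (.inl i) hf

theorem par_mul0 {ε : ZMod 2} {f g : Alg F m n} (hf : f ∈ par F m n 0)
    (hg : g ∈ par F m n ε) : mul f g ∈ par F m n ε := by
  simpa using par_mul hf hg

theorem mul_comm_even {ε : ZMod 2} {f g : Alg F m n} (hf : f ∈ par F m n 0)
    (hg : g ∈ par F m n ε) : mul f g = mul g f := by
  simpa [sgn_zero] using mul_super_comm hf hg

theorem mul_assoc' (f g h : Alg F m n) : mul (mul f g) h = mul f (mul g h) := by
  rw [mul_mul]; rfl

theorem D_inl_mul (i : Fin m) (f g : Alg F m n) :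
    D (.inl i) (mul f g) = mul (D (.inl i) f) g + mul f (D (.inl i) g) := by
  have : (LinearMap.compr₂ mul (D (.inl i)) : Alg F m n →ₗ[F] Alg F m n →ₗ[F] Alg F m n)
      = mul ∘ₗ D (.inl i) + mul.compl₂ (D (.inl i)) :=
    alg_ext fun a => alg_ext fun b => D_mul_inl i a b
  exact LinearMap.congr_fun₂ this f g

theorem D_inr_mul0 (k : Fin n) {f : Alg F m n} (hf : f ∈ par F m n 0) (g : Alg F m n) :
    D (.inr k) (mul f g) = mul (D (.inr k) f) g + mul f (D (.inr k) g) := by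
  simpa [sgn_zero] using LinearMap.congr_fun (D_mul (.inr k) hf) g

theorem D_inr_mul1 (k : Fin n) {f : Alg F m n} (hf : f ∈ par F m n 1) (g : Alg F m n) :
    D (.inr k) (mul f g) = mul (D (.inr k) f) g - mul f (D (.inr k) g) := by
  have := LinearMap.congr_fun (D_mul (.inr k) hf) g
  simpa [tau_inr, sgn_one, sub_eq_add_neg] using this

theorem D_inl_comm (i : Fin m) (r : Fin m ⊕ Fin n) (f : Alg F m n) :
    D (.inl i) (D r f) = D r (D (.inl i) f) := by
  have := LinearMap.congr_fun (D_comm (F := F) (.inl i) r) f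
  simpa [tau_inl, sgn_zero] using this

theorem D_xi_inl (i : Fin m) (k : Fin n) : D (.inl i) (xi k : Alg F m n) = 0 := by
  rw [D_xv]; simp

theorem D_xi_self (k : Fin n) : D (.inr k) (xi k : Alg F m n) = one := by
  rw [D_xv]; simp

theorem D_xi_ne {k l : Fin n} (h : l ≠ k) : D (.inr l) (xi k : Alg F m n) = 0 := by
  rw [D_xv]; simp [h]

theorem D_x_inr (i : Fin m) (k : Fin n) : D (.inr k) (xv (.inl i) : Alg F m n) = 0 := by
  rw [D_xv]; simp

theorem D_x_self (i : Fin m) : D (.inl i) (xv (.inl i) : Alg F m n) = one := by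
  rw [D_xv]; simp

theorem D_x_ne {i j : Fin m} (h : j ≠ i) : D (.inl j) (xv (.inl i) : Alg F m n) = 0 := by
  rw [D_xv]; simp [h]

theorem xi_mul_self (k : Fin n) : mul (xi k) (xi k : Alg F m n) = 0 := by
  simp [xv, mul_single, mulCoeff]

theorem xi_mul_xi (k l : Fin n) : mul (xi k) (xi l : Alg F m n) = -mul (xi l) (xi k) := by
  have := mul_super_comm (par_xi (F := F) (m := m) k) (par_xi l)
  simpa [sgn_one] using this

/-! ### Elements `f D_r` and their brackets -/

/-- The operator `f D_r`. -/
def fd (f : Alg F m n) (r : Fin m ⊕ Fin n) : Module.End F (Alg F m n) := mul f * D r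

theorem fd_add (f g : Alg F m n) (r : Fin m ⊕ Fin n) : fd (f + g) r = fd f r + fd g r := by
  simp [fd, add_mul]

theorem fd_neg (f : Alg F m n) (r : Fin m ⊕ Fin n) : fd (-f) r = -fd f r := by
  simp [fd]

theorem fd_smul (c : F) (f : Alg F m n) (r : Fin m ⊕ Fin n) : fd (c • f) r = c • fd f r := by
  simp [fd]

theorem fd_zero (r : Fin m ⊕ Fin n) : fd (0 : Alg F m n) r = 0 := by simp [fd]

theorem fd_one (r : Fin m ⊕ Fin n) : fd (one : Alg F m n) r = D r := by simp [fd, one_mul']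

theorem fd_apply (f : Alg F m n) (r : Fin m ⊕ Fin n) (g : Alg F m n) :
    fd f r g = mul f (D r g) := rfl

theorem fd_xv (f : Alg F m n) (r s : Fin m ⊕ Fin n) : fd f r (xv s) = if r = s then f else 0 := by
  rw [fd_apply, D_xv]
  split <;> simp [mul_one']

theorem vec_eq_sum (f : Fin m ⊕ Fin n → Alg F m n) : vec f = ∑ r, fd (f r) r := rfl

theorem fd_eq_vec (f : Alg F m n) (r : Fin m ⊕ Fin n) : fd f r = vec (Pi.single r f) := by
  rw [vec_eq_sum, Finset.sum_eq_single r]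
  · simp
  · intro s _ hs; simp [hs, fd_zero]
  · simp

theorem fd_mul_comm {f g : Alg F m n} {r s : Fin m ⊕ Fin n} (hf : f ∈ par F m n (tau r))
    (hg : g ∈ par F m n (tau s)) :
    fd f r * mul g = mul (fd f r g) + mul g * fd f r := by
  have h : ∀ q, (Pi.single r f : Fin m ⊕ Fin n → Alg F m n) q ∈ par F m n (tau q) := by
    intro q
    by_cases hq : q = r
    · subst hq; simpa using hf
    · simp [hq]
  rw [fd_eq_vec]
  exact vec_mul h hg

/-- The second-order parts `f g D_r D_s` of the two products cancel: for even fields, the sign from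
exchanging the coefficients is the same as the one from exchanging `D_r` and `D_s`. -/
theorem lie_fd {f g : Alg F m n} {r s : Fin m ⊕ Fin n} (hf : f ∈ par F m n (tau r))
    (hg : g ∈ par F m n (tau s)) :
    ⁅fd f r, fd g s⁆ = fd (mul f (D r g)) s - fd (mul g (D s f)) r := by
  have e1 : fd f r * fd g s = fd (mul f (D r g)) s + mul g * (mul f * (D r * D s)) := by
    rw [fd.eq_1 g s, ← _root_.mul_assoc, fd_mul_comm hf hg, add_mul, fd_apply, ← fd.eq_1,
      fd.eq_1 f r]
    simp only [_root_.mul_assoc]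
  have e2 : fd g s * fd f r = fd (mul g (D s f)) r + mul f * (mul g * (D s * D r)) := by
    rw [fd.eq_1 f r, ← _root_.mul_assoc, fd_mul_comm hg hf, add_mul, fd_apply, ← fd.eq_1,
      fd.eq_1 g s]
    simp only [_root_.mul_assoc]
  have e3 : mul g * (mul f * (D r * D s)) = mul f * (mul g * (D s * D r)) := by
    rw [← _root_.mul_assoc, ← _root_.mul_assoc (mul f), D_comm r s, mul_super_comm' hg hf,
      smul_mul_smul_comm, mul_comm (tau s), sgn_mul_self, one_smul]
  rw [Ring.lie_def, e1, e2, e3]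
  abel

theorem fd_even {f : Alg F m n} {r : Fin m ⊕ Fin n} (hf : f ∈ par F m n (tau r)) :
    fd f r ∈ evenEnd F m n := by
  intro ε g hg
  have := par_mul hf (par_D r hg)
  rwa [← add_assoc, show tau r + tau r = 0 by
    rcases zmod_two_cases (tau r) with h | h <;> simp [h, zmod_two_one_add_one], zero_add] at this

theorem fd_mem_W {p : ℕ} {t : Fin m → ℕ} {f : Alg F m n} (r : Fin m ⊕ Fin n)
    (hf : f ∈ trunc F n p t) : fd f r ∈ W F n p t := by
  refine ⟨Pi.single r f, fun s => ?_, fd_eq_vec f r⟩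
  by_cases hs : s = r
  · subst hs; simpa using hf
  · simp [hs]

/-- The even part of `W(m,n;t)`, as a space of operators. -/
def W0 (F : Type*) [Field F] (n p : ℕ) (t : Fin m → ℕ) : Submodule F (Module.End F (Alg F m n)) :=
  W F n p t ⊓ evenEnd F m n

/-- The even part of `S(m,n;t)`, as a space of operators. -/
def S0 (F : Type*) [Field F] (n p : ℕ) (t : Fin m → ℕ) : Submodule F (Module.End F (Alg F m n)) :=
  S F n p t ⊓ evenEnd F m n

theorem fd_mem_W0 {p : ℕ} {t : Fin m → ℕ} {f : Alg F m n} {r : Fin m ⊕ Fin n}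
    (hf : f ∈ trunc F n p t) (hf' : f ∈ par F m n (tau r)) : fd f r ∈ W0 F n p t :=
  ⟨fd_mem_W r hf, fd_even hf'⟩

section

variable {p : ℕ} {t : Fin m → ℕ}

theorem S0_le_W0 : S0 F n p t ≤ W0 F n p t := inf_le_inf_right _ (S_le_W p t)

theorem W0_lie [Fact p.Prime] [CharP F p] {A B : Module.End F (Alg F m n)}
    (hA : A ∈ W0 F n p t) (hB : B ∈ W0 F n p t) : ⁅A, B⁆ ∈ W0 F n p t :=
  (evenW F n p t).lie_mem hA hB

theorem S0_lie [Fact p.Prime] [CharP F p] {A B : Module.End F (Alg F m n)}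
    (hA : A ∈ S0 F n p t) (hB : B ∈ S0 F n p t) : ⁅A, B⁆ ∈ S0 F n p t :=
  ⟨lie_mem_S hA.1 (S_le_W p t hA.1) hA.2 hB.1 hB.2, evenEnd_lie hA.2 hB.2⟩

theorem W_ext {A B : Module.End F (Alg F m n)} (hA : A ∈ W F n p t) (hB : B ∈ W F n p t)
    (h : ∀ r, A (xv r) = B (xv r)) : A = B := by
  obtain ⟨f, -, rfl⟩ := hA
  obtain ⟨g, -, rfl⟩ := hB
  congr 1
  funext r
  rw [← coeff_xv f r, h, coeff_xv]

theorem W_apply_trunc {A : Module.End F (Alg F m n)} (hA : A ∈ W F n p t) (r : Fin m ⊕ Fin n) :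
    A (xv r) ∈ trunc F n p t := by
  obtain ⟨f, hf, rfl⟩ := hA
  rw [coeff_xv]; exact hf r

theorem even_apply_par {A : Module.End F (Alg F m n)} (hA : A ∈ evenEnd F m n)
    (r : Fin m ⊕ Fin n) : A (xv r) ∈ par F m n (tau r) := hA _ _ (par_xv r)

theorem W_eq_sum {A : Module.End F (Alg F m n)} (hA : A ∈ W F n p t) :
    A = ∑ r, fd (A (xv r)) r := by
  obtain ⟨f, -, rfl⟩ := hA
  simp only [coeff_xv]
  rfl

theorem W_apply_one {A : Module.End F (Alg F m n)} (hA : A ∈ W F n p t) : A one = 0 := by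
  rw [W_eq_sum hA, LinearMap.sum_apply]
  exact Finset.sum_eq_zero fun r _ => by rw [fd_apply, D_one, map_zero]

/-- Elements of the even part of `W(m,n;t)` act as derivations. -/
theorem W0_apply_mul {A : Module.End F (Alg F m n)} (hA : A ∈ W0 F n p t) {ε : ZMod 2}
    {g : Alg F m n} (hg : g ∈ par F m n ε) (h : Alg F m n) :
    A (mul g h) = mul (A g) h + mul g (A h) := by
  obtain ⟨⟨f, -, rfl⟩, h2⟩ := hA
  exact LinearMap.congr_fun (vec_mul (even_coeff h2) hg) h

theorem mem_trunc_iff {f : Alg F m n} :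
    f ∈ trunc F n p t ↔ ∀ a, cf a f ≠ 0 → ∀ i, a.1 i < p ^ t i := mem_monSpan_iff

theorem mem_par_iff {ε : ZMod 2} {f : Alg F m n} :
    f ∈ par F m n ε ↔ ∀ a, cf a f ≠ 0 → mpar a = ε := mem_monSpan_iff

end

theorem exists_third {N : ℕ} (hN : 3 ≤ N) (a b : Fin N) : ∃ c, c ≠ a ∧ c ≠ b := by
  by_contra h
  push Not at h
  have : (Finset.univ : Finset (Fin N)) ⊆ {a, b} := fun c _ => by
    by_cases hc : c = a
    · simp [hc]
    · simp [h c hc]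
  have h1 := Finset.card_le_card this
  have h2 := Finset.card_le_two (a := a) (b := b)
  rw [Finset.card_univ, Fintype.card_fin] at h1
  omega

/-! ### Divergence-free elements with a prescribed even coefficient -/

/-- The element `f D_i + D_i(f) ξ_s D_s`, which is divergence-free if `D_s(f) = 0`. -/
def Y (f : Alg F m n) (i : Fin m) (s : Fin n) : Module.End F (Alg F m n) :=
  fd f (.inl i) + fd (mul (D (.inl i) f) (xi s)) (.inr s)

theorem Y_add (f g : Alg F m n) (i : Fin m) (s : Fin n) : Y (f + g) i s = Y f i s + Y g i s := by
  simp only [Y, map_add, LinearMap.add_apply, fd_add]; abel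

theorem Y_smul (c : F) (f : Alg F m n) (i : Fin m) (s : Fin n) : Y (c • f) i s = c • Y f i s := by
  simp only [Y, map_smul, LinearMap.smul_apply, fd_smul, smul_add]

theorem Y_zero (i : Fin m) (s : Fin n) : Y (0 : Alg F m n) i s = 0 := by
  simp [Y, fd_zero]

theorem Y_of_D_eq_zero {f : Alg F m n} {i : Fin m} (h : D (.inl i) f = 0) (s : Fin n) :
    Y f i s = fd f (.inl i) := by
  simp [Y, h, fd_zero]

theorem par_mul_xi {f : Alg F m n} (hf : f ∈ par F m n 0) (s : Fin n) :
    mul f (xi s) ∈ par F m n (tau (.inr s : Fin m ⊕ Fin n)) := par_mul0 hf (par_xi s)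

theorem D_inr_mul_xi {f : Alg F m n} (hf : f ∈ par F m n 0) {s : Fin n}
    (hs : D (.inr s) f = 0) : D (.inr s) (mul f (xi s)) = f := by
  rw [D_inr_mul0 _ hf, hs, D_xi_self, mul_one']; simp

theorem D_inl_mul_xi (i : Fin m) (f : Alg F m n) (s : Fin n) :
    D (.inl i) (mul f (xi s)) = mul (D (.inl i) f) (xi s) := by
  rw [D_inl_mul, D_xi_inl]; simp

/-- This is the bracket of the fields `f D_i` and `g D_j`. The term in `ξ_s D_s` compensates the
divergence without disturbing brackets, as long as the coefficients do not involve `ξ_s`. Generating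
divergence-free elements thus reduces to computing with arbitrary fields `f D_i`. -/
theorem lie_Y {f g : Alg F m n} (hf : f ∈ par F m n 0) (hg : g ∈ par F m n 0) {s : Fin n}
    (hfs : D (.inr s) f = 0) (hgs : D (.inr s) g = 0) (i j : Fin m) :
    ⁅Y f i s, Y g j s⁆ = Y (mul f (D (.inl i) g)) j s - Y (mul g (D (.inl j) f)) i s := by
  have hf' := par_D0 i hf
  have hg' := par_D0 j hg
  have hfs' : D (.inr s) (D (.inl i) f) = 0 := by rw [← D_inl_comm, hfs, map_zero]
  have hgs' : D (.inr s) (D (.inl j) g) = 0 := by rw [← D_inl_comm, hgs, map_zero]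
  have e : mul (mul (D (.inl i) f) (xi s)) (D (.inl j) g)
      = mul (mul (D (.inl j) g) (xi s)) (D (.inl i) f) := by
    rw [mul_assoc', ← mul_comm_even hg' (par_xi s), ← mul_assoc', mul_comm_even hf' hg',
      mul_assoc', mul_comm_even hf' (par_xi s), ← mul_assoc']
  rw [Y, Y, lie_add, add_lie, add_lie, lie_fd (r := .inl i) (s := .inl j) hf hg,
    lie_fd (r := .inr s) (s := .inl j) (par_mul_xi hf' s) hg,
    lie_fd (r := .inl i) (s := .inr s) hf (par_mul_xi hg' s),
    lie_fd (r := .inr s) (s := .inr s) (par_mul_xi hf' s) (par_mul_xi hg' s),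
    hfs, hgs, D_inr_mul_xi hf' hfs', D_inr_mul_xi hg' hgs', e, D_inl_mul_xi, D_inl_mul_xi,
    Y, Y, D_inl_mul, D_inl_mul, D_inl_comm i (.inl j) g, D_inl_comm i (.inl j) f,
    mul_comm_even (par_D0 j hf) (par_D0 i hg)]
  simp only [map_add, LinearMap.add_apply, fd_add, mul_assoc', map_zero, fd_zero]
  abel

/-! ### Monomials -/

theorem par_mono {α : Fin m → ℕ} {u : Finset (Fin n)} {ε : ZMod 2} (h : (u.card : ZMod 2) = ε)
    (c : F) : mono (α, u) c ∈ par F m n ε := mono_mem _ h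

theorem exists_add_single {α : Fin m → ℕ} {i : Fin m} (h : 0 < α i) :
    ∃ δ : Fin m → ℕ, α = δ + Pi.single i 1 := by
  refine ⟨α - Pi.single i 1, ?_⟩
  funext q
  by_cases hq : q = i
  · subst hq; simp only [Pi.add_apply, Pi.sub_apply, Pi.single_eq_same]; omega
  · simp only [Pi.add_apply, Pi.sub_apply, Pi.single_eq_of_ne hq]; rfl

theorem D_inl_mono_add (i : Fin m) (α : Fin m → ℕ) (u : Finset (Fin n)) (c : F) :
    D (.inl i) (mono (α + Pi.single i 1, u) c) = mono (α, u) c := by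
  rw [D_inl_single, if_pos (by simp)]
  simp

theorem D_inl_mono_zero {i : Fin m} {α : Fin m → ℕ} (h : α i = 0) (u : Finset (Fin n)) (c : F) :
    D (.inl i) (mono (α, u) c) = 0 := by
  rw [D_inl_single, if_neg (by simp [h])]

theorem D_inr_mono_notMem {k : Fin n} {u : Finset (Fin n)} (h : k ∉ u) (α : Fin m → ℕ) (c : F) :
    D (.inr k) (mono (α, u) c) = 0 := by
  rw [D_inr_single, if_neg h]

theorem inversions_empty_left (u : Finset (Fin n)) : inversions ∅ u = 0 := by
  simp [inversions]

theorem mono_mul_disj {α β : Fin m → ℕ} (h : ∀ i, α i = 0 ∨ β i = 0) (u : Finset (Fin n)) :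
    mul (mono (α, ∅) (1 : F)) (mono (β, u) 1) = mono (α + β, u) 1 := by
  rw [mul_single]
  have : mulCoeff F (α, (∅ : Finset (Fin n))) (β, u) = 1 := by
    simp only [mulCoeff, Finset.disjoint_empty_left, if_true, inversions_empty_left, pow_zero,
      mul_one]
    refine Finset.prod_eq_one fun i _ => ?_
    rcases h i with h | h <;> simp [h]
  simp [this]

theorem x_mul_mono (i : Fin m) (β : Fin m → ℕ) (u : Finset (Fin n)) :
    mul (xv (.inl i)) (mono (β, u) (1 : F)) = ((β i + 1 : ℕ) : F) • mono (β + Pi.single i 1, u) 1 := by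
  rw [xv, mul_single]
  have : mulCoeff F (Pi.single i 1, (∅ : Finset (Fin n))) (β, u) = ((β i + 1 : ℕ) : F) := by
    simp only [mulCoeff, Finset.disjoint_empty_left, if_true, inversions_empty_left, pow_zero,
      mul_one]
    rw [Finset.prod_eq_single i]
    · rw [Pi.single_eq_same, Nat.choose_one_right, add_comm]
    · intro j _ hj; simp [hj]
    · simp
  simp [this, smul_mono, add_comm]

theorem xv_inl_eq (i : Fin m) : (xv (.inl i) : Alg F m n) = mono (Pi.single i 1, ∅) 1 := rfl

theorem trunc_mono {p : ℕ} {t : Fin m → ℕ} {a : Mon m n} (h : ∀ i, a.1 i < p ^ t i) (c : F) :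
    mono a c ∈ trunc F n p t := mono_mem _ h

theorem three_lt_pow {p : ℕ} {t : Fin m → ℕ} (hp : 3 < p) (ht : ∀ i, 1 ≤ t i) (i : Fin m) : 3 < p ^ t i :=
  lt_of_lt_of_le hp (Nat.le_self_pow (by have := ht i; omega) p)

/-! ### Generation of the part with purely even coefficients -/

section Generation

variable {p : ℕ} [CharP F p] {t : Fin m → ℕ}

theorem natCast_pow_sub_one (i : Fin m) (ht : 1 ≤ t i) {a : ℕ} (ha : a + 1 = p ^ t i) :
    (a : F) = -1 := by
  have : ((a + 1 : ℕ) : F) = 0 := by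
    rw [ha, Nat.cast_pow, CharP.cast_eq_zero, zero_pow (by omega)]
  push_cast at this
  linear_combination this

theorem two_ne_zero_of_lt (hp : 3 < p) : (2 : F) ≠ 0 := by
  intro h
  have : ((2 : ℕ) : F) = 0 := by exact_mod_cast h
  rw [CharP.cast_eq_zero_iff F p] at this
  have := Nat.le_of_dvd (by norm_num) this
  omega

/-- By `lie_Y` this says that the fields `x^(α) D_l` in the even variables are generated by the
`x_i^(a) D_j` with `i ≠ j` and the `x_i^(2) D_i`. Exponents are raised by brackets. The case that
needs care is an exponent already equal to `p^{t_i} - 1`, which cannot be raised first and then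
lowered by `D_i`; there the scalar `-1` or `-2` replaces the missing room. -/
theorem Y_even_mem {K : Submodule F (Module.End F (Alg F m n))} (hp : 3 < p) (hm : 3 ≤ m) (ht : ∀ i, 1 ≤ t i)
    (hK : ∀ A ∈ K, ∀ B ∈ K, ⁅A, B⁆ ∈ K) (s : Fin n)
    (h1 : ∀ i j, i ≠ j → ∀ a, a < p ^ t i → Y (mono (Pi.single i a, ∅) 1) j s ∈ K)
    (h3 : ∀ i, Y (mono (Pi.single i 2, ∅) 1) i s ∈ K)
    (α : Fin m → ℕ) (hα : ∀ i, α i < p ^ t i) (l : Fin m) :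
    Y (mono (α, ∅) 1) l s ∈ K := by
  have hpt := three_lt_pow hp ht
  have br {α β : Fin m → ℕ} {i j : Fin m} (ha : Y (mono (α, ∅) 1) i s ∈ K)
      (hb : Y (mono (β, ∅) 1) j s ∈ K) :
      Y (mul (mono (α, ∅) 1) (D (.inl i) (mono (β, ∅) 1))) j s
        - Y (mul (mono (β, ∅) 1) (D (.inl j) (mono (α, ∅) 1))) i s ∈ K := by
    rw [← lie_Y (par_mono (by simp) 1) (par_mono (by simp) 1) (D_inr_mono_notMem (by simp) _ _)
      (D_inr_mono_notMem (by simp) _ _)]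
    exact hK _ ha _ hb
  have br0 {α β : Fin m → ℕ} {i j : Fin m} (ha : Y (mono (α, ∅) 1) i s ∈ K)
      (hb : Y (mono (β + Pi.single i 1, ∅) 1) j s ∈ K) (h0 : α j = 0) :
      Y (mul (mono (α, ∅) 1) (mono (β, ∅) 1)) j s ∈ K := by
    have := br ha hb
    rwa [D_inl_mono_add, D_inl_mono_zero h0, map_zero, Y_zero, sub_zero] at this
  -- `[x_i^(a) D_j, x_j^(2) D_j] = x_i^(a) x_j D_j`.
  have f1 {i j : Fin m} (hij : i ≠ j) {a : ℕ} (ha : a < p ^ t i) :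
      Y (mono (Pi.single i a + Pi.single j 1, ∅) 1) j s ∈ K := by
    have hb := h3 j
    rw [show (2 : ℕ) = 1 + 1 from rfl, Pi.single_add] at hb
    have := br0 (h1 i j hij a ha) hb (by simp [hij.symm])
    rwa [mono_mul_disj] at this
    intro k
    by_cases hk : k = i
    · subst hk; right; simp [hij]
    · left; simp [hk]
  -- `[x_j D_i, x_i^(a+1) D_j] = x_i^(a) x_j D_j - x_i^(a+1) D_i`, whose first term is covered by
  -- `f1`.
  have f2 (i : Fin m) {a : ℕ} (ha : a < p ^ t i) : Y (mono (Pi.single i a, ∅) 1) i s ∈ K := by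
    obtain ⟨j, hj, -⟩ := exists_third hm i i
    rcases a with _ | a
    · have := h1 j i hj 0 (by have := hpt j; omega)
      simpa using this
    · have hb := h1 i j hj.symm (a + 1) ha
      rw [Pi.single_add] at hb
      have ha' := h1 j i hj 1 (by have := hpt j; omega)
      have := br ha' hb
      rw [D_inl_mono_add, ← zero_add (Pi.single j 1 : Fin m → ℕ), D_inl_mono_add, zero_add,
        mono_mul_disj, add_comm] at this
      · rw [← Pi.single_add] at this
        have h4 := f1 hj.symm (a := a) (by omega)
        have h5 := K.sub_mem h4 this
        rw [sub_sub_cancel] at h5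
        have h6 : mul (mono (Pi.single i (a + 1), ∅) (1 : F)) (mono (0, ∅) 1 : Alg F m n)
          = mono (Pi.single i (a + 1), ∅) 1 := mul_one' _
        rwa [h6] at h5
      · intro k
        by_cases hk : k = j
        · subst hk; right; simp [hj]
        · left; simp [hk]
  have f3 {i l : Fin m} (hil : i ≠ l) {a : ℕ} (ha : a < p ^ t l) :
      Y (mono (Pi.single i 1 + Pi.single l a, ∅) 1) l s ∈ K := by
    have h1a := h1 i l hil 1 (by have := hpt i; omega)
    have low {a : ℕ} (ha : a + 1 < p ^ t l) :
        Y (mono (Pi.single i 1 + Pi.single l a, ∅) 1) l s ∈ K := by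
      have hb := f2 l ha
      rw [Pi.single_add] at hb
      have := br0 h1a hb (by simp [hil.symm])
      rwa [mono_mul_disj] at this
      intro k
      by_cases hk : k = i
      · subst hk; right; simp [hil]
      · left; simp [hk]
    by_cases ha1 : a + 1 < p ^ t l
    · exact low ha1
    -- At the top exponent, `[x_i x_l D_l, x_l^(a) D_l] = (a - 1) x_i x_l^(a) D_l`, and `a - 1 = -2`
    -- in `F`.
    · have ha2 : a + 1 = p ^ t l := by omega
      obtain ⟨b, rfl⟩ : ∃ b, a = b + 1 := ⟨a - 1, by have := hpt l; omega⟩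
      have hA := low (a := 1) (by have := hpt l; omega)
      have hB := f2 l ha
      have := br hA hB
      have e0 : mono (Pi.single i 1 + Pi.single l 1, ∅) (1 : F)
          = mul (xv (.inl l)) (mono (Pi.single i 1, ∅) (1 : F) : Alg F m n) := by
        rw [x_mul_mono]; simp [hil.symm]
      have e1 : mul (mono (Pi.single i 1 + Pi.single l 1, ∅) (1 : F)) (mono (Pi.single l b, ∅) 1)
          = ((b + 1 : ℕ) : F) • (mono (Pi.single i 1 + Pi.single l (b + 1), ∅) 1 : Alg F m n) := by
        rw [e0, mul_assoc', mono_mul_disj, x_mul_mono]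
        · rw [add_assoc, ← Pi.single_add]; simp [hil.symm]
        · intro k
          by_cases hk : k = i
          · subst hk; right; simp [hil]
          · left; simp [hk]
      have e2 : mul (mono (Pi.single l (b + 1), ∅) (1 : F)) (mono (Pi.single i 1, ∅) 1)
          = (mono (Pi.single i 1 + Pi.single l (b + 1), ∅) 1 : Alg F m n) := by
        rw [mono_mul_disj, add_comm]
        intro k
        by_cases hk : k = i
        · subst hk; left; simp [hil]
        · right; simp [hk]
      have e3 : D (.inl l) (mono (Pi.single l (b + 1), ∅) (1 : F) : Alg F m n)
          = mono (Pi.single l b, ∅) 1 := by rw [Pi.single_add, D_inl_mono_add]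
      rw [e3, D_inl_mono_add, e1, e2, Y_smul,
        natCast_pow_sub_one (F := F) l (ht l) ha2] at this
      generalize Y (mono (Pi.single i 1 + Pi.single l (b + 1), ∅) (1 : F)) l s = Z at this ⊢
      refine (K.smul_mem_iff (neg_ne_zero.2 (two_ne_zero_of_lt (F := F) hp))).1 ?_
      convert this using 1
      module
  -- `[x_j^(b) D_i, x_i x_l^(a) D_l]` with a third index `i`; this uses `m ≥ 3`.
  have f4 {j l : Fin m} (hjl : j ≠ l) {a b : ℕ} (ha : a < p ^ t l) (hb : b < p ^ t j) :
      Y (mono (Pi.single j b + Pi.single l a, ∅) 1) l s ∈ K := by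
    obtain ⟨i, hij, hil⟩ := exists_third hm j l
    have hB := f3 hil ha
    rw [add_comm] at hB
    have := br0 (h1 j i hij.symm b hb) hB (by simp [hjl.symm])
    rwa [mono_mul_disj] at this
    intro k
    by_cases hk : k = j
    · subst hk; right; simp [hjl]
    · left; simp [hk]
  obtain ⟨j, hjl, -⟩ := exists_third hm l l
  -- Induction on the variables other than `x_l` and `x_j` that may occur. The variable `x_j` serves
  -- as the carrier: bracketing with a field in direction `D_j` brings in one more factor
  -- `x_i^(α_i)`.
  have f5 (T : Finset (Fin m)) (hT : l ∉ T) (hT' : j ∉ T) : ∀ α : Fin m → ℕ,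
      (∀ i, α i < p ^ t i) → (∀ i ∉ T, i ≠ l → i ≠ j → α i = 0) →
      Y (mono (α, ∅) 1) l s ∈ K := by
    induction T using Finset.induction_on with
    | empty =>
      intro α hα h0
      have : α = Pi.single j (α j) + Pi.single l (α l) := by
        funext i
        by_cases hi : i = l
        · subst hi; simp [hjl.symm]
        · by_cases hi' : i = j
          · subst hi'; simp [hjl]
          · simp [hi, hi', h0 i (by simp) hi hi']
      rw [this]
      exact f4 hjl (hα l) (hα j)
    | insert i T hi ih =>
      intro α hα h0
      simp only [Finset.mem_insert, not_or] at hT hT'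
      have ih' := ih hT.2 hT'.2
      set γ := Function.update α i 0 with hγ
      have hγi : γ i = 0 := by simp [hγ]
      have hγj : γ j = α j := by simp [hγ, hT'.1]
      have hsum : Pi.single i (α i) + γ = α := by
        funext k
        by_cases hk : k = i
        · subst hk; simp [hγ]
        · simp [hγ, hk]
      have hγlt : ∀ k, γ k < p ^ t k := by
        intro k
        by_cases hk : k = i
        · subst hk; rw [hγi]; have := hpt k; omega
        · simp [hγ, hk, hα k]
      have hγ0 : ∀ k ∉ T, k ≠ l → k ≠ j → γ k = 0 := by
        intro k hkT hkl hkj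
        by_cases hk : k = i
        · subst hk; exact hγi
        · simp only [hγ, Function.update_of_ne hk]
          exact h0 k (by simp [hk, hkT]) hkl hkj
      have hdisj : ∀ k, (Pi.single i (α i) : Fin m → ℕ) k = 0 ∨ γ k = 0 := by
        intro k
        by_cases hk : k = i
        · subst hk; right; exact hγi
        · left; simp [hk]
      -- If there is room, bracket `x_i^(α_i) D_j` with `x^(γ) x_j`-raised field. Otherwise use
      -- `x_i^(α_i) x_j D_j`, which leaves the exponent of `x_j` unchanged and contributes the
      -- factor `γ_j = -1`.
      by_cases htop : γ j + 1 < p ^ t j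
      · have hB := ih' (γ + Pi.single j 1) (fun k => by
          by_cases hk : k = j
          · subst hk; simpa using htop
          · simpa [hk] using hγlt k) (fun k h1 h2 h3 => by simp [hγ0 k h1 h2 h3, h3])
        have := br0 (h1 i j (Ne.symm hT'.1) (α i) (hα i)) hB (by simp [hT.1])
        rwa [mono_mul_disj hdisj, hsum] at this
      · have hB := ih' γ hγlt hγ0
        have := br (f1 (Ne.symm hT'.1) (hα i)) hB
        rw [D_inl_mono_zero (i := l) (by simp [hT.1, hjl.symm]), map_zero, Y_zero, sub_zero] at this
        have hpos : γ j + 1 = p ^ t j := by have := hγlt j; omega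
        obtain ⟨δ, hδ⟩ := exists_add_single (α := γ) (i := j) (by have := hpt j; omega)
        have hδj : δ j + 1 = γ j := by simp [hδ]
        have e : mul (mono (Pi.single i (α i) + Pi.single j 1, ∅) (1 : F)) (mono (δ, ∅) 1)
            = (-1 : F) • (mono (α, ∅) 1 : Alg F m n) := by
          have e0 : (mono (Pi.single i (α i) + Pi.single j 1, ∅) (1 : F) : Alg F m n)
              = mul (mono (Pi.single i (α i), ∅) (1 : F)) (xv (.inl j)) := by
            rw [xv, mono_mul_disj]
            intro k
            by_cases hk : k = i
            · subst hk; right; simp [Ne.symm hT'.1]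
            · left; simp [hk]
          rw [e0, mul_assoc', x_mul_mono, ← hδ, hδj, natCast_pow_sub_one (F := F) j (ht j) hpos,
            map_smul, mono_mul_disj hdisj, hsum]
        rw [hδ, D_inl_mono_add, e, Y_smul] at this
        simpa using K.smul_mem (-1 : F) this
  have hmem (i : Fin m) : i ∈ (Finset.univ.erase l).erase j ↔ i ≠ j ∧ i ≠ l := by
    rw [Finset.mem_erase, Finset.mem_erase]
    exact and_congr_right fun _ => and_iff_left (Finset.mem_univ i)
  exact f5 ((Finset.univ.erase l).erase j) (fun h => ((hmem l).1 h).2 rfl)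
    (fun h => ((hmem j).1 h).1 rfl) α hα fun i hi h1 h2 => absurd ((hmem i).2 ⟨h2, h1⟩) hi

end Generation

/-! ### Generation of the elements involving odd variables -/

theorem mono_zero_mul {u v : Finset (Fin n)} (h : Disjoint u v) : ∃ c : F, c ≠ 0 ∧
    ∀ α : Fin m → ℕ, mul (mono (0, u) (1 : F)) (mono (α, v) 1) = c • mono (α, u ∪ v) 1 := by
  refine ⟨(-1) ^ inversions u v, pow_ne_zero _ (by simp), fun α => ?_⟩
  rw [mul_single]
  simp [mulCoeff, h, smul_mono]

theorem mono_mul_xi {k : Fin n} {v : Finset (Fin n)} (h : k ∉ v) : ∃ c : F, c ≠ 0 ∧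
    ∀ α : Fin m → ℕ, mul (mono (α, v) (1 : F)) (xi k) = c • mono (α, insert k v) 1 := by
  refine ⟨(-1) ^ inversions v {k}, pow_ne_zero _ (by simp), fun α => ?_⟩
  rw [xi, xv, mul_single, Finset.union_comm, ← Finset.insert_eq]
  simp [mulCoeff, h, smul_mono]

theorem xi_mul_xi_eq {k l : Fin n} (h : k ≠ l) : ∃ c : F, c ≠ 0 ∧
    mul (xi k) (xi l : Alg F m n) = c • mono (0, {k, l}) 1 := by
  obtain ⟨c, hc, e⟩ := mono_zero_mul (F := F) (m := m) (u := {k}) (v := {l}) (by simpa using h)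
  exact ⟨c, hc, e 0⟩

theorem card_erase_even {k : Fin n} {u : Finset (Fin n)} (h : k ∈ u)
    (hu : (u.card : ZMod 2) = 1) : ((u.erase k).card : ZMod 2) = 0 := by
  have := Finset.card_erase_add_one h
  rw [← this] at hu
  push_cast at hu
  exact add_eq_right.1 hu

theorem card_erase_odd {k : Fin n} {u : Finset (Fin n)} (h : k ∈ u)
    (hu : (u.card : ZMod 2) = 0) : ((u.erase k).card : ZMod 2) = 1 := by
  have := Finset.card_erase_add_one h
  rw [← this] at hu
  push_cast at hu
  revert hu
  generalize ((u.erase k).card : ZMod 2) = z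
  revert z; decide

theorem D_inl_mono_mem {V : Type*} [AddCommGroup V] [Module F V] (K : Submodule F V)
    (L : Alg F m n →ₗ[F] V) (i : Fin m) (α : Fin m → ℕ) (u : Finset (Fin n)) {q : Fin m → ℕ}
    (hα : ∀ i, α i < q i) (h : ∀ β : Fin m → ℕ, (∀ i, β i < q i) → L (mono (β, u) 1) ∈ K) :
    L (D (.inl i) (mono (α, u) 1)) ∈ K := by
  rw [D_inl_single]
  split
  · exact h _ fun j => lt_of_le_of_lt (Nat.sub_le _ _) (hα j)
  · rw [map_zero]; exact K.zero_mem

/-- `f ↦ f D_r` as a linear map. -/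
def fdL (r : Fin m ⊕ Fin n) : Alg F m n →ₗ[F] Module.End F (Alg F m n) where
  toFun f := fd f r
  map_add' f g := fd_add f g r
  map_smul' c f := fd_smul c f r

/-- `f ↦ f D_i + D_i(f) ξ_s D_s` as a linear map. -/
def YL (i : Fin m) (s : Fin n) : Alg F m n →ₗ[F] Module.End F (Alg F m n) where
  toFun f := Y f i s
  map_add' f g := Y_add f g i s
  map_smul' c f := Y_smul c f i s

theorem D_inr_mul_xi_ne {f : Alg F m n} (hf : f ∈ par F m n 0) {l k : Fin n} (h : l ≠ k)
    (hl : D (.inr l) f = 0) : D (.inr l) (mul f (xi k)) = 0 := by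
  rw [D_inr_mul0 _ hf, hl, D_xi_ne h]; simp

section Generation

variable {p : ℕ} [CharP F p] {t : Fin m → ℕ} {K : Submodule F (Module.End F (Alg F m n))}

/-- Two odd variables are brought in at a time, by a bracket with `P D_i`, `P` being `ξ_k ξ_l` up to
sign. The index `s` of the compensating term lies outside `w`, so that `lie_Y` applies throughout.
-/
theorem Y_xi_mem (hp : 3 < p) (hm : 3 ≤ m) (ht : ∀ i, 1 ≤ t i)
    (hK : ∀ A ∈ K, ∀ B ∈ K, ⁅A, B⁆ ∈ K)
    (hY : ∀ (s : Fin n) (α : Fin m → ℕ), (∀ i, α i < p ^ t i) → ∀ l, Y (mono (α, ∅) 1) l s ∈ K)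
    (hP : ∀ k l : Fin n, k ≠ l → ∀ i, fd (mono (0, {k, l}) 1) (.inl i) ∈ K) (N : ℕ) :
    ∀ w : Finset (Fin n), w.card = 2 * N → ∀ s ∉ w, ∀ α : Fin m → ℕ, (∀ i, α i < p ^ t i) → ∀ j,
      Y (mono (α, w) 1) j s ∈ K := by
  have hpt := three_lt_pow hp ht
  induction N with
  | zero =>
    intro w hw s _ α hα j
    rw [Finset.card_eq_zero.1 hw]
    exact hY s α hα j
  | succ N ih =>
    intro w hw s hs α hα j
    obtain ⟨k, hk⟩ := Finset.card_pos.1 (by omega : 0 < w.card)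
    have hc1 := Finset.card_erase_add_one hk
    obtain ⟨l, hl⟩ := Finset.card_pos.1 (by omega : 0 < (w.erase k).card)
    have hc2 := Finset.card_erase_add_one hl
    set v := (w.erase k).erase l with hv
    have hlk : l ≠ k := (Finset.mem_erase.1 hl).1
    have hw' : {k, l} ∪ v = w := by
      rw [hv]
      ext q
      simp only [Finset.mem_union, Finset.mem_insert, Finset.mem_singleton, Finset.mem_erase]
      by_cases h1 : q = k
      · simp [h1, hk]
      · by_cases h2 : q = l
        · simp [h2, Finset.mem_of_mem_erase hl]
        · simp [h1, h2]
    have hdisj : Disjoint ({k, l} : Finset (Fin n)) v := by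
      rw [hv]; simp
    have hsv : s ∉ v := fun h => hs (hw' ▸ Finset.mem_union_right _ h)
    have hskl : s ∉ ({k, l} : Finset (Fin n)) := fun h => hs (hw' ▸ Finset.mem_union_left _ h)
    have hvc : v.card = 2 * N := by omega
    have ihv := ih v hvc s hsv
    obtain ⟨c, hc, hmul⟩ := mono_zero_mul (F := F) (m := m) hdisj
    rw [hw'] at hmul
    set P : Alg F m n := mono (0, {k, l}) 1 with hPdef
    have hDP (i : Fin m) : D (.inl i) P = 0 := D_inl_mono_zero rfl _ _
    have hDPs : D (.inr s) P = 0 := D_inr_mono_notMem hskl _ _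
    have hPK (i : Fin m) : Y P i s ∈ K := by
      rw [Y_of_D_eq_zero (hDP i)]; exact hP k l hlk.symm i
    have hPe : P ∈ par F m n 0 := par_mono (by
      rw [Finset.card_pair hlk.symm]; decide) 1
    have hve (β : Fin m → ℕ) : mono (β, v) (1 : F) ∈ par F m n 0 := par_mono (by
      rw [hvc]; push_cast; rw [show (2 : ZMod 2) = 0 by decide, zero_mul]) 1
    have hvs (β : Fin m → ℕ) : D (.inr s) (mono (β, v) (1 : F)) = 0 := D_inr_mono_notMem hsv _ _
    by_cases hlow : ∃ i, α i + 1 < p ^ t i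
    · obtain ⟨i, hi⟩ := hlow
      have hB := ihv (α + Pi.single i 1) (fun q => by
        by_cases hq : q = i
        · subst hq; simpa using hi
        · simpa [hq] using hα q) j
      have := hK _ (hPK i) _ hB
      rw [lie_Y hPe (hve _) hDPs (hvs _), D_inl_mono_add, hDP, map_zero, Y_zero, sub_zero, hmul,
        Y_smul] at this
      exact (K.smul_mem_iff hc).1 this
    -- All exponents are maximal, so none can be raised. Bracketing `P D_i` with the element for
    -- `x_i^(2)` first gives the one for `P x_i`; its bracket with `x^(α) x^v D_j`, `i ≠ j`, has the
    -- factor `α_i = -1`.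
    · push Not at hlow
      obtain ⟨i, hij, -⟩ := exists_third hm j j
      have hA : Y (mul P (xv (.inl i))) i s ∈ K := by
        have hB := hY s (Pi.single i 1 + Pi.single i 1) (fun q => by
          by_cases hq : q = i
          · subst hq; have := hpt q; simp; omega
          · have := hpt q; simp [hq]; omega) i
        have := hK _ (hPK i) _ hB
        rwa [lie_Y hPe (par_mono (by simp) 1) hDPs (D_inr_mono_notMem (by simp) _ _),
          D_inl_mono_add, hDP, map_zero, Y_zero, sub_zero] at this
      have hB := ihv α hα j
      have := hK _ hA _ hB
      obtain ⟨δ, hδ⟩ := exists_add_single (α := α) (i := i) (by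
        have := hpt i; have := hlow i; omega)
      have hδi : δ i + 1 = α i := by simp [hδ]
      have htop : α i + 1 = p ^ t i := le_antisymm (hα i) (hlow i)
      rw [lie_Y (par_mul0 hPe (par_xinl i)) (hve _) (by
          rw [D_inr_mul0 _ hPe, hDPs, D_x_inr]; simp) (hvs _), D_inl_mul, hDP, D_x_ne hij.symm,
        map_zero, map_zero, LinearMap.zero_apply, add_zero, map_zero, Y_zero, sub_zero, hδ,
        D_inl_mono_add, mul_assoc', x_mul_mono, hδi, ← hδ,
        natCast_pow_sub_one (F := F) i (ht i) htop, map_smul, hmul, Y_smul, Y_smul] at this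
      exact (K.smul_mem_iff hc).1 ((K.smul_mem_iff (by simp)).1 this)

/-- Write the coefficient as `f ξ_k` up to sign. The brackets of `x_i ξ_k D_l` with `Y f i k` and
with `Y f i l` are `f ξ_k D_l` plus, respectively minus, `D_i(f) x_i ξ_k D_l`. Their sum is `2 f ξ_k
D_l`, and no exponent had to be raised. -/
theorem fd_xi_mem (hp : 3 < p) (hm : 3 ≤ m)
    (hK : ∀ A ∈ K, ∀ B ∈ K, ⁅A, B⁆ ∈ K)
    (hQ : ∀ w : Finset (Fin n), (w.card : ZMod 2) = 0 → ∀ s ∉ w, ∀ α : Fin m → ℕ,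
      (∀ i, α i < p ^ t i) → ∀ j, Y (mono (α, w) 1) j s ∈ K)
    (hx : ∀ k l : Fin n, k ≠ l → ∀ i, fd (mul (xv (.inl i)) (xi k)) (.inr l) ∈ K)
    (u : Finset (Fin n)) (hu : (u.card : ZMod 2) = 1) (l : Fin n) (hl : l ∉ u) (α : Fin m → ℕ)
    (hα : ∀ i, α i < p ^ t i) : fd (mono (α, u) 1) (.inr l) ∈ K := by
  obtain ⟨k, hk⟩ : u.Nonempty := by
    rw [Finset.nonempty_iff_ne_empty]; rintro rfl; simp at hu
  have hlk : l ≠ k := fun h => hl (h ▸ hk)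
  have hkv : k ∉ u.erase k := by simp
  have hlv : l ∉ u.erase k := fun h => hl (Finset.mem_of_mem_erase h)
  have hv := card_erase_even hk hu
  obtain ⟨c, hc, hmul⟩ := mono_mul_xi (F := F) (m := m) hkv
  rw [Finset.insert_erase hk] at hmul
  set i : Fin m := ⟨0, by omega⟩
  set f : Alg F m n := mono (α, u.erase k) 1 with hf
  have hfe : f ∈ par F m n 0 := par_mono hv 1
  have hfk : D (.inr k) f = 0 := D_inr_mono_notMem hkv _ _
  have hfl : D (.inr l) f = 0 := D_inr_mono_notMem hlv _ _
  have hf'e := par_D0 i hfe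
  have hfk' : D (.inr k) (D (.inl i) f) = 0 := by rw [← D_inl_comm, hfk, map_zero]
  have hfl' : D (.inr l) (D (.inl i) f) = 0 := by rw [← D_inl_comm, hfl, map_zero]
  have hge : mul (xv (.inl i)) (xi k) ∈ par F m n (tau (.inr l : Fin m ⊕ Fin n)) :=
    par_mul_xi (par_xinl i) k
  have hDi : D (.inl i) (mul (xv (.inl i)) (xi k)) = (xi k : Alg F m n) := by
    rw [D_inl_mul_xi, D_x_self, one_mul']; rfl
  have hDk : D (.inr k) (mul (xv (.inl i)) (xi k)) = (xv (.inl i) : Alg F m n) :=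
    D_inr_mul_xi (par_xinl i) (D_x_inr i k)
  have hDl : D (.inr l) (mul (xv (.inl i)) (xi k)) = (0 : Alg F m n) :=
    D_inr_mul_xi_ne (par_xinl i) hlk (D_x_inr i l)
  have e1 := hK _ (hQ _ hv k hkv α hα i) _ (hx k l hlk.symm i)
  have e2 := hK _ (hQ _ hv l hlv α hα i) _ (hx k l hlk.symm i)
  rw [Y, ← hf, add_lie, lie_fd (r := .inl i) hfe hge, hDi, hfl,
    lie_fd (r := .inr k) (par_mul_xi hf'e k) hge, hDk, D_inr_mul_xi_ne hf'e hlk hfl'] at e1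
  rw [Y, ← hf, add_lie, lie_fd (r := .inl i) hfe hge, hDi, hfl,
    lie_fd (r := .inr l) (par_mul_xi hf'e l) hge, hDl, D_inr_mul_xi hf'e hfl'] at e2
  have e3 : mul (mul (D (.inl i) f) (xi k)) (xv (.inl i))
      = mul (mul (xv (.inl i)) (xi k)) (D (.inl i) f) := by
    rw [mul_comm_even (par_xinl i) (par_xi k), ← mul_comm_even hf'e (par_mul (par_xi k) (par_xinl i)),
      mul_assoc']
  have e4 := K.add_mem e1 e2
  simp only [map_zero, fd_zero, sub_zero, zero_sub, e3] at e4
  rw [add_add_add_comm, add_neg_cancel, add_zero, ← fd_add, ← two_smul F, hmul, fd_smul,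
    fd_smul] at e4
  exact (K.smul_mem_iff hc).1 ((K.smul_mem_iff (two_ne_zero_of_lt hp)).1 e4)

/-- A space of operators which is closed under brackets and contains the even elements of low
degree contains all even elements of `S(m,n;t)`. -/
theorem homGen_le (hp : 3 < p) (hm : 3 ≤ m) (hn : 3 ≤ n) (ht : ∀ i, 1 ≤ t i)
    (hK : ∀ A ∈ K, ∀ B ∈ K, ⁅A, B⁆ ∈ K)
    (h1 : ∀ (i j : Fin m) (s : Fin n), i ≠ j → ∀ a, a < p ^ t i →
      Y (mono (Pi.single i a, ∅) 1) j s ∈ K)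
    (h2 : ∀ i s, Y (mono (Pi.single i 2, ∅) 1) i s ∈ K)
    (h3 : ∀ k l : Fin n, k ≠ l → fd (xi k) (.inr l) ∈ K)
    (h4 : ∀ k l : Fin n, k ≠ l → ∀ i, fd (mul (xv (.inl i)) (xi k)) (.inr l) ∈ K)
    (h5 : ∀ k l : Fin n, k ≠ l → ∀ i, fd (mono (0, {k, l}) 1) (.inl i) ∈ K) :
    homGen F n p t 0 ≤ K := by
  have hQ : ∀ w : Finset (Fin n), (w.card : ZMod 2) = 0 → ∀ s ∉ w, ∀ α : Fin m → ℕ,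
      (∀ i, α i < p ^ t i) → ∀ j, Y (mono (α, w) 1) j s ∈ K := by
    intro w hw
    obtain ⟨N, hN⟩ := even_iff_two_dvd.1 ((ZMod.natCast_eq_zero_iff_even).1 hw)
    exact Y_xi_mem hp hm ht hK (fun s α hα l => Y_even_mem hp hm ht hK s
      (fun i j => h1 i j s) (fun i => h2 i s) α hα l) h5 N w hN
  have hR := fd_xi_mem hp hm hK hQ h4
  refine Submodule.span_le.2 ?_
  rintro _ ⟨r, s, f, hft, hfp, rfl⟩
  obtain ⟨T, hT, hne⟩ := eq_sum_mono f
  rw [hT, map_sum]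
  refine K.sum_mem fun a ha => ?_
  have hα := mem_monSpan_iff.1 hft a (hne a ha)
  have hε := mem_monSpan_iff.1 hfp a (hne a ha)
  rw [← mul_one (cf a f), ← smul_mono, map_smul]
  refine K.smul_mem _ ?_
  clear ha hT hne hft hfp
  obtain ⟨α, u⟩ := a
  simp only [Set.mem_ofPred_eq, mpar, add_zero] at hα hε
  have hpar : (mono (α, u) (1 : F) : Alg F m n) ∈ par F m n (tau r + tau s) := par_mono hε 1
  -- If `ξ_k` divides the monomial, then up to a sign the latter is `g ξ_k` and the sum is `Y g i
  -- k`. Otherwise the second term vanishes and only a field `f' D_k` without `ξ_k` remains.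
  have mixed (i : Fin m) (k : Fin n) (hu : (u.card : ZMod 2) = 1) :
      fd (D (.inl i) (mono (α, u) (1 : F))) (.inr k)
        + fd (D (.inr k) (mono (α, u) (1 : F))) (.inl i) ∈ K := by
    by_cases hk : k ∈ u
    · obtain ⟨c, hc, hmul⟩ := mono_mul_xi (F := F) (m := m) (Finset.notMem_erase k u)
      rw [Finset.insert_erase hk] at hmul
      have hv := card_erase_even hk hu
      have := hQ _ hv k (by simp) α hα i
      have hfk := D_inr_mono_notMem (Finset.notMem_erase k u) α (1 : F)
      rw [Y] at this
      nth_rw 1 [← D_inr_mul_xi (par_mono hv 1) hfk] at this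
      rw [← D_inl_mul_xi, hmul, map_smul, map_smul, fd_smul, fd_smul, ← smul_add] at this
      rw [add_comm]
      exact (K.smul_mem_iff hc).1 this
    · rw [D_inr_mono_notMem hk, fd_zero, add_zero]
      exact D_inl_mono_mem K (fdL (.inr k)) i α u hα fun β hβ => hR u hu k hk β hβ
  rcases r with i | k <;> rcases s with j | l
  · simp only [tau_inl, add_zero] at hε hpar
    rw [Drs_par _ _ hpar]
    simp only [tau_inl, mul_zero, sgn_zero, one_smul]
    change fd _ _ - fd _ _ ∈ K
    -- If some `ξ_s` is missing, `D_ij(f)` is `Y (D_i f) j s - Y (D_j f) i s`, as the compensating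
    -- terms cancel. If all odd variables occur, `f` is a multiple of `P g` with `P = ξ_k ξ_l`, and
    -- `D_ij(P g) = [P D_i, Y g j k]`: the compensating term contributes through `ξ_k D_k(P) = P`
    -- and `P ξ_k = 0`.
    by_cases hs : ∃ s, s ∉ u
    · obtain ⟨s, hs⟩ := hs
      have e1 := D_inl_mono_mem K (YL j s) i α u hα fun β hβ => hQ u hε s hs β hβ j
      have e2 := D_inl_mono_mem K (YL i s) j α u hα fun β hβ => hQ u hε s hs β hβ i
      have := K.sub_mem e1 e2
      simp only [YL, LinearMap.coe_mk, AddHom.coe_mk, Y] at this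
      rw [D_inl_comm i (.inl j)] at this
      simpa using this
    · push Not at hs
      obtain ⟨k, hk⟩ : ∃ k, k ∈ u := ⟨⟨0, by omega⟩, hs _⟩
      obtain ⟨l, hlk, -⟩ := exists_third hn k k
      set v := (u.erase k).erase l with hv
      have hlu : l ∈ u.erase k := Finset.mem_erase.2 ⟨hlk, hs l⟩
      have hw' : {k, l} ∪ v = u := by
        rw [hv]
        ext q
        simp only [Finset.mem_union, Finset.mem_insert, Finset.mem_singleton, Finset.mem_erase, hs q]
        tauto
      have hdisj : Disjoint ({k, l} : Finset (Fin n)) v := by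
        rw [hv]; simp
      obtain ⟨c, hc, hmul⟩ := mono_zero_mul (F := F) (m := m) hdisj
      obtain ⟨d, hd, hxi⟩ := xi_mul_xi_eq (F := F) (m := m) hlk.symm
      rw [hw'] at hmul
      have hve := card_erase_even hlu (card_erase_odd hk hε)
      have hkv : k ∉ v := by simp [hv]
      set g : Alg F m n := mono (α, v) 1 with hg
      have hge : g ∈ par F m n 0 := par_mono hve 1
      have hY := hQ v hve k hkv α hα j
      set P : Alg F m n := mul (xi k) (xi l) with hP
      have hPe : P ∈ par F m n 0 := by
        have := par_mul (par_xi (F := F) (m := m) k) (par_xi l)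
        rwa [zmod_two_one_add_one] at this
      have hPg : mul P g = (d * c) • mono (α, u) 1 := by
        rw [hxi, map_smul, LinearMap.smul_apply, hmul α, smul_smul]
      have hPi (i : Fin m) : D (.inl i) P = 0 := by
        rw [hP, D_inl_mul, D_xi_inl, D_xi_inl]; simp
      have hPx : mul P (xi k) = 0 := by
        rw [hP, mul_assoc', xi_mul_xi l k, map_neg, ← mul_assoc', xi_mul_self]; simp
      have hPk : mul (xi k) (D (.inr k) P) = P := by
        rw [hP, D_inr_mul1 _ (par_xi k), D_xi_self, D_xi_ne hlk.symm, one_mul']; simp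
      have hgj := par_D0 j hge
      have hPD (q : Fin m) : D (.inl q) (mul P g) = mul P (D (.inl q) g) := by
        rw [D_inl_mul, hPi]; simp
      have hPK : fd P (.inl i) ∈ K := by
        rw [hxi, fd_smul]; exact K.smul_mem _ (h5 k l hlk.symm i)
      clear_value P
      have := hK _ hPK _ hY
      rw [Y, ← hg, lie_add, lie_fd (r := .inl i) (s := .inl j) hPe hge,
        lie_fd (r := .inl i) (s := .inr k) hPe (par_mul_xi hgj k), hPi, map_zero, fd_zero, sub_zero,
        D_inl_mul_xi, ← mul_assoc', mul_comm_even hPe (par_D0 i hgj), mul_assoc', hPx, map_zero,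
        fd_zero, zero_sub, mul_assoc', hPk, mul_comm_even hgj hPe, ← hPD, ← hPD, hPg, map_smul,
        map_smul, fd_smul, fd_smul, ← sub_eq_add_neg, ← smul_sub] at this
      exact (K.smul_mem_iff (mul_ne_zero hd hc)).1 this
  · simp only [tau_inl, tau_inr, zero_add] at hε hpar
    rw [Drs_par _ _ hpar]
    simp only [tau_inl, tau_inr, zero_add, mul_one, sgn_zero, sgn_one, one_smul, neg_smul,
      sub_neg_eq_add]
    exact mixed i l hε
  · simp only [tau_inl, tau_inr, add_zero] at hε hpar
    rw [Drs_par _ _ hpar]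
    simp only [tau_inl, tau_inr, add_zero, mul_zero, mul_one, sgn_zero, sgn_one, one_smul, neg_smul,
      sub_neg_eq_add]
    rw [add_comm]
    exact mixed j k hε
  · simp only [tau_inr, zmod_two_one_add_one] at hε hpar
    rw [Drs_par _ _ hpar]
    simp only [tau_inr, zmod_two_one_add_one, mul_one, mul_zero, sgn_zero, sgn_one, one_smul,
      neg_smul]
    change -fd _ _ - fd _ _ ∈ K
    -- If both variables occur, the element is a multiple of `g ξ_k D_k - g ξ_l D_l = [g ξ_k D_l,
    -- ξ_l D_k]`. Otherwise each of its two terms lies in `K` separately.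
    by_cases hkl : k ≠ l ∧ k ∈ u ∧ l ∈ u
    · obtain ⟨hkl, hk, hl⟩ := hkl
      have hlk : l ∈ u.erase k := Finset.mem_erase.2 ⟨hkl.symm, hl⟩
      have hk' : k ∉ (u.erase k).erase l := by simp
      obtain ⟨c, hc, hm1⟩ := mono_mul_xi (F := F) (m := m) (Finset.notMem_erase l (u.erase k))
      rw [Finset.insert_erase hlk] at hm1
      obtain ⟨d, hd, hm2⟩ := mono_mul_xi (F := F) (m := m) (Finset.notMem_erase k u)
      rw [Finset.insert_erase hk] at hm2
      obtain ⟨e, he, hm3⟩ := mono_mul_xi (F := F) (m := m) hk'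
      have hodd := card_erase_odd hk hε
      have hve := card_erase_even hlk hodd
      set g : Alg F m n := mono (α, (u.erase k).erase l) 1 with hg
      have hge : g ∈ par F m n 0 := par_mono hve 1
      have hgk : D (.inr k) g = 0 := D_inr_mono_notMem hk' _ _
      have hgl : D (.inr l) g = 0 := D_inr_mono_notMem (Finset.notMem_erase _ _) _ _
      have hgx : mul g (xi k) ∈ par F m n 1 := par_mul_xi (m := m) hge k
      have hA : fd (mul g (xi k)) (.inr l) ∈ K := by
        rw [hm3, fd_smul]
        refine K.smul_mem _ (hR _ ?_ l ?_ α hα)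
        · rw [Finset.card_insert_of_notMem hk', Nat.cast_add, hve]; simp
        · simp [hkl.symm]
      have hB := hK _ hA _ (h3 l k hkl.symm)
      rw [lie_fd (r := .inr l) (s := .inr k) hgx (par_xi l), D_xi_self, mul_one',
        D_inr_mul_xi hge hgk, ← mul_comm_even hge (par_xi l)] at hB
      have hf : (mono (α, u) 1 : Alg F m n) = -((d * c)⁻¹ • mul (mul g (xi k)) (xi l)) := by
        rw [mul_assoc', xi_mul_xi, map_neg, ← mul_assoc', hm1 α, map_smul, LinearMap.smul_apply,
          hm2 α, smul_neg, neg_neg, smul_smul, smul_smul,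
          show (d * c)⁻¹ * c * d = 1 by field_simp, one_smul]
      have e1 : D (.inr k) (mul (mul g (xi k)) (xi l)) = mul g (xi l) := by
        rw [D_inr_mul1 _ hgx, D_inr_mul_xi hge hgk, D_xi_ne hkl]; simp
      have e2 : D (.inr l) (mul (mul g (xi k)) (xi l)) = -mul g (xi k) := by
        rw [D_inr_mul1 _ hgx, D_inr_mul_xi_ne hge hkl.symm hgl, D_xi_self, mul_one']; simp
      rw [hf, map_neg, map_neg, map_smul, map_smul, e1, e2, fd_neg, fd_neg, fd_smul, fd_smul, fd_neg]
      have := K.smul_mem (-(d * c)⁻¹) hB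
      convert this using 1
      module
    · have key (k l : Fin n) (h : ¬(k ≠ l ∧ k ∈ u ∧ l ∈ u)) :
          fd (D (.inr k) (mono (α, u) (1 : F))) (.inr l) ∈ K := by
        by_cases hk : k ∈ u
        · rw [D_inr_single, if_pos hk, mul_comm (1 : F), ← smul_mono, fd_smul]
          refine K.smul_mem _ (hR _ (card_erase_odd hk hε) l ?_ α hα)
          intro hl
          exact h ⟨(Finset.mem_erase.1 hl).1.symm, hk, Finset.mem_of_mem_erase hl⟩
        · rw [D_inr_mono_notMem hk, fd_zero]; exact K.zero_mem
      refine K.sub_mem (K.neg_mem (key k l hkl)) (key l k ?_)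
      rintro ⟨h1, h2, h3⟩
      exact hkl ⟨h1.symm, h3, h2⟩

end Generation

/-! ### Membership in the special algebra -/

section Membership

variable {p : ℕ} [Fact p.Prime] [CharP F p] {t : Fin m → ℕ}

omit [CharP F p] in
theorem xi_trunc (k : Fin n) : (xi k : Alg F m n) ∈ trunc F n p t :=
  trunc_mono (fun _ => pow_pos (Fact.out : p.Prime).pos _) 1

/-- The element is `D_is(f ξ_s)`. -/
theorem Y_mem_S0 {f : Alg F m n} (hf : f ∈ trunc F n p t) (hfe : f ∈ par F m n 0) {s : Fin n}
    (hfs : D (.inr s) f = 0) (i : Fin m) : Y f i s ∈ S0 F n p t := by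
  constructor
  · have h := Drs_mem_S (p := p) (t := t) (.inl i) (.inr s) (trunc_mul hf (xi_trunc (F := F) s))
    rw [Drs_par _ _ (par_mul_xi hfe s)] at h
    simp only [tau_inl, tau_inr, zero_add, mul_one, sgn_zero, sgn_one, one_smul, neg_smul,
      sub_neg_eq_add, D_inl_mul_xi, D_inr_mul_xi hfe hfs] at h
    rw [Y, add_comm]
    exact h
  · exact (evenEnd F m n).add_mem (fd_even hfe) (fd_even (par_mul_xi (par_D0 i hfe) s))

/-- `D_ll(f ξ_l) = 2 f D_l`, and `2` is invertible. -/
theorem fd_mem_S0 (hp : 3 < p) {f : Alg F m n} (hf : f ∈ trunc F n p t) (hfe : f ∈ par F m n 1)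
    {l : Fin n} (hfl : D (.inr l) f = 0) : fd f (.inr l) ∈ S0 F n p t := by
  refine ⟨?_, fd_even hfe⟩
  have h := Drs_mem_S (p := p) (t := t) (.inr l) (.inr l) (trunc_mul hf (xi_trunc (F := F) l))
  have hpar := par_mul hfe (par_xi (F := F) l)
  have e : D (.inr l) (mul f (xi l)) = -f := by
    rw [D_inr_mul1 _ hfe, hfl, D_xi_self, mul_one']; simp
  rw [Drs_par _ _ hpar] at h
  simp only [tau_inr, zmod_two_one_add_one, mul_one, mul_zero, sgn_zero, sgn_one, one_smul,
    neg_smul, e, map_neg, neg_mul, neg_neg, sub_neg_eq_add] at h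
  rw [← two_smul F] at h
  exact ((S F n p t).smul_mem_iff (two_ne_zero_of_lt hp)).1 h

end Membership

/-! ### The torus and the translations -/

/-- The element `x_i D_i + ξ_k D_k`. -/
def hop (i : Fin m) (k : Fin n) : Module.End F (Alg F m n) :=
  fd (xv (.inl i)) (.inl i) + fd (xi k) (.inr k)

theorem Y_x (i : Fin m) (k : Fin n) : Y (xv (.inl i) : Alg F m n) i k = hop i k := by
  rw [Y, D_x_self, one_mul']; rfl

theorem xi_D_mono (k : Fin n) (a : Mon m n) :
    fd (xi k) (.inr k) (mono a (1 : F)) = (if k ∈ a.2 then 1 else 0 : F) • mono a 1 := by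
  rw [fd_apply, D_inr_single]
  by_cases h : k ∈ a.2
  · have hll : inversions {k} {k} = 0 := by simp [inversions]
    rw [if_pos h, if_pos h, xi, xv, mul_single, card_filter_lt, inversions_erase_right h, hll]
    simp only [mulCoeff, Finset.disjoint_singleton_left, Finset.notMem_erase, not_false_eq_true,
      if_true, zero_add, one_mul, Pi.zero_apply, Nat.choose_zero_right, Nat.cast_one,
      Finset.prod_const_one, one_smul, neg_one_pow_sq]
    rw [← Finset.insert_eq, Finset.insert_erase h]
  · simp [h]

theorem hop_mono (i : Fin m) (k : Fin n) (a : Mon m n) :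
    hop i k (mono a (1 : F)) = ((a.1 i : F) + if k ∈ a.2 then 1 else 0) • mono a 1 := by
  rw [hop, LinearMap.add_apply, fd_apply, fd_apply, add_smul]
  congr 1
  · rcases Nat.eq_zero_or_pos (a.1 i) with h | h
    · rw [D_inl_single, if_neg (by omega), h]; simp
    · obtain ⟨α, u⟩ := a
      obtain ⟨δ, hδ⟩ := exists_add_single h
      subst hδ
      rw [D_inl_mono_add, x_mul_mono]
      simp
  · rw [← fd_apply, xi_D_mono]

theorem cf_hop (i : Fin m) (k : Fin n) (a : Mon m n) (f : Alg F m n) :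
    cf a (hop i k f) = ((a.1 i : F) + if k ∈ a.2 then 1 else 0) * cf a f := by
  have : (cf a ∘ₗ hop i k : Alg F m n →ₗ[F] F)
      = ((a.1 i : F) + if k ∈ a.2 then 1 else 0) • cf a := by
    refine alg_ext fun b => ?_
    rw [LinearMap.comp_apply, hop_mono, map_smul, LinearMap.smul_apply, cf_mono]
    by_cases h : b = a
    · subst h; simp
    · simp [h]
  exact LinearMap.congr_fun this f

theorem hop_xv (i : Fin m) (k : Fin n) (r : Fin m ⊕ Fin n) :
    hop i k (xv r : Alg F m n)
      = ((if r = .inl i then 1 else 0) + if r = .inr k then 1 else 0 : F) • xv r := by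
  rw [hop, LinearMap.add_apply, fd_xv, fd_xv, add_smul]
  congr 1
  · by_cases h : r = .inl i
    · subst h; simp
    · simp [h, Ne.symm h]
  · by_cases h : r = .inr k
    · subst h; simp
    · simp [h, Ne.symm h]

/-- The weight of `x^(α) x^u D_r`, where `a = (α, u)`, with respect to `x_i D_i + ξ_k D_k`. -/
def wt (F : Type*) [Field F] (i : Fin m) (k : Fin n) (r : Fin m ⊕ Fin n) (a : Mon m n) : F :=
  ((a.1 i : F) + if k ∈ a.2 then 1 else 0)
    - ((if r = .inl i then 1 else 0) + if r = .inr k then 1 else 0)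

theorem cf_lie_hop (i : Fin m) (k : Fin n) (E : Module.End F (Alg F m n)) (r : Fin m ⊕ Fin n)
    (a : Mon m n) : cf a (⁅(hop i k : Module.End F (Alg F m n)), E⁆ (xv r)) = wt F i k r a * cf a (E (xv r)) := by
  rw [Ring.lie_def, LinearMap.sub_apply, Module.End.mul_apply, Module.End.mul_apply, hop_xv,
    map_sub, cf_hop, map_smul, map_smul, smul_eq_mul, ← sub_mul]
  rfl

theorem cf_lie_D {p : ℕ} {t : Fin m → ℕ} (j : Fin m) {E : Module.End F (Alg F m n)}
    (hE : E ∈ W F n p t) (r : Fin m ⊕ Fin n) (a : Mon m n) :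
    cf a (⁅(D (.inl j) : Module.End F (Alg F m n)), E⁆ (xv r)) = cf (a.1 + Pi.single j 1, a.2) (E (xv r)) := by
  rw [Ring.lie_def, LinearMap.sub_apply, Module.End.mul_apply, Module.End.mul_apply, D_xv]
  have : E (if (.inl j : Fin m ⊕ Fin n) = r then one else 0) = 0 := by
    split
    · exact W_apply_one hE
    · exact map_zero _
  rw [this, sub_zero, cf_D_inl]

section

variable {p : ℕ} [Fact p.Prime] [CharP F p] {t : Fin m → ℕ}

omit [Fact p.Prime] [CharP F p] in
theorem x_trunc (hp : 3 < p) (ht : ∀ i, 1 ≤ t i) (i : Fin m) :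
    (xv (.inl i) : Alg F m n) ∈ trunc F n p t := by
  refine trunc_mono (fun j => ?_) 1
  have := three_lt_pow hp ht j
  by_cases h : j = i
  · subst h; simp; omega
  · simp [h]; omega

theorem hop_mem_S0 (hp : 3 < p) (ht : ∀ i, 1 ≤ t i) (i : Fin m) (k : Fin n) :
    (hop i k : Module.End F (Alg F m n)) ∈ S0 F n p t := by
  rw [← Y_x]
  exact Y_mem_S0 (x_trunc hp ht i) (par_xinl i) (D_x_inr i k) i

theorem D_mem_S0 (hn : 3 ≤ n) (i : Fin m) : (D (.inl i) : Module.End F (Alg F m n)) ∈ S0 F n p t := by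
  have := Y_mem_S0 (p := p) (t := t) (f := (one : Alg F m n))
    (trunc_mono (fun _ => pow_pos (Fact.out : p.Prime).pos _) 1) par_one (D_one _)
    (s := ⟨0, by omega⟩) i
  rwa [Y_of_D_eq_zero (D_one _), fd_one] at this

theorem fd_even_mem_S0 {a : Mon m n} {k : Fin n} (hk : k ∉ a.2) {i : Fin m}
    (hi : a.1 i = 0) (ha : ∀ i, a.1 i < p ^ t i) (he : (a.2.card : ZMod 2) = 0) :
    fd (mono a (1 : F)) (.inl i) ∈ S0 F n p t := by
  rw [← Y_of_D_eq_zero (D_inl_mono_zero hi _ _) k]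
  exact Y_mem_S0 (trunc_mono ha 1) (par_mono he 1) (D_inr_mono_notMem hk _ _) i

theorem fd_pair_mem_S0 (hn : 3 ≤ n) {k l : Fin n} (h : k ≠ l) (i : Fin m) :
    fd (mono (0, {k, l}) (1 : F)) (.inl i) ∈ S0 F n p t := by
  obtain ⟨s, hsk, hsl⟩ := exists_third hn k l
  refine fd_even_mem_S0 (k := s) (by simp [hsk, hsl]) rfl
    (fun _ => pow_pos (Fact.out : p.Prime).pos _) ?_
  rw [Finset.card_pair h]; decide

end

theorem W0_eq_of_cf {p : ℕ} {t : Fin m → ℕ} {A B : Module.End F (Alg F m n)}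
    (hA : A ∈ W0 F n p t) (hB : B ∈ W0 F n p t)
    (h : ∀ r a, cf a (A (xv r)) = cf a (B (xv r))) : A = B :=
  W_ext hA.1 hB.1 fun r => cf_ext (h r)

theorem lie_hop_fd {p : ℕ} [Fact p.Prime] [CharP F p] {t : Fin m → ℕ} (hp : 3 < p)
    (ht : ∀ i, 1 ≤ t i) (i : Fin m) (k : Fin n)
    {a : Mon m n} {r : Fin m ⊕ Fin n} (ha : ∀ i, a.1 i < p ^ t i)
    (he : (a.2.card : ZMod 2) = tau r) :
    ⁅(hop i k : Module.End F (Alg F m n)), fd (mono a (1 : F)) r⁆ = wt F i k r a • fd (mono a 1) r := by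
  have hf : fd (mono a (1 : F)) r ∈ W0 F n p t := fd_mem_W0 (trunc_mono ha 1) (par_mono he 1)
  refine W0_eq_of_cf (W0_lie (S0_le_W0 (hop_mem_S0 hp ht i k)) hf) (Submodule.smul_mem _ _ hf) ?_
  intro s b
  rw [cf_lie_hop, LinearMap.smul_apply, map_smul, fd_xv, smul_eq_mul]
  by_cases hs : r = s
  · subst hs
    rw [if_pos rfl, cf_mono]
    by_cases hb : a = b
    · subst hb; rfl
    · simp [hb]
  · simp [hs]

/-- Elements of `W(m,n;t)` with prescribed coefficients. -/
theorem exists_W0 {p : ℕ} {t : Fin m → ℕ} (s : Set (Mon m n))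
    (hs : ∀ a ∈ s, ∀ i, a.1 i < p ^ t i) (e : Fin m ⊕ Fin n → Mon m n → F) :
    ∃ E ∈ W0 F n p t, ∀ r a, (a ∈ s → mpar a = tau r → cf a (E (xv r)) = e r a) ∧
      (a ∉ s → cf a (E (xv r)) = 0) := by
  have hfin : s.Finite := by
    refine Set.Finite.subset (s := (Set.pi Set.univ fun i => Set.Iio (p ^ t i)) ×ˢ Set.univ)
      ((Set.Finite.pi fun i => Set.finite_Iio _).prod Set.finite_univ) ?_
    intro a ha
    exact ⟨fun i _ => hs a ha i, trivial⟩
  choose f hf hfe using fun r : Fin m ⊕ Fin n =>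
    exists_cf (s ∩ {a | mpar a = tau r}) (hfin.subset Set.inter_subset_left) (e r)
  refine ⟨vec f, ⟨⟨f, fun r => mem_trunc_iff.2 fun a ha => hs a (mem_monSpan_iff.1 (hf r) a ha).1,
    rfl⟩, ?_⟩, fun r a => ⟨fun h1 h2 => ?_, fun h => ?_⟩⟩
  · rw [vec_eq_sum]
    refine Submodule.sum_mem _ fun r _ => fd_even ?_
    exact mem_par_iff.2 fun a ha => (mem_monSpan_iff.1 (hf r) a ha).2
  · rw [coeff_xv]; exact hfe r a ⟨h1, h2⟩
  · rw [coeff_xv]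
    by_contra h'
    exact h (mem_monSpan_iff.1 (hf r) a h').1

/-! ### Derivations -/

/-- The operator `[A, ·]`. -/
def adl (A : Module.End F (Alg F m n)) : Module.End F (Module.End F (Alg F m n)) :=
  LinearMap.mulLeft F A - LinearMap.mulRight F A

theorem adl_apply (A B : Module.End F (Alg F m n)) : adl A B = ⁅A, B⁆ := rfl

/-- The linear maps which restrict to derivations from the even part of `S(m,n;t)` to the even
part of `W(m,n;t)`. -/
def derEnd (F : Type*) [Field F] (n p : ℕ) (t : Fin m → ℕ) :
    Submodule F (Module.End F (Module.End F (Alg F m n))) where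
  carrier := {ψ | (∀ y ∈ S0 F n p t, ψ y ∈ W0 F n p t) ∧
    ∀ x ∈ S0 F n p t, ∀ y ∈ S0 F n p t, ψ ⁅x, y⁆ = ⁅x, ψ y⁆ - ⁅y, ψ x⁆}
  zero_mem' := ⟨fun _ _ => Submodule.zero_mem _, fun _ _ _ _ => by simp⟩
  add_mem' := by
    rintro ψ χ ⟨h1, h2⟩ ⟨h3, h4⟩
    refine ⟨fun y hy => Submodule.add_mem _ (h1 y hy) (h3 y hy), fun x hx y hy => ?_⟩
    simp only [LinearMap.add_apply, h2 x hx y hy, h4 x hx y hy, lie_add]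
    abel
  smul_mem' := by
    rintro c ψ ⟨h1, h2⟩
    refine ⟨fun y hy => Submodule.smul_mem _ c (h1 y hy), fun x hx y hy => ?_⟩
    simp only [LinearMap.smul_apply, h2 x hx y hy, lie_smul, smul_sub]

section

variable {p : ℕ} [Fact p.Prime] [CharP F p] {t : Fin m → ℕ}

theorem adl_leibniz (A x y : Module.End F (Alg F m n)) :
    adl A ⁅x, y⁆ = ⁅x, adl A y⁆ - ⁅y, adl A x⁆ := by
  simp only [adl_apply, Ring.lie_def]
  noncomm_ring

theorem adl_mem_derEnd {E : Module.End F (Alg F m n)} (hE : E ∈ W0 F n p t) :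
    adl E ∈ derEnd F n p t :=
  ⟨fun _ hy => W0_lie hE (S0_le_W0 hy), fun x _ y _ => adl_leibniz E x y⟩

instance : Nontrivial (Alg F m n) := inferInstanceAs (Nontrivial (Mon m n →₀ F))

/-- Frobenius applied to the difference of the commuting left and right multiplications by `A`. It
shows that `(ad D_i)^{p^r}` is a derivation, although the operator `D_i^{p^r}` need not belong to
`𝒲`. -/
theorem adl_pow_char (A : Module.End F (Alg F m n)) (r : ℕ) :
    adl A ^ p ^ r = adl (A ^ p ^ r) := by
  have : CharP (Module.End F (Module.End F (Alg F m n))) p :=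
    charP_of_injective_algebraMap (FaithfulSMul.algebraMap_injective F _) p
  rw [adl, adl, sub_pow_char_pow_of_commute, LinearMap.pow_mulLeft, LinearMap.pow_mulRight]
  exact LinearMap.commute_mulLeft_right (R := F) A A

theorem adl_pow_mem_W0 {E y : Module.End F (Alg F m n)} (hE : E ∈ W0 F n p t)
    (hy : y ∈ W0 F n p t) (N : ℕ) : (adl E ^ N) y ∈ W0 F n p t := by
  induction N with
  | zero => exact hy
  | succ N ih => rw [pow_succ']; exact W0_lie hE ih

theorem adl_pow_mem_derEnd {E : Module.End F (Alg F m n)} (hE : E ∈ W0 F n p t) (r : ℕ) :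
    adl E ^ p ^ r ∈ derEnd F n p t :=
  ⟨fun _ hy => adl_pow_mem_W0 hE (S0_le_W0 hy) _, fun x _ y _ => by
    rw [adl_pow_char]; exact adl_leibniz _ x y⟩

/-- The kernel of a derivation is closed under brackets. -/
theorem ker_lie {ψ : Module.End F (Module.End F (Alg F m n))} (hψ : ψ ∈ derEnd F n p t)
    {A B : Module.End F (Alg F m n)} (hA : A ∈ S0 F n p t ⊓ LinearMap.ker ψ)
    (hB : B ∈ S0 F n p t ⊓ LinearMap.ker ψ) : ⁅A, B⁆ ∈ S0 F n p t ⊓ LinearMap.ker ψ := by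
  refine ⟨S0_lie hA.1 hB.1, ?_⟩
  change ψ ⁅A, B⁆ = 0
  rw [hψ.2 A hA.1 B hB.1, LinearMap.mem_ker.1 hA.2, LinearMap.mem_ker.1 hB.2]
  simp

end

/-! ### Vanishing of diagonal elements -/

theorem eq_zero_of_pairwise {N : ℕ} (hN : 3 ≤ N) (h2 : (2 : F) ≠ 0) {z : Fin N → F}
    (h : ∀ k l, k ≠ l → z k + z l = 0) (k : Fin N) : z k = 0 := by
  obtain ⟨l, hl, -⟩ := exists_third hN k k
  obtain ⟨s, hs, hsl⟩ := exists_third hN k l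
  have : 2 * z k = 0 := by
    linear_combination h k l hl.symm + h k s hs.symm - h l s hsl.symm
  exact (mul_eq_zero.1 this).resolve_left h2

/-- Such an `E` is `x^(γ) ∑ z_s ξ_s D_s`, the obstruction that weights cannot remove. It kills all
`x_j`, so its bracket with a multiple of `ξ_k ξ_l D_i` sees only `E(ξ_k ξ_l) = (z_k + z_l) x^(γ) ξ_k
ξ_l`. Three odd indices then force every `z_k` to vanish. -/
theorem diagonal_eq_zero {p : ℕ} [Fact p.Prime] [CharP F p] {t : Fin m → ℕ} (hp : 3 < p)
    (hn : 3 ≤ n) {E : Module.End F (Alg F m n)} (hE : E ∈ W0 F n p t) (γ : Fin m → ℕ)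
    (hdiag : ∀ r a, cf a (E (xv r)) ≠ 0 → ∃ s, r = .inr s ∧ a = (γ, {s})) (i : Fin m)
    (h : ∀ k l, k ≠ l →
      cf (γ, {k, l}) (⁅fd (mono (0, {k, l}) (1 : F)) (.inl i), E⁆ (xv (.inl i))) = 0) : E = 0 := by
  set G : Alg F m n := mono (γ, ∅) 1 with hG
  have hGe : G ∈ par F m n 0 := par_mono (by simp) 1
  have hGxi (k : Fin n) : mul G (xi k) = mono (γ, {k}) 1 := by
    rw [hG, xi, xv, mul_single]
    simp [mulCoeff, inversions_empty_left]
  set z : Fin n → F := fun k => cf (γ, {k}) (E (xi k)) with hz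
  have hx (j : Fin m) : E (xv (.inl j)) = 0 := by
    refine cf_ext fun a => ?_
    by_contra hne
    obtain ⟨s, hs, -⟩ := hdiag _ a (by simpa using hne)
    cases hs
  have hxi (k : Fin n) : E (xi k) = z k • mul G (xi k) := by
    refine cf_ext fun a => ?_
    rw [hGxi, map_smul, cf_mono]
    by_cases ha : (γ, {k}) = a
    · subst ha; simp [hz]
    · rw [if_neg ha, smul_zero]
      by_contra hne
      obtain ⟨s, hs, rfl⟩ := hdiag _ a hne
      cases hs
      exact ha rfl
  have hpair (k l : Fin n) (hkl : k ≠ l) : z k + z l = 0 := by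
    obtain ⟨d, hd, hP⟩ := xi_mul_xi_eq (F := F) (m := m) hkl
    have e1 : E (mul (xi k) (xi l)) = (z k + z l) • mul G (mul (xi k) (xi l)) := by
      rw [W0_apply_mul hE (par_xi k), hxi, hxi, map_smul, map_smul, LinearMap.smul_apply,
        ← mul_assoc', ← mul_comm_even hGe (par_xi k), mul_assoc', add_smul]
    have e2 : mul G (mono (0, {k, l}) 1) = mono (γ, {k, l}) 1 := by
      rw [hG, mono_mul_disj (β := 0) (fun _ => Or.inr rfl), add_zero]
    have := h k l hkl
    rw [Ring.lie_def, LinearMap.sub_apply, Module.End.mul_apply, Module.End.mul_apply, hx, map_zero,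
      zero_sub, fd_xv, if_pos rfl, map_neg, neg_eq_zero] at this
    rw [hP, map_smul, map_smul, smul_comm, e2] at e1
    have e3 := congrArg (cf (γ, {k, l})) (smul_right_injective _ hd e1)
    rwa [this, map_smul, cf_mono, if_pos rfl, smul_eq_mul, mul_one, eq_comm] at e3
  have hz0 := eq_zero_of_pairwise hn (two_ne_zero_of_lt (F := F) hp) hpair
  refine W_ext hE.1 (Submodule.zero_mem (W F n p t)) fun r => ?_
  rcases r with j | k
  · rw [hx]; rfl
  · exact (hxi k).trans (by rw [hz0, zero_smul]; rfl)

/-- Monomials of weight zero with constant coefficients are the `ξ_s D_s`. -/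
theorem weight_zero_diag (hm : 3 ≤ m) (hn : 3 ≤ n) {r : Fin m ⊕ Fin n} {u : Finset (Fin n)}
    (h : ∀ i k, wt F i k r (0, u) = 0) : ∃ s, r = .inr s ∧ u = {s} := by
  rcases r with i | s
  · obtain ⟨j, hj, -⟩ := exists_third hm i i
    have h1 := h i ⟨0, by omega⟩
    have h2 := h j ⟨0, by omega⟩
    simp [wt, Ne.symm hj] at h1 h2
    simp [h2] at h1
  · refine ⟨s, rfl, ?_⟩
    ext k
    have h1 := h ⟨0, by omega⟩ k
    by_cases hk : k ∈ u <;> by_cases hs : s = k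
    · simp [hk, hs]
    · simp [wt, hk, hs] at h1
    · simp [wt, hk, hs] at h1
    · simp [hk, Ne.symm hs]

/-! ### Normalizing a derivation on the translations and on the torus -/

theorem lie_D_D (i j : Fin m) :
    ⁅(D (.inl i) : Module.End F (Alg F m n)), (D (.inl j) : Module.End F (Alg F m n))⁆ = 0 := by
  rw [Ring.lie_def, sub_eq_zero]
  exact LinearMap.ext fun f => D_inl_comm i (.inl j) f

theorem lie_D_fd (j : Fin m) {f : Alg F m n} {r : Fin m ⊕ Fin n} (hf : f ∈ par F m n (tau r)) :
    ⁅(D (.inl j) : Module.End F (Alg F m n)), fd f r⁆ = fd (D (.inl j) f) r := by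
  rw [← fd_one, lie_fd (r := .inl j) par_one hf, D_one, map_zero, fd_zero, sub_zero, one_mul',
    fd_one]
  rfl

theorem lie_D_Y (j : Fin m) {f : Alg F m n} (hf : f ∈ par F m n 0) (i : Fin m) (s : Fin n) :
    ⁅(D (.inl j) : Module.End F (Alg F m n)), Y f i s⁆ = Y (D (.inl j) f) i s := by
  rw [Y, lie_add, lie_D_fd (r := .inl i) j hf, lie_D_fd (r := .inr s) j (par_mul_xi (par_D0 i hf) s),
    D_inl_mul_xi, D_inl_comm j (.inl i), Y]

section

variable {p : ℕ} {t : Fin m → ℕ}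

theorem cf_eq_zero_of_le {E : Module.End F (Alg F m n)} (hE : E ∈ W F n p t) (r : Fin m ⊕ Fin n)
    {a : Mon m n} {i : Fin m} (h : p ^ t i ≤ a.1 i) : cf a (E (xv r)) = 0 := by
  by_contra h'
  exact absurd (mem_trunc_iff.1 (W_apply_trunc hE r) a h' i) (not_lt.2 h)

theorem constant_of_lie {E : Module.End F (Alg F m n)} (hE : E ∈ W F n p t)
    (h : ∀ j, ⁅(D (.inl j) : Module.End F (Alg F m n)), E⁆ = 0) {r : Fin m ⊕ Fin n} {a : Mon m n}
    (ha : cf a (E (xv r)) ≠ 0) : a.1 = 0 := by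
  funext j
  by_contra hj
  obtain ⟨α, u⟩ := a
  obtain ⟨δ, rfl⟩ := exists_add_single (Nat.pos_of_ne_zero hj)
  have := cf_lie_D j hE r (δ, u)
  rw [h j, LinearMap.zero_apply, map_zero] at this
  exact ha this.symm

variable [Fact p.Prime] [CharP F p]

theorem lie_hop_D (hp : 3 < p) (ht : ∀ i, 1 ≤ t i) (i j : Fin m) (k : Fin n) :
    ⁅(hop i k : Module.End F (Alg F m n)), (D (.inl j) : Module.End F (Alg F m n))⁆
      = wt F i k (.inl j : Fin m ⊕ Fin n) (0, ∅) • (D (.inl j) : Module.End F (Alg F m n)) := by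
  have := lie_hop_fd (F := F) (p := p) (t := t) (n := n) hp ht i k (a := (0, ∅)) (r := .inl j)
    (fun _ => pow_pos (Fact.out : p.Prime).pos _) (by simp [tau_inl])
  rwa [show mono ((0, ∅) : Mon m n) (1 : F) = one from rfl, fd_one] at this

/-- This is `ψ([D_i, D_j]) = 0` read in coefficients: mixed partial derivatives agree. -/
theorem cocycle_D (hn : 3 ≤ n) {ψ : Module.End F (Module.End F (Alg F m n))}
    (hψ : ψ ∈ derEnd F n p t) (i j : Fin m) (r : Fin m ⊕ Fin n) (a : Mon m n) :
    cf (a.1 + Pi.single i 1, a.2) (ψ (D (.inl j)) (xv r))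
      = cf (a.1 + Pi.single j 1, a.2) (ψ (D (.inl i)) (xv r)) := by
  have hD (i : Fin m) := D_mem_S0 (F := F) (p := p) (t := t) hn i
  have := hψ.2 _ (hD i) _ (hD j)
  rw [lie_D_D, map_zero, eq_comm, sub_eq_zero] at this
  rw [← cf_lie_D i (hψ.1 _ (hD j)).1, ← cf_lie_D j (hψ.1 _ (hD i)).1, this]

/-- A derivation is, up to an inner one, concentrated on the top powers on each `D_j`. -/
theorem exists_adl_top (hn : 3 ≤ n) {ψ : Module.End F (Module.End F (Alg F m n))}
    (hψ : ψ ∈ derEnd F n p t) : ∃ E ∈ W0 F n p t, ∀ j r a,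
      cf a ((ψ + adl E) (D (.inl j)) (xv r)) ≠ 0 → a.1 = Pi.single j (p ^ t j - 1) := by
  classical
  have hD (i : Fin m) := D_mem_S0 (F := F) (p := p) (t := t) hn i
  -- The primitive: the coefficient at `b` is taken from `ψ(D_j)` at `b` lowered in some direction
  -- `j` with `b_j > 0`. By `cocycle_D` the choice of `j` is immaterial. Where there is no such
  -- direction the coefficient is irrelevant for the brackets with the `D_j`, and is set to `0`.
  obtain ⟨E, hE, hcf⟩ := exists_W0 (F := F) (p := p) (t := t) {a : Mon m n | ∀ i, a.1 i < p ^ t i}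
    (fun a ha => ha) (fun r b => if h : ∃ j, 0 < b.1 j then
      cf (b.1 - Pi.single h.choose 1, b.2) (ψ (D (.inl h.choose)) (xv r)) else 0)
  have hψ' := Submodule.add_mem _ hψ (adl_mem_derEnd hE)
  refine ⟨E, hE, ?_⟩
  have h1 (j : Fin m) (r : Fin m ⊕ Fin n) (a : Mon m n) (ha : a.1 j + 1 < p ^ t j) :
      cf a ((ψ + adl E) (D (.inl j)) (xv r)) = 0 := by
    rw [LinearMap.add_apply, adl_apply, ← lie_skew, LinearMap.add_apply, map_add,
      LinearMap.neg_apply, map_neg, cf_lie_D j hE.1, ← sub_eq_add_neg, sub_eq_zero]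
    have hw := hψ.1 _ (hD j)
    by_cases hs : ∀ i, a.1 i < p ^ t i
    · by_cases hpar : mpar a = tau r
      · rw [(hcf r (a.1 + Pi.single j 1, a.2)).1 _ hpar]
        · have hex : ∃ i, 0 < (a.1 + Pi.single j 1 : Fin m → ℕ) i := ⟨j, by simp⟩
          rw [dif_pos hex]
          obtain ⟨δ, hδ⟩ := exists_add_single hex.choose_spec
          generalize hex.choose = q at hδ
          simp only [hδ, add_tsub_cancel_right]
          by_cases hq : q = j
          · subst hq
            rw [← add_right_cancel hδ]
          · obtain ⟨η, hη⟩ := exists_add_single (α := δ) (i := j) (by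
              have := congrFun hδ j
              simp [Ne.symm hq] at this; omega)
            have ha' : a.1 = η + Pi.single q 1 := by
              rw [hη, add_right_comm] at hδ
              exact add_right_cancel hδ
            rw [hη]
            have := cocycle_D hn hψ q j r (η, a.2)
            simpa only [← ha'] using this
        · intro i
          by_cases hi : i = j
          · subst hi; simpa using ha
          · simpa [hi] using hs i
      · have z1 : cf a (ψ (D (.inl j)) (xv r)) = 0 := by
          by_contra h
          exact hpar (mem_par_iff.1 (even_apply_par hw.2 r) a h)
        have z2 : cf (a.1 + Pi.single j 1, a.2) (E (xv r)) = 0 := by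
          by_contra h
          exact hpar (mem_par_iff.1 (even_apply_par hE.2 r) (a.1 + Pi.single j 1, a.2) h)
        rw [z1, z2]
    · push Not at hs
      obtain ⟨i, hi⟩ := hs
      rw [cf_eq_zero_of_le hw.1 r hi, cf_eq_zero_of_le hE.1 r (i := i)]
      simp; omega
  intro j r a ha
  have hw := hψ'.1 _ (hD j)
  have htop : a.1 j = p ^ t j - 1 := by
    have h2 := mem_trunc_iff.1 (W_apply_trunc hw.1 r) a ha j
    by_contra h3
    exact ha (h1 j r a (by omega))
  funext i
  by_cases hi : i = j
  · subst hi; simpa using htop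
  -- If another variable `x_i` occurred, the cocycle relation would move the coefficient to one of
  -- `ψ(D_i)` with exponent `p^{t_j}` at `x_j`, which truncation excludes.
  · rw [Pi.single_eq_of_ne hi]
    by_contra hne
    obtain ⟨α, u⟩ := a
    obtain ⟨δ, rfl⟩ := exists_add_single (Nat.pos_of_ne_zero hne)
    refine ha ?_
    have := cocycle_D hn hψ' i j r (δ, u)
    rw [this]
    refine cf_eq_zero_of_le (hψ'.1 _ (hD i)).1 r (i := j) ?_
    have hpos := pow_pos (Fact.out : p.Prime).pos (t j)
    simp [Ne.symm hi] at htop ⊢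
    omega

theorem wt_eq_add (i : Fin m) (k : Fin n) (r : Fin m ⊕ Fin n) (a : Mon m n) :
    wt F i k r a = (a.1 i : F) + wt F i k r (0, a.2) := by
  simp only [wt, Pi.zero_apply, Nat.cast_zero]; ring

/-- A bracket with `D_j` has no term of top exponent in `x_j`. On the remaining terms of `ψ(D_j)`
the derivation rule for `[h, D_j]`, `h` in the torus, therefore acts as if `ψ(h)` were zero, and
these terms have the weight of `D_j`. The same remark, applied to `[D_j, ξ_k ξ_l D_i] = 0`, supplies
the hypothesis of `diagonal_eq_zero`. -/
theorem exists_adl_D (hp : 3 < p) (hm : 3 ≤ m) (hn : 3 ≤ n) (ht : ∀ i, 1 ≤ t i)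
    {ψ : Module.End F (Module.End F (Alg F m n))}
    (hψ : ψ ∈ derEnd F n p t) : ∃ E ∈ W0 F n p t, ∀ j, (ψ + adl E) (D (.inl j)) = 0 := by
  obtain ⟨E, hE, htop⟩ := exists_adl_top hn hψ
  refine ⟨E, hE, fun j => ?_⟩
  have hψ' := Submodule.add_mem _ hψ (adl_mem_derEnd hE)
  generalize ψ + adl E = ψ at *
  have hD (i : Fin m) := D_mem_S0 (F := F) (p := p) (t := t) hn i
  have hw := hψ'.1 _ (hD j)
  have hpos := pow_pos (Fact.out : p.Prime).pos (t j)
  have hzero {A : Module.End F (Alg F m n)} (hA : A ∈ W F n p t) (r : Fin m ⊕ Fin n) (u) :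
      cf (Pi.single j (p ^ t j - 1), u) (⁅(D (.inl j) : Module.End F (Alg F m n)), A⁆ (xv r))
        = 0 := by
    rw [cf_lie_D j hA]
    refine cf_eq_zero_of_le hA r (i := j) ?_
    simp; omega
  obtain ⟨i, hij, -⟩ := exists_third hm j j
  refine diagonal_eq_zero hp hn hw (Pi.single j (p ^ t j - 1)) ?_ i ?_
  · intro r a ha
    obtain ⟨α, u⟩ := a
    have hα : α = _ := htop j r _ ha
    subst hα
    have hwt (i : Fin m) (k : Fin n) : wt F i k r (0, u) = 0 := by
      have h1 := hψ'.2 _ (hop_mem_S0 hp ht i k) _ (hD j)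
      rw [lie_hop_D hp ht, map_smul] at h1
      have h2 := congrArg (fun A : Module.End F (Alg F m n) =>
        cf (Pi.single j (p ^ t j - 1), u) (A (xv r))) h1
      simp only [LinearMap.sub_apply, LinearMap.smul_apply, map_sub, map_smul, cf_lie_hop,
        smul_eq_mul, hzero (hψ'.1 _ (hop_mem_S0 hp ht i k)).1, sub_zero] at h2
      have h3 := mul_right_cancel₀ ha h2
      rw [wt_eq_add i k r (_, u)] at h3
      -- The factor `x_j^(p^{t_j} - 1)` alone already has the weight of `D_j`, so what remains, `x^u
      -- D_r`, has weight zero.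
      have h4 : ((Pi.single j (p ^ t j - 1) : Fin m → ℕ) i : F) = if i = j then -1 else 0 := by
        by_cases h : i = j
        · subst h
          rw [Pi.single_eq_same, if_pos rfl]
          exact natCast_pow_sub_one i (ht i) (by omega)
        · simp [h]
      have h5 : wt F i k (.inl j : Fin m ⊕ Fin n) (0, ∅) = if i = j then -1 else 0 := by
        by_cases h : i = j
        · subst h; simp [wt]
        · simp [wt, h, Ne.symm h]
      rw [h4, h5] at h3
      exact (add_eq_left.1 h3.symm)
    obtain ⟨s, hs, rfl⟩ := weight_zero_diag hm hn hwt
    exact ⟨s, hs, rfl⟩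
  · intro k l hkl
    have hy := fd_pair_mem_S0 (F := F) (p := p) (t := t) hn hkl i
    have h1 := hψ'.2 _ (hD j) _ hy
    rw [lie_D_fd (r := .inl i) j (par_mono (by rw [Finset.card_pair hkl]; rfl) 1),
      D_inl_mono_zero rfl, fd_zero, map_zero, eq_comm, sub_eq_zero] at h1
    rw [← h1]
    exact hzero (hψ'.1 _ hy).1 _ _

theorem lie_hop_hop (i j : Fin m) (k l : Fin n) :
    ⁅(hop i k : Module.End F (Alg F m n)), (hop j l : Module.End F (Alg F m n))⁆ = 0 := by
  rw [Ring.lie_def, sub_eq_zero]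
  refine alg_ext fun a => ?_
  simp only [Module.End.mul_apply, hop_mono, map_smul]
  rw [smul_comm]

/-- The values on the torus have constant even part, since `[h, D_j]` is a multiple of `D_j`. As the
torus is abelian, their components of nonzero weight form a coboundary. The component of weight zero
is diagonal and is excluded by `diagonal_eq_zero`. -/
theorem exists_adl_hop (hp : 3 < p) (hm : 3 ≤ m) (hn : 3 ≤ n) (ht : ∀ i, 1 ≤ t i)
    {ψ : Module.End F (Module.End F (Alg F m n))}
    (hψ : ψ ∈ derEnd F n p t) (h0 : ∀ j, ψ (D (.inl j)) = 0) : ∃ E ∈ W0 F n p t,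
      (∀ j, (ψ + adl E) (D (.inl j)) = 0) ∧ ∀ i k, (ψ + adl E) (hop i k) = 0 := by
  classical
  have hpos (i : Fin m) := pow_pos (Fact.out : p.Prime).pos (t i)
  have hD (i : Fin m) := D_mem_S0 (F := F) (p := p) (t := t) hn i
  have hH (i : Fin m) (k : Fin n) := hop_mem_S0 (F := F) (p := p) (t := t) hp ht i k
  -- Divide by a nonzero weight; by `hrel` below, any torus element with nonzero weight gives the
  -- same quotient. Only coefficients without `x_i` are used, so `E` commutes with the `D_j` and
  -- their vanishing is preserved.
  obtain ⟨E, hE, hcf⟩ := exists_W0 (F := F) (p := p) (t := t) {a : Mon m n | a.1 = 0}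
    (fun a ha i => by rw [show a.1 = 0 from ha]; exact hpos i)
    (fun r b => if h : ∃ q : Fin m × Fin n, wt F q.1 q.2 r b ≠ 0 then
      cf b (ψ (hop h.choose.1 h.choose.2) (xv r)) / wt F h.choose.1 h.choose.2 r b else 0)
  have hED (j : Fin m) : ⁅(D (.inl j) : Module.End F (Alg F m n)), E⁆ = 0 := by
    refine W0_eq_of_cf (W0_lie (S0_le_W0 (hD j)) hE) (Submodule.zero_mem _) fun r a => ?_
    rw [cf_lie_D j hE.1, (hcf r _).2]
    · simp
    · intro h
      have := congrFun (show a.1 + Pi.single j 1 = 0 from h) j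
      simp at this
  have hψ' := Submodule.add_mem _ hψ (adl_mem_derEnd hE)
  have hD0 (j : Fin m) : (ψ + adl E) (D (.inl j)) = 0 := by
    rw [LinearMap.add_apply, h0, adl_apply, ← lie_skew, hED]; simp
  refine ⟨E, hE, hD0, fun i k => ?_⟩
  have hconst {χ : Module.End F (Module.End F (Alg F m n))} (hχ : χ ∈ derEnd F n p t)
      (hχ0 : ∀ j, χ (D (.inl j)) = 0) (i k r a) (h : cf a (χ (hop i k) (xv r)) ≠ 0) : a.1 = 0 := by
    refine constant_of_lie (hχ.1 _ (hH i k)).1 (fun j => ?_) h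
    have := hχ.2 _ (hH i k) _ (hD j)
    rw [lie_hop_D hp ht, map_smul, hχ0, smul_zero, lie_zero, zero_sub, eq_comm, neg_eq_zero] at this
    exact this
  have hrel (i k j l r a) : wt F i k r a * cf a (ψ (hop j l) (xv r))
      = wt F j l r a * cf a (ψ (hop i k) (xv r)) := by
    have := hψ.2 _ (hH i k) _ (hH j l)
    rw [lie_hop_hop, map_zero, eq_comm, sub_eq_zero] at this
    rw [← cf_lie_hop, ← cf_lie_hop, this]
  have key (i k r a) (ha : cf a ((ψ + adl E) (hop i k) (xv r)) ≠ 0) :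
      ∀ j l, wt F j l r a = 0 := by
    by_contra hex
    have hex' : ∃ q : Fin m × Fin n, wt F q.1 q.2 r a ≠ 0 := by
      push Not at hex
      obtain ⟨j, l, h⟩ := hex
      exact ⟨(j, l), h⟩
    have ha0 := hconst hψ' hD0 i k r a ha
    have hpar := mem_par_iff.1 (even_apply_par (hψ'.1 _ (hH i k)).2 r) a ha
    have e := (hcf r a).1 ha0 hpar
    rw [dif_pos hex'] at e
    have hne := hex'.choose_spec
    refine ha ?_
    rw [LinearMap.add_apply, adl_apply, ← lie_skew, LinearMap.add_apply, LinearMap.neg_apply,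
      map_add, map_neg, cf_lie_hop, e, mul_div_assoc', hrel, mul_div_assoc, mul_comm,
      div_mul_cancel₀ _ hne, add_neg_cancel]
  generalize ψ + adl E = ψ at *
  refine diagonal_eq_zero hp hn (hψ'.1 _ (hH i k)) 0 ?_ i ?_
  · intro r a ha
    obtain ⟨α, u⟩ := a
    have hα : α = 0 := hconst hψ' hD0 i k r _ ha
    subst hα
    obtain ⟨s, hs, rfl⟩ := weight_zero_diag hm hn (key i k r _ ha)
    exact ⟨s, hs, rfl⟩
  · intro q l hql
    have hy := fd_pair_mem_S0 (F := F) (p := p) (t := t) hn hql i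
    have h1 := hψ'.2 _ (hH i k) _ hy
    -- In the derivation rule for `[h, y]` with `y` a weight vector, the coefficient of `ψ(y)` at
    -- the monomial of `y` appears on both sides with the same weight. What is left is that of `[y,
    -- ψ(h)]`.
    rw [lie_hop_fd (p := p) (t := t) (r := .inl i) hp ht i k hpos
      (by rw [Finset.card_pair hql]; rfl), map_smul] at h1
    have h2 := congrArg (fun A : Module.End F (Alg F m n) => cf (0, {q, l}) (A (xv (.inl i)))) h1
    simp only [LinearMap.sub_apply, LinearMap.smul_apply, map_sub, map_smul, cf_lie_hop,
        smul_eq_mul] at h2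
    linear_combination h2

/-! ### Derivations vanishing on translations and the torus -/

/-- On a weight vector whose brackets with the translations are killed, the values of the derivation
have constant coefficients and the same weight. -/
theorem weight_of_cf_ne_zero (hp : 3 < p) (hn : 3 ≤ n) (ht : ∀ i, 1 ≤ t i)
    {ψ : Module.End F (Module.End F (Alg F m n))}
    (hψ : ψ ∈ derEnd F n p t) (hD : ∀ j, ψ (D (.inl j)) = 0) (hH : ∀ i k, ψ (hop i k) = 0)
    {y : Module.End F (Alg F m n)} (hy : y ∈ S0 F n p t)
    (hDy : ∀ j, ψ ⁅(D (.inl j) : Module.End F (Alg F m n)), y⁆ = 0) {c : Fin m → Fin n → F}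
    (hHy : ∀ i k, ⁅(hop i k : Module.End F (Alg F m n)), y⁆ = c i k • y)
    {r : Fin m ⊕ Fin n} {a : Mon m n} (ha : cf a (ψ y (xv r)) ≠ 0) :
    a.1 = 0 ∧ ∀ i k, wt F i k r (0, a.2) = c i k := by
  have hw := hψ.1 _ hy
  have h0 : a.1 = 0 := by
    refine constant_of_lie hw.1 (fun j => ?_) ha
    rw [← hDy j, hψ.2 _ (D_mem_S0 hn j) _ hy, hD, lie_zero, sub_zero]
  refine ⟨h0, fun i k => ?_⟩
  have h1 := hψ.2 _ (hop_mem_S0 hp ht i k) _ hy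
  rw [hHy, map_smul, hH, lie_zero, sub_zero] at h1
  have h2 := congrArg (fun A : Module.End F (Alg F m n) => cf a (A (xv r))) h1
  simp only [LinearMap.smul_apply, map_smul, cf_lie_hop, smul_eq_mul] at h2
  have h3 := mul_right_cancel₀ ha h2
  rw [h3, wt_eq_add i k r a, h0]; simp

end

/-! ### Comparison of weights -/

/-- The condition on `u₀` is needed: the weight of `x^v ξ_l D_l`, `l ∉ v`, does not depend on `l`.
Without such a cancelling factor, a weight `-1` at `l` identifies `D_l`, because a monomial
contributes only `0` or `1` there and `2 ≠ 0`. -/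
theorem weight_unique (h2 : (2 : F) ≠ 0) (hm : 3 ≤ m) (hn : 3 ≤ n) {r r₀ : Fin m ⊕ Fin n}
    {u u₀ : Finset (Fin n)} (hu : ∀ l, r₀ = .inr l → l ∉ u₀)
    (h : ∀ i k, wt F i k r (0, u) = wt F i k r₀ (0, u₀)) : r = r₀ ∧ u = u₀ := by
  have hr : r = r₀ := by
    rcases r with i | k <;> rcases r₀ with j | l
    · by_contra hij
      have hij' : i ≠ j := fun e => hij (by rw [e])
      have e1 := h i ⟨0, by omega⟩
      have e2 := h j ⟨0, by omega⟩
      simp only [wt, Sum.inl.injEq, hij', Ne.symm hij', if_true, if_false, reduceCtorEq] at e1 e2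
      exact h2 (by linear_combination e2 - e1)
    · obtain ⟨j, hj, -⟩ := exists_third hm i i
      have e1 := h i ⟨0, by omega⟩
      have e2 := h j ⟨0, by omega⟩
      simp only [wt, Sum.inl.injEq, Ne.symm hj, if_true, if_false, reduceCtorEq, Pi.zero_apply]
        at e1 e2
      exact absurd (by linear_combination e2 - e1 : (1 : F) = 0) one_ne_zero
    · obtain ⟨i, hi, -⟩ := exists_third hm j j
      have e1 := h i ⟨0, by omega⟩
      have e2 := h j ⟨0, by omega⟩
      simp only [wt, Sum.inl.injEq, Ne.symm hi, if_true, if_false, reduceCtorEq, Pi.zero_apply]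
        at e1 e2
      exact absurd (by linear_combination e2 - e1 : (1 : F) = 0) one_ne_zero
    · by_contra hkl
      have hkl' : k ≠ l := fun e => hkl (by rw [e])
      have e1 := h ⟨0, by omega⟩ l
      by_cases hl : l ∈ u
      · simp only [wt, Sum.inr.injEq, hkl', hu l rfl, hl, if_true, if_false, reduceCtorEq,
          Pi.zero_apply] at e1
        exact h2 (by linear_combination e1)
      · simp only [wt, Sum.inr.injEq, hkl', hu l rfl, hl, if_true, if_false, reduceCtorEq,
          Pi.zero_apply] at e1
        exact absurd (by linear_combination e1 : (1 : F) = 0) one_ne_zero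
  subst hr
  refine ⟨rfl, ?_⟩
  ext k
  have e := h ⟨0, by omega⟩ k
  simp only [wt] at e
  by_cases h3 : k ∈ u <;> by_cases h4 : k ∈ u₀ <;> simp only [h3, h4, if_true, if_false] at e ⊢
  · exact absurd (by linear_combination e : (1 : F) = 0) one_ne_zero
  · exact absurd (by linear_combination -e : (1 : F) = 0) one_ne_zero

/-- The even parts of the weights of elements with constant coefficients take at most one
exceptional value. -/
theorem weight_triple {r : Fin m ⊕ Fin n} {u : Finset (Fin n)} {b : Fin m → F} {k : Fin n} {v : F}
    (h : ∀ i, wt F i k r (0, u) = b i + v) {i j l : Fin m} (hij : i ≠ j) (hil : i ≠ l)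
    (hjl : j ≠ l) :
    (b i = b j ∧ b j = b l) ∨ (b i = b j ∧ b l + 1 = b i) ∨ (b i = b l ∧ b j + 1 = b i) ∨
      (b j = b l ∧ b i + 1 = b j) := by
  have hi := h i
  have hj := h j
  have hl := h l
  rcases r with s | s
  · by_cases h1 : s = i
    · subst h1
      simp only [wt, Sum.inl.injEq, hij, hil, if_true, if_false, reduceCtorEq, Pi.zero_apply]
        at hi hj hl
      exact .inr (.inr (.inr ⟨by linear_combination hl - hj, by linear_combination hj - hi⟩))
    · by_cases h2 : s = j
      · subst h2
        simp only [wt, Sum.inl.injEq, hij.symm, hjl, if_true, if_false, reduceCtorEq, Pi.zero_apply]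
          at hi hj hl
        exact .inr (.inr (.inl ⟨by linear_combination hl - hi, by linear_combination hi - hj⟩))
      · by_cases h3 : s = l
        · subst h3
          simp only [wt, Sum.inl.injEq, hil.symm, hjl.symm, if_true, if_false, reduceCtorEq,
            Pi.zero_apply] at hi hj hl
          exact .inr (.inl ⟨by linear_combination hj - hi, by linear_combination hi - hl⟩)
        · simp only [wt, Sum.inl.injEq, h1, h2, h3, if_false, reduceCtorEq, Pi.zero_apply]
            at hi hj hl
          exact .inl ⟨by linear_combination hj - hi, by linear_combination hl - hj⟩
  · simp only [wt, if_false, reduceCtorEq, Pi.zero_apply] at hi hj hl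
    exact .inl ⟨by linear_combination hj - hi, by linear_combination hl - hj⟩

/-! ### The odd torus -/

/-- The element `∑ z_k ξ_k D_k`. -/
def oddTorus (m : ℕ) (z : Fin n → F) : Module.End F (Alg F m n) :=
  ∑ k, z k • fd (xi k) (.inr k)

theorem oddTorus_mono (z : Fin n → F) (a : Mon m n) :
    oddTorus m z (mono a 1) = (∑ k ∈ a.2, z k) • mono a 1 := by
  rw [oddTorus, LinearMap.sum_apply]
  simp only [LinearMap.smul_apply, xi_D_mono, smul_smul, mul_ite, mul_one, mul_zero]
  rw [← Finset.sum_smul, Finset.sum_ite_mem, Finset.univ_inter]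

theorem lie_oddTorus_hop (z : Fin n → F) (i : Fin m) (k : Fin n) :
    ⁅oddTorus m z, (hop i k : Module.End F (Alg F m n))⁆ = 0 := by
  rw [Ring.lie_def, sub_eq_zero]
  refine alg_ext fun a => ?_
  simp only [Module.End.mul_apply, hop_mono, oddTorus_mono, map_smul]
  rw [smul_comm]

/-- The weight of `D_r` with respect to `∑ z_k ξ_k D_k`, up to sign. -/
def oddWt (z : Fin n → F) : Fin m ⊕ Fin n → F
  | .inl _ => 0
  | .inr k => z k

theorem oddTorus_xv (z : Fin n → F) (r : Fin m ⊕ Fin n) :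
    oddTorus m z (xv r) = oddWt z r • xv r := by
  rcases r with i | k
  · simp [xv, oddTorus_mono, oddWt]
  · simp [xv, oddTorus_mono, oddWt]

theorem oddTorus_mem {p : ℕ} [Fact p.Prime] {t : Fin m → ℕ} (z : Fin n → F) :
    oddTorus m z ∈ W0 F n p t :=
  Submodule.sum_mem _ fun k _ => Submodule.smul_mem _ _ (fd_mem_W0 (xi_trunc k) (par_xi k))

theorem lie_oddTorus_fd {p : ℕ} [Fact p.Prime] [CharP F p] {t : Fin m → ℕ} (z : Fin n → F)
    {a : Mon m n} {r : Fin m ⊕ Fin n} (ha : ∀ i, a.1 i < p ^ t i)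
    (he : (a.2.card : ZMod 2) = tau r) :
    ⁅oddTorus m z, fd (mono a (1 : F)) r⁆
      = (∑ k ∈ a.2, z k - oddWt z r) • fd (mono a 1) r := by
  have hf : fd (mono a (1 : F)) r ∈ W0 F n p t := fd_mem_W0 (trunc_mono ha 1) (par_mono he 1)
  refine W0_eq_of_cf (W0_lie (oddTorus_mem z) hf) (Submodule.smul_mem _ _ hf) fun s b => ?_
  rw [Ring.lie_def, LinearMap.sub_apply, Module.End.mul_apply, Module.End.mul_apply, oddTorus_xv,
    map_smul, LinearMap.smul_apply, fd_xv]
  by_cases hs : r = s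
  · subst hs
    rw [if_pos rfl, oddTorus_mono, sub_smul]
  · simp [hs]

/-! ### Normalized derivations -/

/-- A derivation which vanishes on the translations `D_j` and on the torus. -/
structure Normalized (p : ℕ) (t : Fin m → ℕ) (ψ : Module.End F (Module.End F (Alg F m n))) :
    Prop where
  der : ψ ∈ derEnd F n p t
  onD : ∀ j, ψ (D (.inl j)) = 0
  onH : ∀ i k, ψ (hop i k) = 0

section

variable {p : ℕ} [Fact p.Prime] [CharP F p] {t : Fin m → ℕ}
  {ψ : Module.End F (Module.End F (Alg F m n))}

/-- The odd torus commutes with the translations and with all `hop i k`. It is the freedom left by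
the normalization. -/
theorem Normalized.add_adl (h : Normalized p t ψ) (z : Fin n → F) :
    Normalized p t (ψ + adl (oddTorus m z)) := by
  refine ⟨Submodule.add_mem _ h.der (adl_mem_derEnd (oddTorus_mem z)), fun j => ?_, fun i k => ?_⟩
  · have := lie_oddTorus_fd (F := F) (p := p) (t := t) z (a := ((0, ∅) : Mon m n)) (r := .inl j)
      (fun _ => pow_pos (Fact.out : p.Prime).pos _) (by simp [tau_inl])
    rw [show mono ((0, ∅) : Mon m n) (1 : F) = one from rfl, fd_one] at this
    rw [LinearMap.add_apply, h.onD, adl_apply, this]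
    simp [oddWt]
  · rw [LinearMap.add_apply, h.onH, adl_apply, lie_oddTorus_hop, add_zero]

/-- A normalized derivation vanishes on weight vectors whose weight does not occur among the
elements with constant coefficients. -/
theorem Normalized.eq_zero (hp : 3 < p) (hn : 3 ≤ n) (ht : ∀ i, 1 ≤ t i) (h : Normalized p t ψ)
    {y : Module.End F (Alg F m n)} (hy : y ∈ S0 F n p t)
    (hDy : ∀ j, ψ ⁅(D (.inl j) : Module.End F (Alg F m n)), y⁆ = 0) {b : Fin m → F} {v : Fin n → F}
    (hHy : ∀ i k, ⁅(hop i k : Module.End F (Alg F m n)), y⁆ = (b i + v k) • y) {i j l : Fin m}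
    (hij : i ≠ j) (hil : i ≠ l) (hjl : j ≠ l)
    (hb : ¬((b i = b j ∧ b j = b l) ∨ (b i = b j ∧ b l + 1 = b i) ∨ (b i = b l ∧ b j + 1 = b i) ∨
      (b j = b l ∧ b i + 1 = b j))) : ψ y = 0 := by
  refine W0_eq_of_cf (h.der.1 y hy) (Submodule.zero_mem _) fun r a => ?_
  rw [LinearMap.zero_apply, map_zero]
  by_contra hne
  obtain ⟨-, hw⟩ := weight_of_cf_ne_zero hp hn ht h.der h.onD h.onH hy hDy hHy hne
  exact hb (weight_triple (k := ⟨0, by omega⟩) (fun i => hw i _) hij hil hjl)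

/-- A normalized derivation acts as a scalar on suitable elements with constant weight. -/
theorem Normalized.eq_smul (hp : 3 < p) (hm : 3 ≤ m) (hn : 3 ≤ n) (ht : ∀ i, 1 ≤ t i)
    (h : Normalized p t ψ) {y : Module.End F (Alg F m n)} (hy : y ∈ S0 F n p t)
    (hDy : ∀ j, ψ ⁅(D (.inl j) : Module.End F (Alg F m n)), y⁆ = 0) {r : Fin m ⊕ Fin n}
    {u : Finset (Fin n)} (hu : ∀ l, r = .inr l → l ∉ u) (he : (u.card : ZMod 2) = tau r)
    (hHy : ∀ i k, ⁅(hop i k : Module.End F (Alg F m n)), y⁆ = wt F i k r (0, u) • y) :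
    ψ y = cf (0, u) (ψ y (xv r)) • fd (mono (0, u) 1) r := by
  refine W0_eq_of_cf (h.der.1 y hy) (Submodule.smul_mem _ _ (fd_mem_W0
    (trunc_mono (fun _ => pow_pos (Fact.out : p.Prime).pos _) 1) (par_mono he 1))) fun s a => ?_
  rw [LinearMap.smul_apply, map_smul, fd_xv]
  by_cases hne : cf a (ψ y (xv s)) = 0
  · rw [hne]
    by_cases hs : r = s
    · subst hs
      rw [if_pos rfl, cf_mono]
      by_cases ha : (0, u) = a
      · subst ha; rw [hne]; simp
      · simp [ha]
    · simp [hs]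
  · obtain ⟨h1, h3⟩ := weight_of_cf_ne_zero hp hn ht h.der h.onD h.onH hy hDy hHy hne
    obtain ⟨rfl, h4⟩ := weight_unique (two_ne_zero_of_lt hp) hm hn hu h3
    have : (0, u) = a := Prod.ext h1.symm h4.symm
    subst this
    simp [cf_mono]

/-! ### Normalized derivations on `ξ_k D_l`, `x_i D_j` and `ξ_k ξ_l D_i` -/

theorem lie_xi_xi (k l q s : Fin n) :
    ⁅fd (xi k : Alg F m n) (.inr l), fd (xi q : Alg F m n) (.inr s)⁆
      = (if l = q then fd (xi k) (.inr s) else 0) - if s = k then fd (xi q) (.inr l) else 0 := by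
  rw [lie_fd (r := .inr l) (s := .inr s) (par_xi k) (par_xi q), D_xv, D_xv]
  by_cases h1 : l = q <;> by_cases h2 : s = k <;> simp [h1, h2, mul_one', fd_zero]

theorem fd_xi_mem_S0 (hp : 3 < p) {k l : Fin n} (h : k ≠ l) :
    fd (xi k : Alg F m n) (.inr l) ∈ S0 F n p t :=
  fd_mem_S0 hp (xi_trunc k) (par_xi k) (D_xi_ne h.symm)

theorem Normalized.xi_eq_smul (hp : 3 < p) (hm : 3 ≤ m) (hn : 3 ≤ n) (ht : ∀ i, 1 ≤ t i)
    (h : Normalized p t ψ) {k l : Fin n} (hkl : k ≠ l) :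
    ∃ c : F, ψ (fd (xi k) (.inr l)) = c • fd (xi k) (.inr l) := by
  refine ⟨_, h.eq_smul hp hm hn ht (fd_xi_mem_S0 hp hkl) (fun j => ?_) (r := .inr l) (u := {k})
    (fun q hq => ?_) (by simp [tau_inr]) fun i q =>
      lie_hop_fd hp ht i q (fun _ => pow_pos (Fact.out : p.Prime).pos _) (by simp [tau_inr])⟩
  · rw [lie_D_fd (r := .inr l) j (par_xi k), D_xi_inl, fd_zero, map_zero]
  · cases hq; simpa using hkl.symm

/-- The even weight takes the values `1`, `-1`, `0` at `i`, `j` and a third index, which no element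
with constant even part has. -/
theorem Normalized.x_eq_zero (hp : 3 < p) (hm : 3 ≤ m) (hn : 3 ≤ n) (ht : ∀ i, 1 ≤ t i)
    (h : Normalized p t ψ) {i j : Fin m} (hij : i ≠ j) :
    fd (xv (.inl i)) (.inl j) ∈ S0 F n p t ⊓ LinearMap.ker ψ := by
  obtain ⟨l, hli, hlj⟩ := exists_third hm i j
  have hS : fd (xv (.inl i) : Alg F m n) (.inl j) ∈ S0 F n p t := by
    rw [← Y_of_D_eq_zero (D_x_ne hij.symm) ⟨0, by omega⟩]
    exact Y_mem_S0 (x_trunc hp ht i) (par_xinl i) (D_x_inr i _) j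
  refine ⟨hS, ?_⟩
  refine h.eq_zero hp hn ht hS (fun q => ?_) (b := fun q => (if q = i then 1 else 0)
    - if q = j then 1 else 0) (v := fun _ => 0) (fun q k => ?_) hij hli.symm hlj.symm ?_
  · rw [lie_D_fd (r := .inl j) q (par_xinl i), D_xv]
    by_cases hq : q = i
    · rw [if_pos (by rw [hq]), fd_one, h.onD]
    · rw [if_neg (by simpa using hq), fd_zero, map_zero]
  · rw [xv_inl_eq, lie_hop_fd (p := p) (t := t) hp ht q k
      (mem_trunc_iff.1 (x_trunc (F := F) hp ht i) _ (by rw [xv_inl_eq, cf_mono]; simp))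
      (by simp [tau_inl])]
    congr 1
    simp [wt, Pi.single_apply, eq_comm]
  · have h2 := two_ne_zero_of_lt (F := F) hp
    simp only [hij, hij.symm, hli, hlj, if_true, if_false]
    rintro (⟨h1, h3⟩ | ⟨h1, h3⟩ | ⟨h1, h3⟩ | ⟨h1, h3⟩)
    · exact h2 (by linear_combination h1)
    · exact h2 (by linear_combination h1)
    · exact one_ne_zero (by linear_combination h1)
    · exact one_ne_zero (by linear_combination -h1)

theorem Normalized.exists_xi (hp : 3 < p) (hm : 3 ≤ m) (hn : 3 ≤ n) (ht : ∀ i, 1 ≤ t i)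
    (h : Normalized p t ψ) : ∃ z : Fin n → F, Normalized p t (ψ + adl (oddTorus m z)) ∧
      ∀ k l, k ≠ l → (ψ + adl (oddTorus m z)) (fd (xi k) (.inr l)) = 0 := by
  classical
  set k₀ : Fin n := ⟨0, by omega⟩
  choose b hb using fun k => fun hk : k ≠ k₀ => h.xi_eq_smul hp hm hn ht hk
  -- The odd torus multiplies `ξ_k D_{k₀}` by `z_k - z_{k₀}`; with `z_{k₀} = 0` this cancels the
  -- scalar `b_k`.
  set z : Fin n → F := fun k => if hk : k ≠ k₀ then -b k hk else 0 with hz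
  have h' := h.add_adl z
  refine ⟨z, h', ?_⟩
  have h0 (k : Fin n) (hk : k ≠ k₀) : (ψ + adl (oddTorus m z)) (fd (xi k) (.inr k₀)) = 0 := by
    have := lie_oddTorus_fd (F := F) (p := p) (t := t) z (a := ((0, {k}) : Mon m n)) (r := .inr k₀)
      (fun _ => pow_pos (Fact.out : p.Prime).pos _) (by simp [tau_inr])
    rw [LinearMap.add_apply, adl_apply, hb k hk]
    refine (congrArg _ this).trans ?_
    rw [Finset.sum_singleton, oddWt, ← xv, ← add_smul]
    simp [hz, hk]
  generalize ψ + adl (oddTorus m z) = χ at *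
  have h1 (k : Fin n) (hk : k ≠ k₀) : χ (fd (xi k₀) (.inr k)) = 0 := by
    obtain ⟨c, hc⟩ := h'.xi_eq_smul hp hm hn ht hk.symm
    -- The bracket lies in the torus, where the derivation vanishes, but it is not zero; so the
    -- scalar on the second factor is zero.
    have e1 : ⁅fd (xi k : Alg F m n) (.inr k₀), fd (xi k₀ : Alg F m n) (.inr k)⁆
        = hop ⟨0, by omega⟩ k - hop ⟨0, by omega⟩ k₀ := by
      rw [lie_xi_xi, if_pos rfl, if_pos rfl, hop, hop]; abel
    have e2 := h'.der.2 _ (fd_xi_mem_S0 hp hk) _ (fd_xi_mem_S0 hp hk.symm)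
    rw [h0 k hk, lie_zero, sub_zero, hc, lie_smul, e1, map_sub, h'.onH, h'.onH, sub_zero] at e2
    have e3 := congrArg (fun A : Module.End F (Alg F m n) => cf (0, {k}) (A (xi k))) e2
    simp only [LinearMap.zero_apply, map_zero, LinearMap.smul_apply, LinearMap.sub_apply, map_smul,
      map_sub, cf_hop, smul_eq_mul, Finset.mem_singleton, Ne.symm hk, if_true, if_false, xi, xv,
      cf_mono, Pi.zero_apply, Nat.cast_zero] at e3
    have : c = 0 := by linear_combination -e3
    rw [hc, this, zero_smul]
  intro k l hkl
  by_cases hl : l = k₀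
  · subst hl; exact h0 k hkl
  by_cases hk : k = k₀
  · subst hk; exact h1 l hl
  have := ker_lie h'.der ⟨fd_xi_mem_S0 hp hk, h0 k hk⟩ ⟨fd_xi_mem_S0 hp (Ne.symm hl), h1 l hl⟩
  rw [lie_xi_xi, if_pos rfl, if_neg (Ne.symm hkl), sub_zero] at this
  exact this.2

theorem Normalized.exists_pair (hp : 3 < p) (hm : 3 ≤ m) (hn : 3 ≤ n) (ht : ∀ i, 1 ≤ t i)
    (h : Normalized p t ψ) (hxi : ∀ k l, k ≠ l → ψ (fd (xi k) (.inr l)) = 0) :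
    ∃ z : Fin n → F, Normalized p t (ψ + adl (oddTorus m z)) ∧
      (∀ k l, k ≠ l → (ψ + adl (oddTorus m z)) (fd (xi k) (.inr l)) = 0) ∧
      ∀ k l, k ≠ l → ∀ i, (ψ + adl (oddTorus m z)) (fd (mono (0, {k, l}) 1) (.inl i)) = 0 := by
  set k₀ : Fin n := ⟨0, by omega⟩
  obtain ⟨k₁, hk₁, -⟩ := exists_third hn k₀ k₀
  set i₀ : Fin m := ⟨0, by omega⟩
  have h2 := two_ne_zero_of_lt (F := F) hp
  have hpos (i : Fin m) := pow_pos (Fact.out : p.Prime).pos (t i)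
  have hcard {k l : Fin n} (hkl : k ≠ l) (i : Fin m) :
      ((({k, l} : Finset (Fin n)).card : ℕ) : ZMod 2) = tau (.inl i : Fin m ⊕ Fin n) := by
    rw [Finset.card_pair hkl]; rfl
  obtain ⟨a, hval⟩ : ∃ a : F, ψ (fd (mono (0, {k₀, k₁}) 1) (.inl i₀))
      = a • fd (mono (0, {k₀, k₁}) 1) (.inl i₀) :=
    ⟨_, h.eq_smul hp hm hn ht (fd_pair_mem_S0 hn hk₁.symm i₀) (fun j => by
      rw [lie_D_fd (r := .inl i₀) j (par_mono (hcard hk₁.symm i₀) 1), D_inl_mono_zero rfl, fd_zero,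
        map_zero]) (r := .inl i₀) (u := {k₀, k₁}) (fun q hq => by cases hq) (hcard hk₁.symm i₀)
      (fun i k => lie_hop_fd hp ht i k hpos (hcard hk₁.symm i₀))⟩
  -- A constant `z` gives a multiple of the odd Euler field. It commutes with every `ξ_k D_l`, and
  -- it acts on `ξ_{k₀} ξ_{k₁} D_{i₀}` by `2 · (-(a / 2)) = -a`. One pair is enough, since brackets
  -- with `x_{i₀} D_i` and `ξ_k D_l` produce all the others.
  set z : Fin n → F := fun _ => -(a / 2)
  have h' := h.add_adl z
  have hxi' (k l : Fin n) (hkl : k ≠ l) :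
      (ψ + adl (oddTorus m z)) (fd (xi k) (.inr l)) = 0 := by
    have := lie_oddTorus_fd (F := F) (p := p) (t := t) z (a := ((0, {k}) : Mon m n)) (r := .inr l)
      hpos (by simp [tau_inr])
    rw [LinearMap.add_apply, adl_apply, hxi k l hkl, zero_add]
    refine this.trans ?_
    simp [oddWt, z]
  have h0 : (ψ + adl (oddTorus m z)) (fd (mono (0, {k₀, k₁}) 1) (.inl i₀)) = 0 := by
    rw [LinearMap.add_apply, adl_apply, hval, lie_oddTorus_fd (p := p) (t := t) z hpos
      (hcard hk₁.symm i₀), ← add_smul, Finset.sum_pair hk₁.symm, oddWt]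
    convert zero_smul F _
    simp only [z]
    field_simp
    ring
  refine ⟨z, h', hxi', ?_⟩
  generalize ψ + adl (oddTorus m z) = χ at *
  set K := S0 F n p t ⊓ LinearMap.ker χ
  intro k l hkl i
  have hPe (k l : Fin n) : mul (xi k) (xi l : Alg F m n) ∈ par F m n 0 := by
    have := par_mul (par_xi (F := F) (m := m) k) (par_xi l)
    rwa [zmod_two_one_add_one] at this
  have hPi (k l : Fin n) (i : Fin m) : D (.inl i) (mul (xi k) (xi l : Alg F m n)) = 0 := by
    rw [D_inl_mul, D_xi_inl, D_xi_inl]; simp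
  have base : fd (mul (xi k₀) (xi k₁)) (.inl i) ∈ K := by
    have e0 : fd (mono (0, {k₀, k₁}) 1) (.inl i₀) ∈ K := ⟨fd_pair_mem_S0 hn hk₁.symm i₀, h0⟩
    obtain ⟨c, -, hP⟩ := xi_mul_xi_eq (F := F) (m := m) hk₁.symm
    have e1 : fd (mul (xi k₀) (xi k₁)) (.inl i₀) ∈ K := by
      rw [hP, fd_smul]; exact K.smul_mem _ e0
    by_cases hi : i = i₀
    · rwa [hi]
    · have := ker_lie h'.der e1 (h'.x_eq_zero hp hm hn ht (Ne.symm hi))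
      rwa [lie_fd (r := .inl i₀) (s := .inl i) (hPe _ _) (par_xinl i₀), D_x_self, mul_one', hPi,
        map_zero, fd_zero, sub_zero] at this
  have rule1 {k l q : Fin n} (hlq : l ≠ q) (hl : fd (mul (xi l) (xi q)) (.inl i) ∈ K) :
      fd (mul (xi k) (xi q)) (.inl i) ∈ K := by
    by_cases hk : k = l
    · rwa [hk]
    have := ker_lie h'.der ⟨fd_xi_mem_S0 hp hk, hxi' k l hk⟩ hl
    rwa [lie_fd (r := .inr l) (s := .inl i) (par_xi k) (hPe _ _), D_inr_mul1 _ (par_xi l), D_xi_self,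
      D_xi_ne hlq, one_mul', map_zero, sub_zero, D_xi_inl, map_zero, fd_zero, sub_zero] at this
  have rule2 {k q : Fin n} (hl : fd (mul (xi k) (xi q)) (.inl i) ∈ K) :
      fd (mul (xi q) (xi k)) (.inl i) ∈ K := by
    rw [xi_mul_xi, fd_neg]; exact K.neg_mem hl
  have all : fd (mul (xi k) (xi l)) (.inl i) ∈ K := by
    by_cases hl : l = k₁
    · subst hl; exact rule1 hk₁.symm base
    · exact rule1 (Ne.symm hl) (rule2 (rule1 hk₁.symm base))
  obtain ⟨c, hc, hP⟩ := xi_mul_xi_eq (F := F) (m := m) hkl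
  rw [hP, fd_smul] at all
  exact ((K.smul_mem_iff hc).1 all).2

end

/-! ### Powers of the translations -/

/-- Only for powers of `p` are all the inner binomial coefficients divisible by `p`. This is why
exactly the `p`-power exponents give rise to outer derivations. -/
theorem exists_choose_ne_zero {p : ℕ} [Fact p.Prime] [CharP F p] {a : ℕ} (ha : 0 < a)
    (h : ∀ r, a ≠ p ^ r) : ∃ b c, 0 < b ∧ 0 < c ∧ a = b + c ∧ (a.choose b : F) ≠ 0 := by
  by_contra! hall
  refine h _ (Choose.eq_pow_multiplicity_of_choose_modEq_zero_nat (p := p) ha fun b hb => ?_)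
  rw [Finset.mem_Icc] at hb
  have := hall b (a - b) (by omega) (by omega) (by omega)
  rwa [CharP.cast_eq_zero_iff F p, ← Nat.modEq_zero_iff_dvd] at this

theorem cf_D_pow (i : Fin m) (N : ℕ) (a : Mon m n) (f : Alg F m n) :
    cf a ((D (.inl i) ^ N) f) = cf (a.1 + Pi.single i N, a.2) f := by
  induction N generalizing a with
  | zero => simp
  | succ N ih =>
    rw [pow_succ', Module.End.mul_apply, cf_D_inl, ih]
    congr 2
    simp only [add_assoc, ← Pi.single_add, add_comm 1 N]

theorem D_pow_mono_eq_zero {i : Fin m} {N : ℕ} {a : Mon m n} (h : a.1 i < N) :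
    (D (.inl i) ^ N) (mono a (1 : F)) = 0 := by
  refine cf_ext fun b => ?_
  rw [cf_D_pow, cf_mono, map_zero, if_neg]
  rintro rfl
  simp at h

theorem adl_pow_fd (i : Fin m) (N : ℕ) {f : Alg F m n} {r : Fin m ⊕ Fin n}
    (hf : f ∈ par F m n (tau r)) :
    (adl (D (.inl i) : Module.End F (Alg F m n)) ^ N) (fd f r) = fd ((D (.inl i) ^ N) f) r := by
  induction N generalizing f with
  | zero => rfl
  | succ N ih =>
    rw [pow_succ, Module.End.mul_apply, adl_apply, lie_D_fd i hf, ih (par_D0 i hf), pow_succ,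
      Module.End.mul_apply]

theorem adl_pow_fd_mono_eq_zero {i : Fin m} {N : ℕ} {a : Mon m n} {r : Fin m ⊕ Fin n}
    (he : (a.2.card : ZMod 2) = tau r) (h : a.1 i < N) :
    (adl (D (.inl i) : Module.End F (Alg F m n)) ^ N) (fd (mono a 1) r) = 0 := by
  rw [adl_pow_fd i N (par_mono he 1), D_pow_mono_eq_zero h, fd_zero]

theorem adl_pow_D {i j : Fin m} {N : ℕ} (hN : 0 < N) :
    (adl (D (.inl i) : Module.End F (Alg F m n)) ^ N) (D (.inl j)) = 0 := by
  have := adl_pow_fd_mono_eq_zero (F := F) (i := i) (N := N) (a := ((0, ∅) : Mon m n))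
    (r := .inl j) (by simp [tau_inl]) hN
  rwa [show mono ((0, ∅) : Mon m n) (1 : F) = one from rfl, fd_one] at this

theorem adl_pow_hop {i j : Fin m} {k : Fin n} {N : ℕ} (hN : 1 < N) :
    (adl (D (.inl i) : Module.End F (Alg F m n)) ^ N) (hop j k) = 0 := by
  rw [hop, map_add, xv_inl_eq, xi, xv, adl_pow_fd_mono_eq_zero (by simp [tau_inl]),
    adl_pow_fd_mono_eq_zero (by simp [tau_inr]), add_zero]
  · change 0 < N; omega
  · change (Pi.single j 1 : Fin m → ℕ) i < N
    by_cases h : i = j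
    · subst h; simpa using hN
    · simp [h]; omega

/-- The coefficient of `D_j` in the value of `(ad D_s)^N` on `x_i^(a) D_j`. -/
theorem cf_adl_pow (s i j : Fin m) (N a : ℕ) :
    cf ((0, ∅) : Mon m n) ((adl (D (.inl s) : Module.End F (Alg F m n)) ^ N)
      (fd (mono (Pi.single i a, ∅) 1) (.inl j)) (xv (.inl j)))
      = if (Pi.single i a : Fin m → ℕ) = Pi.single s N then 1 else 0 := by
  rw [adl_pow_fd (r := .inl j) s N (par_mono (by simp [tau_inl]) 1), fd_xv, if_pos rfl, cf_D_pow,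
    cf_mono]
  simp

/-- A linear combination of powers of the `ad D_i`. -/
def powSum (n p : ℕ) (t : Fin m → ℕ) (c : Fin m → ℕ → F) :
    Module.End F (Module.End F (Alg F m n)) :=
  ∑ i, ∑ r ∈ Finset.Ico 1 (t i), c i r • adl (D (.inl i)) ^ p ^ r

theorem powSum_apply (p : ℕ) (t : Fin m → ℕ) (c : Fin m → ℕ → F) (y : Module.End F (Alg F m n)) :
    powSum n p t c y
      = ∑ i, ∑ r ∈ Finset.Ico 1 (t i), c i r • (adl (D (.inl i)) ^ p ^ r) y := by
  simp [powSum, LinearMap.sum_apply]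

theorem powSum_eq_zero {p : ℕ} {t : Fin m → ℕ} {c : Fin m → ℕ → F} {y : Module.End F (Alg F m n)}
    (h : ∀ i, ∀ r, 1 ≤ r → (adl (D (.inl i)) ^ p ^ r) y = 0) : powSum n p t c y = 0 := by
  rw [powSum_apply]
  refine Finset.sum_eq_zero fun i _ => Finset.sum_eq_zero fun r hr => ?_
  rw [h i r (Finset.mem_Ico.1 hr).1, smul_zero]

/-- The coefficients of a linear combination of powers of the `ad D_i` can be read off. -/
theorem cf_powSum {p : ℕ} (hp : 1 < p) {t : Fin m → ℕ} (c : Fin m → ℕ → F) {i : Fin m} (j : Fin m)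
    {r : ℕ} (h1 : 1 ≤ r) (h2 : r < t i) :
    cf ((0, ∅) : Mon m n) (powSum n p t c (fd (mono (Pi.single i (p ^ r), ∅) 1) (.inl j))
      (xv (.inl j))) = c i r := by
  have hpos (s : ℕ) : 0 < p ^ s := pow_pos (by omega) s
  simp only [powSum_apply, LinearMap.sum_apply, LinearMap.smul_apply, map_sum, map_smul,
    cf_adl_pow, smul_eq_mul, mul_ite, mul_one, mul_zero]
  rw [Finset.sum_eq_single i, Finset.sum_eq_single r, if_pos rfl]
  · intro s _ hs
    rw [if_neg]
    intro h
    have := congrFun h i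
    rw [Pi.single_eq_same, Pi.single_eq_same] at this
    exact hs (Nat.pow_right_injective hp this).symm
  · intro h; exact absurd (Finset.mem_Ico.2 ⟨h1, h2⟩) h
  · intro s _ hs
    refine Finset.sum_eq_zero fun q _ => ?_
    rw [if_neg]
    intro h
    have := congrFun h i
    rw [Pi.single_eq_same, Pi.single_eq_of_ne (Ne.symm hs)] at this
    exact (hpos r).ne' this
  · intro h; exact absurd (Finset.mem_univ i) h

section

variable {p : ℕ} [Fact p.Prime] [CharP F p] {t : Fin m → ℕ}
  {ψ : Module.End F (Module.End F (Alg F m n))}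

theorem powSum_mem_derEnd (hn : 3 ≤ n) (c : Fin m → ℕ → F) : powSum n p t c ∈ derEnd F n p t :=
  Submodule.sum_mem _ fun i _ => Submodule.sum_mem _ fun r _ =>
    Submodule.smul_mem _ _ (adl_pow_mem_derEnd (S0_le_W0 (D_mem_S0 hn i)) r)

/-- The powers used have exponent at least `p`, whereas translations and torus elements have degree
at most one in each `x_i`. -/
theorem Normalized.sub_powSum (hp : 3 < p) (hn : 3 ≤ n) (h : Normalized p t ψ)
    (c : Fin m → ℕ → F) : Normalized p t (ψ - powSum n p t c) := by
  have hr {r : ℕ} (h : 1 ≤ r) : 1 < p ^ r := Nat.one_lt_pow (by omega) (by omega)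
  refine ⟨Submodule.sub_mem _ h.der (powSum_mem_derEnd hn c), fun j => ?_, fun i k => ?_⟩
  · rw [LinearMap.sub_apply, h.onD, zero_sub, neg_eq_zero]
    exact powSum_eq_zero fun i r h => adl_pow_D (by have := hr h; omega)
  · rw [LinearMap.sub_apply, h.onH, zero_sub, neg_eq_zero]
    exact powSum_eq_zero fun i r h => adl_pow_hop (hr h)

/-! ### The elements `x_i^(a) D_j` and vanishing of fully corrected derivations -/

theorem single_lt_pow {i : Fin m} {a : ℕ} (ha : a < p ^ t i) (q : Fin m) :
    (Pi.single i a : Fin m → ℕ) q < p ^ t q := by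
  by_cases h : q = i
  · subst h; simpa using ha
  · rw [Pi.single_eq_of_ne h]; exact pow_pos (Fact.out : p.Prime).pos _

theorem single_mem_S0 (hn : 3 ≤ n) {i j : Fin m} (hij : i ≠ j) {a : ℕ} (ha : a < p ^ t i) :
    fd (mono (Pi.single i a, ∅) (1 : F)) (.inl j) ∈ S0 F n p t :=
  fd_even_mem_S0 (k := ⟨0, by omega⟩) (by simp) (by simp [hij.symm]) (single_lt_pow ha) (by simp)

/-- A normalized derivation which vanishes on the elements `x_i^(b) D_j` with `b < a` also vanishes
on `x_j x_i^(b) D_l` for `b < a`. -/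
theorem Normalized.x_mul_single_eq_zero (hp : 3 < p) (hm : 3 ≤ m) (hn : 3 ≤ n) (ht : ∀ i, 1 ≤ t i)
    (h : Normalized p t ψ) {i j l : Fin m} (hij : i ≠ j) (hil : i ≠ l) (hjl : j ≠ l) {a : ℕ}
    (hX : ∀ b < a, ψ (fd (mono (Pi.single i b, ∅) 1) (.inl l)) = 0) {b : ℕ} (hb : b < a)
    (hbt : b < p ^ t i) :
    fd (mono (Pi.single i b + Pi.single j 1, ∅) 1) (.inl l) ∈ S0 F n p t ⊓ LinearMap.ker ψ := by
  have h2 := two_ne_zero_of_lt (F := F) hp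
  have h3 : (3 : F) ≠ 0 := by
    intro h
    have := (CharP.cast_eq_zero_iff F p 3).1 (by exact_mod_cast h)
    exact absurd (Nat.le_of_dvd (by omega) this) (by omega)
  have htr (q : Fin m) : (Pi.single i b + Pi.single j 1 : Fin m → ℕ) q < p ^ t q := by
    by_cases h : q = j
    · subst h
      have := three_lt_pow hp ht q
      simp [hij.symm]; omega
    · simpa [h] using single_lt_pow hbt q
  have hS : fd (mono (Pi.single i b + Pi.single j 1, ∅) (1 : F)) (.inl l) ∈ S0 F n p t :=
    fd_even_mem_S0 (k := ⟨0, by omega⟩) (by simp) (by simp [hil.symm, hjl.symm]) htr (by simp)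
  refine ⟨hS, ?_⟩
  induction b with
  | zero =>
    rw [Pi.single_zero, zero_add, ← xv_inl_eq]
    exact (h.x_eq_zero hp hm hn ht hjl).2
  | succ b ih =>
    refine h.eq_zero hp hn ht hS (fun q => ?_) (b := fun q => ((if q = i then (b + 1 : ℕ) else 0)
      + if q = j then 1 else 0) - if q = l then 1 else 0) (v := fun _ => 0) (fun q k => ?_)
      hij hil hjl ?_
    · rw [lie_D_fd (r := .inl l) q (par_mono (by simp [tau_inl]) 1)]
      by_cases hq : q = i
      · subst hq
        rw [Pi.single_add, add_right_comm, D_inl_mono_add]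
        refine ih (by omega) (by omega) (fun s => ?_) ?_
        · refine lt_of_le_of_lt ?_ (htr s)
          simp only [Pi.add_apply, Pi.single_add]; omega
        · refine fd_even_mem_S0 (k := ⟨0, by omega⟩) (by simp) (by simp [hil.symm, hjl.symm])
            (fun s => ?_) (by simp)
          refine lt_of_le_of_lt ?_ (htr s)
          simp only [Pi.add_apply, Pi.single_add]; omega
      · by_cases hq' : q = j
        · subst hq'
          rw [D_inl_mono_add]; exact hX _ hb
        · rw [D_inl_mono_zero (by simp [hq, hq']), fd_zero, map_zero]
    · rw [lie_hop_fd (p := p) (t := t) hp ht q k htr (by simp [tau_inl])]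
      congr 1
      simp only [wt, Pi.add_apply, Pi.single_apply, Finset.notMem_empty, if_false, Sum.inl.injEq,
        reduceCtorEq, eq_comm (a := l)]
      push_cast
      ring
    -- The even weights at `i`, `j`, `l` are `b + 1`, `1`, `-1`. The case `b + 1 = -1` together with
    -- `1 + 1 = b + 1` is excluded only by `3 ≠ 0`.
    · simp only [hij, hij.symm, hil, hil.symm, hjl, hjl.symm, if_true, if_false]
      rintro (⟨h4, h5⟩ | ⟨h4, h5⟩ | ⟨h4, h5⟩ | ⟨h4, h5⟩)
      · exact h2 (by linear_combination h5)
      · exact one_ne_zero (α := F) (by linear_combination -h4 - h5)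
      · exact h3 (by linear_combination h4 + h5)
      · exact h2 (by linear_combination h4)

/-- Strong induction on `a`. If `a ≠ 0` in `F`, the weight does not occur. If it is zero, the weight
is that of `D_j`, and three cases remain: `a = 0`, a power of `p`, where `hpow` makes the scalar
vanish, and all other `a`, where the element is a bracket. In `hpow` a single `j` suffices, because
brackets with `x_{j₀} D_j` change the direction. -/
theorem Normalized.single_eq_zero (hp : 3 < p) (hm : 3 ≤ m) (hn : 3 ≤ n) (ht : ∀ i, 1 ≤ t i)
    (h : Normalized p t ψ)
    (hpow : ∀ i r, 1 ≤ r → r < t i → ∃ j, i ≠ j ∧ cf ((0, ∅) : Mon m n)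
      (ψ (fd (mono (Pi.single i (p ^ r), ∅) 1) (.inl j)) (xv (.inl j))) = 0)
    {i j : Fin m} (hij : i ≠ j) {a : ℕ} (ha : a < p ^ t i) :
    ψ (fd (mono (Pi.single i a, ∅) 1) (.inl j)) = 0 := by
  have h2 := two_ne_zero_of_lt (F := F) hp
  induction a using Nat.strong_induction_on generalizing j with
  | _ a ih =>
  have hS {j : Fin m} (hij : i ≠ j) := single_mem_S0 (F := F) (p := p) (t := t) hn hij ha
  have hpar (b : ℕ) (j : Fin m) : mono (Pi.single i b, (∅ : Finset (Fin n))) (1 : F)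
      ∈ par F m n (tau (.inl j : Fin m ⊕ Fin n)) := par_mono (by simp [tau_inl]) 1
  have hD {j : Fin m} (hij : i ≠ j) (q : Fin m) :
      ψ ⁅(D (.inl q) : Module.End F (Alg F m n)), fd (mono (Pi.single i a, ∅) 1) (.inl j)⁆ = 0 := by
    rw [lie_D_fd (r := .inl j) q (hpar a j)]
    by_cases hq : q = i
    · subst hq
      rcases a with - | a
      · rw [D_inl_mono_zero (by simp), fd_zero, map_zero]
      · rw [Pi.single_add, D_inl_mono_add]
        exact ih a (by omega) hij (by omega)
    · rw [D_inl_mono_zero (by simp [hq]), fd_zero, map_zero]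
  have hH (j : Fin m) (q : Fin m) (k : Fin n) := lie_hop_fd (F := F) (p := p) (t := t)
    (a := (Pi.single i a, ∅)) (r := .inl j) hp ht q k (single_lt_pow ha) (by simp [tau_inl])
  obtain ⟨l, hli, hlj⟩ := exists_third hm i j
  by_cases ha0 : (a : F) = 0
  · rcases Nat.eq_zero_or_pos a with rfl | hpos
    · rw [Pi.single_zero, show mono ((0, ∅) : Mon m n) (1 : F) = one from rfl, fd_one, h.onD]
    by_cases hr : ∃ r, a = p ^ r
    · obtain ⟨r, rfl⟩ := hr
      have h1 : 1 ≤ r := by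
        by_contra hr
        rw [show r = 0 by omega] at ha0
        simp at ha0
      obtain ⟨j₀, hj₀, hc⟩ := hpow i r h1 ((Nat.pow_lt_pow_iff_right (by omega)).1 ha)
      have h0 := h.eq_smul hp hm hn ht (hS hj₀) (hD hj₀) (r := .inl j₀) (u := ∅)
        (fun l hl => by cases hl) (by simp [tau_inl]) (fun q k => by
          rw [hH]
          congr 1
          have hz : ((p ^ r : ℕ) : F) = 0 := ha0
          by_cases hq : q = i
          · subst hq; simp only [wt, Pi.single_eq_same, hz, Pi.zero_apply, Nat.cast_zero]
          · simp only [wt, Pi.single_eq_of_ne hq, Pi.zero_apply])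
      rw [hc, zero_smul] at h0
      by_cases hjj : j = j₀
      · rw [hjj, h0]
      have := (ker_lie h.der (h.x_eq_zero hp hm hn ht (Ne.symm hjj)) ⟨hS hj₀, h0⟩).2
      rw [lie_fd (r := .inl j) (s := .inl j₀) (par_xinl j₀) (hpar _ j₀),
        D_inl_mono_zero (by simp [hij.symm]), map_zero, fd_zero, D_x_self, mul_one', zero_sub]
        at this
      have := LinearMap.mem_ker.1 this
      rwa [map_neg, neg_eq_zero] at this
    · push Not at hr
      -- `[x_i^(b) D_l, x_i^(c) x_l D_j] = C(b + c, b) x_i^(b+c) D_j`, with both factors killed.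
      obtain ⟨b, c, hb, hc, rfl, hne⟩ := exists_choose_ne_zero (F := F) (p := p) hpos hr
      have hb' := ih b (by omega) hli.symm (by omega)
      have hZ := h.x_mul_single_eq_zero hp hm hn ht hli.symm hij hlj (a := b + c)
        (fun d hd => ih d hd hij (by omega)) (b := c) (by omega) (by omega)
      have := (ker_lie h.der
        ⟨single_mem_S0 (F := F) (p := p) (t := t) hn hli.symm (by omega : b < p ^ t i), hb'⟩ hZ).2
      rw [lie_fd (r := .inl l) (s := .inl j) (hpar _ l) (par_mono (by simp [tau_inl]) 1),
        D_inl_mono_add, D_inl_mono_zero (by simp [hij.symm]), map_zero, fd_zero, sub_zero,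
        mul_single] at this
      have hcoef : mulCoeff F (Pi.single i b, (∅ : Finset (Fin n))) (Pi.single i c, ∅)
          = ((b + c).choose b : F) := by
        simp only [mulCoeff, Finset.disjoint_empty_left, if_true, inversions_empty_left, pow_zero,
          mul_one]
        rw [Finset.prod_eq_single i]
        · simp
        · intro q _ hq; simp [hq]
        · intro h; exact absurd (Finset.mem_univ i) h
      rw [hcoef, ← Pi.single_add, Finset.union_empty, _root_.mul_one, _root_.one_mul,
        ← _root_.mul_one (((b + c).choose b : ℕ) : F), ← smul_mono,
        fd_smul] at this
      have := LinearMap.mem_ker.1 this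
      rw [map_smul] at this
      exact (smul_eq_zero.1 this).resolve_left hne
  · refine h.eq_zero hp hn ht (hS hij) (hD hij) (b := fun q => (if q = i then (a : F) else 0)
      - if q = j then 1 else 0) (v := fun _ => 0) (fun q k => ?_) hij hli.symm hlj.symm ?_
    · rw [hH]
      congr 1
      simp [wt, Pi.single_apply, eq_comm (a := j)]
    · simp only [hij, hij.symm, hli, hlj, if_true, if_false]
      rintro (⟨h4, h5⟩ | ⟨h4, h5⟩ | ⟨h4, h5⟩ | ⟨h4, h5⟩)
      · exact one_ne_zero (α := F) (by linear_combination -h5)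
      · exact h2 (by linear_combination h4 + h5)
      · exact ha0 (by linear_combination h4)
      · exact one_ne_zero (α := F) (by linear_combination -h4)

/-- The kernel is closed under brackets, so the generators in `homGen_le` suffice. Those not yet
treated, `x_i^(2) D_i + x_i ξ_s D_s` and `x_i ξ_k D_l`, have an even weight that is larger by `1` at
`i` than elsewhere; constant even parts allow only an exceptional value smaller by `1`. -/
theorem Normalized.eq_zero_of_mem_S0 (hp : 3 < p) (hm : 3 ≤ m) (hn : 3 ≤ n) (ht : ∀ i, 1 ≤ t i)
    (h : Normalized p t ψ) (hxi : ∀ k l, k ≠ l → ψ (fd (xi k) (.inr l)) = 0)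
    (hpair : ∀ k l, k ≠ l → ∀ i, ψ (fd (mono (0, {k, l}) 1) (.inl i)) = 0)
    (hpow : ∀ i r, 1 ≤ r → r < t i → ∃ j, i ≠ j ∧ cf ((0, ∅) : Mon m n)
      (ψ (fd (mono (Pi.single i (p ^ r), ∅) 1) (.inl j)) (xv (.inl j))) = 0)
    {y : Module.End F (Alg F m n)} (hy : y ∈ S0 F n p t) : ψ y = 0 := by
  have h2 := two_ne_zero_of_lt (F := F) hp
  have hpt := three_lt_pow hp ht
  have key : homGen F n p t 0 ≤ S0 F n p t ⊓ LinearMap.ker ψ := by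
    refine homGen_le hp hm hn ht (fun A hA B hB => ker_lie h.der hA hB) (fun i j s hij a ha => ?_)
      (fun i s => ?_) (fun k l hkl => ⟨fd_xi_mem_S0 hp hkl, hxi k l hkl⟩) (fun k l hkl i => ?_)
      (fun k l hkl i => ⟨fd_pair_mem_S0 hn hkl i, hpair k l hkl i⟩)
    · rw [Y_of_D_eq_zero (D_inl_mono_zero (by simp [hij.symm]) _ _)]
      exact ⟨single_mem_S0 hn hij ha, h.single_eq_zero hp hm hn ht hpow hij ha⟩
    · have hS : Y (mono (Pi.single i 2, ∅) (1 : F)) i s ∈ S0 F n p t :=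
        Y_mem_S0 (trunc_mono (single_lt_pow (by have := hpt i; omega)) 1) (par_mono (by simp) 1)
          (D_inr_mono_notMem (by simp) _ _) i
      refine ⟨hS, ?_⟩
      obtain ⟨j, hj, -⟩ := exists_third hm i i
      obtain ⟨l, hl, hlj⟩ := exists_third hm i j
      have h11 : (Pi.single i 2 : Fin m → ℕ) = Pi.single i 1 + Pi.single i 1 := by
        rw [← Pi.single_add]
      refine h.eq_zero hp hn ht hS (fun q => ?_) (b := fun q => if q = i then 1 else 0)
        (v := fun _ => 0) (fun q k => ?_) hj.symm hl.symm hlj.symm ?_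
      · rw [lie_D_Y q (par_mono (by simp) 1)]
        by_cases hq : q = i
        · subst hq
          rw [h11, D_inl_mono_add, ← xv_inl_eq, Y_x, h.onH]
        · rw [D_inl_mono_zero (by simp [hq]), Y_of_D_eq_zero (map_zero _), fd_zero, map_zero]
      · rw [Y, h11, D_inl_mono_add, xi, xv, mono_mul_disj (by simp), add_zero, lie_add, smul_add,
          lie_hop_fd (p := p) (t := t) hp ht q k (by
            rw [← h11]; exact single_lt_pow (by have := hpt i; omega)) (by simp [tau_inl]),
          lie_hop_fd (p := p) (t := t) hp ht q k (single_lt_pow (by have := hpt i; omega))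
            (by simp [tau_inr])]
        congr 2
        · simp only [wt, Pi.add_apply, Pi.single_apply, Finset.notMem_empty, if_false,
            Sum.inl.injEq, reduceCtorEq, eq_comm (a := q)]
          push_cast; ring
        · simp only [wt, Pi.single_apply, Finset.mem_singleton, Sum.inr.injEq, if_false,
            reduceCtorEq, eq_comm (a := s)]
          push_cast; ring
      · simp only [hj, hl, if_true, if_false]
        rintro (⟨h4, h5⟩ | ⟨h4, h5⟩ | ⟨h4, h5⟩ | ⟨h4, h5⟩)
        · exact one_ne_zero (α := F) h4
        · exact one_ne_zero (α := F) h4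
        · exact one_ne_zero (α := F) h4
        · exact h2 (by linear_combination h5)
    · rw [xi, xv, xv, mono_mul_disj (by simp), add_zero]
      have he : ((({k} : Finset (Fin n)).card : ℕ) : ZMod 2) = tau (.inr l : Fin m ⊕ Fin n) := by
        simp [tau_inr]
      have hS : fd (mono (Pi.single i 1, {k}) (1 : F)) (.inr l) ∈ S0 F n p t :=
        fd_mem_S0 hp (trunc_mono (single_lt_pow (by have := hpt i; omega)) 1) (par_mono he 1)
          (D_inr_mono_notMem (by simpa using hkl.symm) _ _)
      refine ⟨hS, ?_⟩
      obtain ⟨j, hj, -⟩ := exists_third hm i i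
      obtain ⟨s, hs, hsj⟩ := exists_third hm i j
      refine h.eq_zero hp hn ht hS (fun q => ?_) (b := fun q => if q = i then 1 else 0)
        (v := fun q => (if q = k then 1 else 0) - if q = l then 1 else 0) (fun q r => ?_)
        hj.symm hs.symm hsj.symm ?_
      · rw [lie_D_fd (r := .inr l) q (par_mono he 1)]
        by_cases hq : q = i
        · subst hq
          rw [← zero_add (Pi.single q 1), D_inl_mono_add]
          exact hxi k l hkl
        · rw [D_inl_mono_zero (by simp [hq]), fd_zero, map_zero]
      · rw [lie_hop_fd (p := p) (t := t) hp ht q r (single_lt_pow (by have := hpt i; omega)) he]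
        congr 1
        simp only [wt, Pi.single_apply, Finset.mem_singleton, Sum.inr.injEq, if_false,
          reduceCtorEq, eq_comm (a := l)]
        push_cast; ring
      · simp only [hj, hs, if_true, if_false]
        rintro (⟨h4, h5⟩ | ⟨h4, h5⟩ | ⟨h4, h5⟩ | ⟨h4, h5⟩)
        · exact one_ne_zero (α := F) h4
        · exact one_ne_zero (α := F) h4
        · exact one_ne_zero (α := F) h4
        · exact h2 (by linear_combination h5)
  exact (key (even_S_mem hy.1 hy.2)).2

/-- Every derivation from the even part of `S(m,n;t)` to the even part of `W(m,n;t)` is a sum of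
an inner derivation and a linear combination of powers of the `ad D_i`. -/
theorem exists_adl_add_powSum (hp : 3 < p) (hm : 3 ≤ m) (hn : 3 ≤ n) (ht : ∀ i, 1 ≤ t i)
    (hψ : ψ ∈ derEnd F n p t) : ∃ E ∈ W0 F n p t, ∃ c : Fin m → ℕ → F, ∀ y ∈ S0 F n p t,
      ψ y = adl E y + powSum n p t c y := by
  obtain ⟨E₁, hE₁, h1⟩ := exists_adl_D hp hm hn ht hψ
  have hψ₁ := Submodule.add_mem _ hψ (adl_mem_derEnd hE₁)
  obtain ⟨E₂, hE₂, h2D, h2H⟩ := exists_adl_hop hp hm hn ht hψ₁ h1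
  have n2 : Normalized p t (ψ + adl E₁ + adl E₂) :=
    ⟨Submodule.add_mem _ hψ₁ (adl_mem_derEnd hE₂), h2D, h2H⟩
  obtain ⟨z₁, n3, hxi⟩ := n2.exists_xi hp hm hn ht
  obtain ⟨z₂, n4, hxi', hpair⟩ := n3.exists_pair hp hm hn ht hxi
  choose j hj _ using fun i : Fin m => exists_third hm i i
  set χ := ψ + adl E₁ + adl E₂ + adl (oddTorus m z₁) + adl (oddTorus m z₂) with hχ
  -- The scalar by which the corrected derivation sends `x_i^(p^r) D_{j i}` to `D_{j i}`.
  -- Subtracting `powSum n p t c` removes it and keeps the values on `ξ_k D_l` and `ξ_k ξ_l D_i`,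
  -- which involve no `x_i`.
  set c : Fin m → ℕ → F := fun i r => cf ((0, ∅) : Mon m n)
    (χ (fd (mono (Pi.single i (p ^ r), ∅) 1) (.inl (j i))) (xv (.inl (j i))))
  have hp3 (r : ℕ) (hr : 1 ≤ r) : 1 < p ^ r := Nat.one_lt_pow (by omega) (by omega)
  have hpos (r : ℕ) (hr : 1 ≤ r) : 0 < p ^ r := pow_pos (by omega) _
  refine ⟨-(E₁ + E₂ + oddTorus m z₁ + oddTorus m z₂), Submodule.neg_mem _ (Submodule.add_mem _
    (Submodule.add_mem _ (Submodule.add_mem _ hE₁ hE₂) (oddTorus_mem z₁)) (oddTorus_mem z₂)), c,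
    fun y hy => ?_⟩
  have := (n4.sub_powSum hp hn c).eq_zero_of_mem_S0 hp hm hn ht (fun k l hkl => ?_)
    (fun k l hkl i => ?_) (fun i r h1 h2 => ⟨j i, (hj i).symm, ?_⟩) hy
  · rw [hχ] at this
    simp only [LinearMap.sub_apply, LinearMap.add_apply, adl_apply] at this
    rw [adl_apply, neg_lie, add_lie, add_lie, add_lie, eq_neg_add_iff_add_eq]
    rw [sub_eq_zero] at this
    rw [← this]; abel
  · rw [LinearMap.sub_apply, hxi' k l hkl, zero_sub, neg_eq_zero]
    exact powSum_eq_zero fun i r hr => adl_pow_fd_mono_eq_zero (by simp [tau_inr]) (hpos r hr)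
  · rw [LinearMap.sub_apply, hpair k l hkl, zero_sub, neg_eq_zero]
    refine powSum_eq_zero fun s r hr => adl_pow_fd_mono_eq_zero ?_ (hpos r hr)
    rw [Finset.card_pair hkl]; rfl
  · rw [LinearMap.sub_apply, LinearMap.sub_apply, map_sub, cf_powSum (by omega) c (j i) h1 h2,
      sub_eq_zero]

end

/-! ### The sum is direct -/

theorem cf_zero_mul (f g : Alg F m n) :
    cf ((0, ∅) : Mon m n) (mul f g) = cf ((0, ∅) : Mon m n) f * cf ((0, ∅) : Mon m n) g := by
  have : (LinearMap.compr₂ mul (cf ((0, ∅) : Mon m n)) : Alg F m n →ₗ[F] Alg F m n →ₗ[F] F)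
      = (LinearMap.mul F F).compl₁₂ (cf ((0, ∅) : Mon m n)) (cf ((0, ∅) : Mon m n)) := by
    refine alg_ext fun a => alg_ext fun b => ?_
    rw [LinearMap.compr₂_apply, LinearMap.compl₁₂_apply, LinearMap.mul_apply', mul_single, cf_mono,
      cf_mono, cf_mono]
    by_cases ha : a = (0, ∅)
    · by_cases hb : b = (0, ∅)
      · subst ha hb; simp [mulCoeff, inversions_empty_left]
      · rw [if_neg hb, mul_zero, if_neg]
        intro h
        subst ha
        exact hb (by simpa using h)
    · rw [if_neg ha, zero_mul, if_neg]
      intro h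
      rw [Prod.mk.injEq, Finset.union_eq_empty] at h
      refine ha (Prod.ext (funext fun i => ?_) h.2.1)
      have := congrFun h.1 i
      simp only [Pi.add_apply, Pi.zero_apply] at this ⊢
      omega
  exact LinearMap.congr_fun (LinearMap.congr_fun this f) g

/-- Every term of the bracket has as a factor `x_i^(N)` or one of its first derivatives, none of
which has a constant term if `N > 1`. -/
theorem cf_zero_adl {p : ℕ} {t : Fin m → ℕ} {E : Module.End F (Alg F m n)} (hE : E ∈ W0 F n p t)
    {i : Fin m} (j : Fin m) {N : ℕ} (hN : 1 < N) :
    cf ((0, ∅) : Mon m n) (adl E (fd (mono (Pi.single i N, ∅) 1) (.inl j)) (xv (.inl j))) = 0 := by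
  have h0 : cf ((0, ∅) : Mon m n) (mono (Pi.single i N, ∅) (1 : F)) = 0 := by
    rw [cf_mono, if_neg]
    intro h
    have := congrFun (congrArg Prod.fst h) i
    simp at this; omega
  obtain ⟨⟨f, -, rfl⟩, -⟩ := hE
  rw [adl_apply, Ring.lie_def, LinearMap.sub_apply, Module.End.mul_apply, Module.End.mul_apply,
    fd_xv, if_pos rfl, map_sub, fd_apply, cf_zero_mul, h0, zero_mul, sub_zero, vec_eq_sum,
    LinearMap.sum_apply, map_sum]
  refine Finset.sum_eq_zero fun r _ => ?_
  rw [fd_apply, cf_zero_mul]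
  rcases r with q | k
  · rw [cf_D_inl, cf_mono, if_neg, mul_zero]
    intro h
    have h1 := congrFun (congrArg Prod.fst h) i
    by_cases hq : i = q
    · subst hq; simp at h1; omega
    · simp [hq] at h1; omega
  · rw [D_inr_mono_notMem (by simp), map_zero, mul_zero]

section

variable {p : ℕ} [Fact p.Prime] [CharP F p] {t : Fin m → ℕ}

theorem powSum_eq_zero_of_adl (hp : 3 < p) (hm : 3 ≤ m) (hn : 3 ≤ n)
    {E : Module.End F (Alg F m n)} (hE : E ∈ W0 F n p t) {c : Fin m → ℕ → F}
    (h : ∀ y ∈ S0 F n p t, adl E y = powSum n p t c y) : powSum n p t c = 0 := by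
  refine Finset.sum_eq_zero fun i _ => Finset.sum_eq_zero fun r hr => ?_
  obtain ⟨h1, h2⟩ := Finset.mem_Ico.1 hr
  obtain ⟨j, hj, -⟩ := exists_third hm i i
  have := h _ (single_mem_S0 (F := F) hn hj.symm
    (Nat.pow_lt_pow_right (by omega : 1 < p) h2))
  have h3 := cf_powSum (n := n) (by omega : 1 < p) c j h1 h2
  rw [← this, cf_zero_adl hE j (Nat.one_lt_pow (by omega) (by omega))] at h3
  rw [← h3, zero_smul]

/-! ### Derivations on subtypes -/

theorem exists_lift {y : Module.End F (Alg F m n)} (hy : y ∈ S0 F n p t) :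
    ∃ x : evenS F n p t, ((x : evenW F n p t) : Module.End F (Alg F m n)) = y :=
  ⟨⟨⟨y, S0_le_W0 hy⟩, hy.1⟩, rfl⟩

theorem coe_mem_S0 (x : evenS F n p t) :
    ((x : evenW F n p t) : Module.End F (Alg F m n)) ∈ S0 F n p t :=
  ⟨x.2, x.1.2.2⟩

theorem mem_derSW_iff {φ : evenS F n p t →ₗ[F] evenW F n p t} :
    φ ∈ derSW F n p t ↔ ∀ x y : evenS F n p t,
      ((φ ⁅x, y⁆ : evenW F n p t) : Module.End F (Alg F m n))
        = ⁅((x : evenW F n p t) : Module.End F (Alg F m n)), (φ y : Module.End F (Alg F m n))⁆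
          - ⁅((y : evenW F n p t) : Module.End F (Alg F m n)),
              (φ x : Module.End F (Alg F m n))⁆ := by
  constructor
  · rintro ⟨d, rfl⟩ x y
    exact congrArg Subtype.val (d.apply_lie_eq_sub x y)
  · intro h
    exact ⟨⟨φ, fun x y => Subtype.ext (h x y)⟩, rfl⟩

theorem coe_ad_pow (i : Fin m) (N : ℕ) (w : evenW F n p t) :
    (((LieAlgebra.ad F _ (DW F n p t i) ^ N) w : evenW F n p t) : Module.End F (Alg F m n))
      = (adl (D (.inl i)) ^ N) (w : Module.End F (Alg F m n)) := by
  induction N with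
  | zero => rfl
  | succ N ih =>
    rw [pow_succ', pow_succ', Module.End.mul_apply, Module.End.mul_apply, ← ih]
    rfl

theorem restrictS_mem_derSW {A : Module.End F (evenW F n p t)}
    {ψ : Module.End F (Module.End F (Alg F m n))} (hψ : ψ ∈ derEnd F n p t)
    (h : ∀ w, ((A w : evenW F n p t) : Module.End F (Alg F m n)) = ψ w) :
    restrictS F n p t A ∈ derSW F n p t := by
  refine mem_derSW_iff.2 fun x y => ?_
  change ((A _ : evenW F n p t) : Module.End F (Alg F m n))
    = ⁅_, ((A _ : evenW F n p t) : Module.End F (Alg F m n))⁆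
      - ⁅_, ((A _ : evenW F n p t) : Module.End F (Alg F m n))⁆
  rw [h, h, h]
  exact hψ.2 _ (coe_mem_S0 x) _ (coe_mem_S0 y)

/-- A linear left inverse of the inclusion of `𝒮` extends the derivation to all operators. Its
values off `𝒮` play no role, since `derEnd` restricts only what happens on `S0`. -/
theorem exists_derEnd {φ : evenS F n p t →ₗ[F] evenW F n p t} (hφ : φ ∈ derSW F n p t) :
    ∃ ψ ∈ derEnd F n p t, ∀ x : evenS F n p t,
      ψ ((x : evenW F n p t) : Module.End F (Alg F m n)) = φ x := by
  set ι : evenS F n p t →ₗ[F] Module.End F (Alg F m n) :=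
    (evenW F n p t).toSubmodule.subtype ∘ₗ (evenS F n p t).toSubmodule.subtype with hι
  obtain ⟨g, hg⟩ := ι.exists_leftInverse_of_injective
    (LinearMap.ker_eq_bot.2 (Subtype.val_injective.comp Subtype.val_injective))
  have key (x : evenS F n p t) :
      ((evenW F n p t).toSubmodule.subtype ∘ₗ φ ∘ₗ g) ((x : evenW F n p t) :
        Module.End F (Alg F m n)) = φ x :=
    congrArg (fun z => ((φ z : evenW F n p t) : Module.End F (Alg F m n)))
      (LinearMap.congr_fun hg x)
  refine ⟨_, ⟨fun y hy => ?_, fun x hx y hy => ?_⟩, key⟩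
  · obtain ⟨x, rfl⟩ := exists_lift hy
    rw [key]
    exact (φ x).2
  · obtain ⟨x, rfl⟩ := exists_lift hx
    obtain ⟨y, rfl⟩ := exists_lift hy
    have := key ⁅x, y⁆
    rw [mem_derSW_iff.1 hφ x y] at this
    rw [key, key]
    exact this

theorem exists_of_mem_adW {φ : evenS F n p t →ₗ[F] evenW F n p t} (hφ : φ ∈ adW F n p t) :
    ∃ E ∈ W0 F n p t, ∀ x : evenS F n p t,
      (φ x : Module.End F (Alg F m n)) = adl E (x : evenW F n p t) := by
  rw [adW] at hφ
  induction hφ using Submodule.span_induction with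
  | mem φ h => obtain ⟨E, rfl⟩ := h; exact ⟨E, E.2, fun x => rfl⟩
  | zero => exact ⟨0, Submodule.zero_mem _, fun x => by simp [adl_apply]⟩
  | add φ χ _ _ h1 h2 =>
    obtain ⟨E, hE, h1⟩ := h1
    obtain ⟨G, hG, h2⟩ := h2
    refine ⟨E + G, Submodule.add_mem _ hE hG, fun x => ?_⟩
    rw [adl_apply, add_lie, ← adl_apply, ← adl_apply, ← h1, ← h2]
    rfl
  | smul c φ _ h1 =>
    obtain ⟨E, hE, h1⟩ := h1
    refine ⟨c • E, Submodule.smul_mem _ c hE, fun x => ?_⟩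
    rw [adl_apply, smul_lie, ← adl_apply, ← h1]
    rfl

theorem exists_of_mem_adPowers {φ : evenS F n p t →ₗ[F] evenW F n p t}
    (hφ : φ ∈ adPowers F n p t) : ∃ c : Fin m → ℕ → F, ∀ x : evenS F n p t,
      (φ x : Module.End F (Alg F m n)) = powSum n p t c (x : evenW F n p t) := by
  rw [adPowers] at hφ
  induction hφ using Submodule.span_induction with
  | mem φ h =>
    obtain ⟨i, r, h1, h2, rfl⟩ := h
    refine ⟨fun j s => if j = i ∧ s = r then 1 else 0, fun x => ?_⟩
    rw [powSum_apply, Finset.sum_eq_single i, Finset.sum_eq_single r, if_pos ⟨rfl, rfl⟩, one_smul]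
    · exact coe_ad_pow i _ _
    · intro s _ hs; rw [if_neg (fun h => hs h.2), zero_smul]
    · intro h; exact absurd (Finset.mem_Ico.2 ⟨h1, h2⟩) h
    · intro j _ hj
      refine Finset.sum_eq_zero fun s _ => ?_
      rw [if_neg (fun h => hj h.1), zero_smul]
    · intro h; exact absurd (Finset.mem_univ i) h
  | zero => exact ⟨0, fun x => by simp [powSum_apply]⟩
  | add φ χ _ _ h1 h2 =>
    obtain ⟨c, h1⟩ := h1
    obtain ⟨d, h2⟩ := h2
    refine ⟨c + d, fun x => ?_⟩
    have : ((φ + χ) x : Module.End F (Alg F m n)) = φ x + χ x := rfl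
    rw [this, h1, h2]
    simp only [powSum_apply, Pi.add_apply, add_smul, Finset.sum_add_distrib]
  | smul a φ _ h1 =>
    obtain ⟨c, h1⟩ := h1
    refine ⟨a • c, fun x => ?_⟩
    have : ((a • φ) x : Module.End F (Alg F m n)) = a • (φ x : Module.End F (Alg F m n)) := rfl
    rw [this, h1]
    simp only [powSum_apply, Pi.smul_apply, smul_assoc, Finset.smul_sum]

theorem exists_mem_adPowers (c : Fin m → ℕ → F) : ∃ φ ∈ adPowers F n p t, ∀ x : evenS F n p t,
    (φ x : Module.End F (Alg F m n)) = powSum n p t c (x : evenW F n p t) := by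
  refine ⟨∑ i, ∑ r ∈ Finset.Ico 1 (t i),
    c i r • restrictS F n p t (LieAlgebra.ad F _ (DW F n p t i) ^ p ^ r),
    Submodule.sum_mem _ fun i _ => Submodule.sum_mem _ fun r hr => Submodule.smul_mem _ _
      (Submodule.subset_span ⟨i, r, (Finset.mem_Ico.1 hr).1, (Finset.mem_Ico.1 hr).2, rfl⟩),
    fun x => ?_⟩
  rw [powSum_apply]
  change (evenW F n p t).toSubmodule.subtype _ = _
  simp only [LinearMap.sum_apply, map_sum, LinearMap.smul_apply, map_smul]
  exact Finset.sum_congr rfl fun i _ => Finset.sum_congr rfl fun r _ =>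
    congrArg _ (coe_ad_pow i _ _)

end

end

end CartanType

theorem theorem4p3p6 (F : Type*) [Field F] (p : ℕ) [Fact p.Prime] [CharP F p] (hp : 3 < p)
    (m n : ℕ) (hm : 3 ≤ m) (hn : 3 ≤ n) (t : Fin m → ℕ) (ht : ∀ i, 1 ≤ t i) :
    CartanType.derSW F n p t = CartanType.adW F n p t ⊔ CartanType.adPowers F n p t ∧
      Disjoint (CartanType.adW F n p t) (CartanType.adPowers F n p t) := by
  refine ⟨le_antisymm (fun φ hφ => ?_) (sup_le (Submodule.span_le.2 ?_) (Submodule.span_le.2 ?_)),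
    Submodule.disjoint_def.2 fun φ h1 h2 => ?_⟩
  · obtain ⟨ψ, hψ, h⟩ := CartanType.exists_derEnd hφ
    obtain ⟨E, hE, c, hc⟩ := CartanType.exists_adl_add_powSum hp hm hn ht hψ
    obtain ⟨χ, hχ, h'⟩ := CartanType.exists_mem_adPowers (n := n) (p := p) (t := t) c
    refine Submodule.mem_sup.2 ⟨CartanType.restrictS F n p t (LieAlgebra.ad F _ ⟨E, hE⟩),
      Submodule.subset_span ⟨_, rfl⟩, χ, hχ, LinearMap.ext fun x => Subtype.ext ?_⟩
    rw [← h, hc _ (CartanType.coe_mem_S0 x), ← h']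
    rfl
  · rintro _ ⟨E, rfl⟩
    exact CartanType.restrictS_mem_derSW (CartanType.adl_mem_derEnd E.2) fun w => rfl
  · rintro _ ⟨i, r, -, -, rfl⟩
    exact CartanType.restrictS_mem_derSW
      (CartanType.adl_pow_mem_derEnd (CartanType.DW F n p t i).2 r) fun w =>
        CartanType.coe_ad_pow i _ w
  · obtain ⟨E, hE, h1⟩ := CartanType.exists_of_mem_adW h1
    obtain ⟨c, h2⟩ := CartanType.exists_of_mem_adPowers h2
    have := CartanType.powSum_eq_zero_of_adl hp hm hn hE (c := c) fun y hy => by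
      obtain ⟨x, rfl⟩ := CartanType.exists_lift hy
      rw [← h1, h2]
    refine LinearMap.ext fun x => Subtype.ext ?_
    rw [h2, this]
    rfl
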